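/- **Setting.** Let $0=x_0<x_1<x_2<\dots$ be a strictly increasing sequence of reals with $\lim_n x_n=b\in(0,+\infty]$, put $\mathcal I=[0,b)$, $X=\{x_n\}_{n\ge 0}$, $d_n=x_n-x_{n-1}$ ($n\ge1$), and assume $d^*=\sup_n d_n<\infty$. Let $W^{2,2}(\mathcal I\setminus X)=\{f\in L^2(\mathcal I): f,f'\in AC_{loc}(\mathcal I\setminus X),\ f''\in L^2(\mathcal I)\}$ and let $\mathrm H_{\min}=-\frac{d^2}{dx^2}$ in $L^2(\mathcal I)$ with domain $W^{2,2}_0(\mathcal I\setminus X)$, the set of $f\in W^{2,2}(\mathcal I\setminus X)$ with $f(x_{n-1}+)=f(x_n-)=f'(x_{n-1}+)=f'(x_n-)=0$ for all $n\ge1$. Then $\operatorname{dom}\mathrm H_{\min}^*=W^{2,2}(\mathcal I\setminus X)$. For $f$ in this space set $$\Gamma_0^{(n)}f=\begin{pmatrix} d_n^{1/2}f(x_{n-1}+)\\ -d_n^{1/2}f(x_n-)\end{pmatrix},\qquad \Gamma_1^{(n)}f=\begin{pmatrix} d_n^{-3/2}\bigl(d_nf'(x_{n-1}+)+f(x_{n-1}+)-f(x_n-)\bigr)\\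 d_n^{-3/2}\bigl(d_nf'(x_n-)+f(x_{n-1}+)-f(x_n-)\bigr)\end{pmatrix},$$ and $\Gamma_j=\bigoplus_{n\ge1}\Gamma_j^{(n)}$ with values in $\mathcal H=l_2(\mathbb N,\mathbb C^2)$. For a closed linear relation $\Theta$ in $\mathcal H$ (a closed subspace of $\mathcal H\oplus\mathcal H$) let $\mathrm H_\Theta$ be the restriction of $\mathrm H_{\min}^*$ to $\{f\in\operatorname{dom}\mathrm H_{\min}^*:\{\Gamma_0f,\Gamma_1f\}\in\Theta\}$. For a linear relation $T$ (an operator being identified with its graph), $T^*=\{\{h,h'\}:(f',h)=(f,h')\text{ for all }\{f,f'\}\in T\}$; $T$ is symmetric if $T\subseteq T^*$, self-adjoint if $T=T^*$; $\mathrm n_\pm(T)=\dim\ker(T^*\mp i)\in\{0,1,\dots,\infty\}$ for symmetric $T$; $T$ is lower semibounded if for some $c\in\mathbb R$ one has $(f',f)\ge c\|f\|^2$ for all $\{f,f'\}\in T$; $\rho(T)$ is the set of $z\in\mathbb C$ for which $(T-z)^{-1}=\{\{f'-zf,f\}:\{f,f'\}\in T\}$ is an everywhere defined bounded operator, and $\sigma(T)=\mathbb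 C\setminus\rho(T)$; a self-adjoint $T$ has discrete spectrum if every point of $\sigma(T)$ is isolated in $\sigma(T)$ and an eigenvalue of finite multiplicity. $\mathfrak S_p$, $0<p<\infty$, is the Schatten–von Neumann ideal of the operators whose singular numbers lie in $\ell_p$, and $\mathfrak S_\infty$ is the ideal of compact operators. **Theorem.** Let $\Theta,\widetilde\Theta$ be closed linear relations in $\mathcal H$. Then: (i) $\mathrm H_\Theta$ is symmetric (self-adjoint) if and only if $\Theta$ is symmetric (self-adjoint), and, when they are symmetric, $\mathrm n_\pm(\mathrm H_\Theta)=\mathrm n_\pm(\Theta)$. (ii) If $\mathrm H_\Theta$ is symmetric (in particular, if it is self-adjoint), then $\mathrm H_\Theta$ is lower semibounded if and only if $\Theta$ is lower semibounded. (iii) For all $p\in(0,\infty]$, $z\in\rho(\mathrm H_\Theta)\cap\rho(\mathrm H_{\widetilde\Theta})$ and $\zeta\in\rho(\Theta)\cap\rho(\widetilde\Theta)$, $$(\mathrm H_\Theta-z)^{-1}-(\mathrm H_{\widetilde\Theta}-z)^{-1}\in\mathfrak S_p\iff(\Theta-\zeta)^{-1}-(\widetilde\Theta-\zeta)^{-1}\in\mathfrak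 S_p .$$ (iv) If $\mathrm H_\Theta$ is self-adjoint, then $\mathrm H_\Theta$ has discrete spectrum if and only if $\lim_{n\to\infty}d_n=0$ and $\Theta$ has discrete spectrum. -/

import Mathlib

open Set Filter Topology MeasureTheory
open scoped ENNReal

noncomputable section

/-! ### Linear relations in a Hilbert space

A linear relation in `E` is a linear subspace of `E × E`; an operator is identified with its graph.
The adjoint relation is Mathlib's `Submodule.adjoint`. -/

namespace LinRel

variable {E : Type*} [NormedAddCommGroup E] [InnerProductSpace ℂ E]

/-- `T` is symmetric: `T ⊆ T*`. -/
def IsSymmetric (T : Submodule ℂ (E × E)) : Prop := T ≤ T.adjoint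

/-- `T` is self-adjoint: `T = T*`. -/
def IsSelfAdjoint (T : Submodule ℂ (E × E)) : Prop := T = T.adjoint

/-- `ker (T - z) = {f | {f, z f} ∈ T}`. -/
def eigenspace (T : Submodule ℂ (E × E)) (z : ℂ) : Submodule ℂ E :=
  T.comap (LinearMap.prod LinearMap.id (z • LinearMap.id))

/-- The dimension, in `ℕ∞`, of the defect subspace `ker (T* - z)`. -/
def defect (T : Submodule ℂ (E × E)) (z : ℂ) : ℕ∞ :=
  Cardinal.toENat (Module.rank ℂ (eigenspace T.adjoint z))

/-- `n₊(T) = dim ker (T* - i)`. -/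
def deficiencyPlus (T : Submodule ℂ (E × E)) : ℕ∞ := defect T Complex.I

/-- `n₋(T) = dim ker (T* + i)`. -/
def deficiencyMinus (T : Submodule ℂ (E × E)) : ℕ∞ := defect T (-Complex.I)

/-- `(f', f) ≥ c (f, f)` for all `{f, f'} ∈ T`, with some real `c`. -/
def IsLowerSemibounded (T : Submodule ℂ (E × E)) : Prop :=
  ∃ c : ℝ, ∀ f f' : E, (f, f') ∈ T → c * ‖f‖ ^ 2 ≤ (inner ℂ f f' : ℂ).re

/-- The relation `(T - z)⁻¹ = {{f' - z f, f} | {f, f'} ∈ T}`. -/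
def shiftInv (T : Submodule ℂ (E × E)) (z : ℂ) : Submodule ℂ (E × E) :=
  T.map (LinearMap.prod (LinearMap.snd ℂ E E - z • LinearMap.fst ℂ E E) (LinearMap.fst ℂ E E))

/-- `ρ(T)`: the `z` for which `(T - z)⁻¹` is an everywhere defined bounded operator. -/
def resolventSet (T : Submodule ℂ (E × E)) : Set ℂ :=
  {z | ∃ R : E →L[ℂ] E, shiftInv T z = (R : E →ₗ[ℂ] E).graph}

open Classical in
/-- The bounded operator `(T - z)⁻¹`, for `z ∈ ρ(T)` (and `0` otherwise). -/
def resolvent (T : Submodule ℂ (E × E)) (z : ℂ) : E →L[ℂ] E :=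
  if h : ∃ R : E →L[ℂ] E, shiftInv T z = (R : E →ₗ[ℂ] E).graph then h.choose else 0

/-- `σ(T) = ℂ \ ρ(T)`. -/
def spectrum (T : Submodule ℂ (E × E)) : Set ℂ := (resolventSet T)ᶜ

/-- Discreteness of the spectrum of a self-adjoint relation: every point of the spectrum is an
isolated point of it and an eigenvalue of finite multiplicity. -/
def HasDiscreteSpectrum (T : Submodule ℂ (E × E)) : Prop :=
  ∀ z ∈ spectrum T, (∃ U ∈ 𝓝 z, U ∩ spectrum T = {z}) ∧
    eigenspace T z ≠ ⊥ ∧ FiniteDimensional ℂ (eigenspace T z)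

end LinRel

/-! ### The ideals `𝔖_p` -/

/-- The `n`-th singular number (`n = 0, 1, …`) of a bounded operator in a Hilbert space, as the
distance to the operators of rank at most `n`. -/
def singularNumber {E : Type*} [NormedAddCommGroup E] [InnerProductSpace ℂ E]
    (T : E →L[ℂ] E) (n : ℕ) : ℝ :=
  sInf {r : ℝ | ∃ F : E →L[ℂ] E, LinearMap.rank (F : E →ₗ[ℂ] E) ≤ n ∧ r = ‖T - F‖}

/-- `T ∈ 𝔖_p`, `0 < p ≤ ∞`: the singular numbers are in `ℓ_p`, and for `p = ∞` the operator is
compact. -/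
def MemSchatten {E : Type*} [NormedAddCommGroup E] [InnerProductSpace ℂ E]
    (p : ℝ≥0∞) (T : E →L[ℂ] E) : Prop :=
  if p = ⊤ then IsCompactOperator T else Summable fun n : ℕ => singularNumber T n ^ p.toReal

/-! ### Absolutely continuous functions: facts used in the definitions below -/

/-- `f` is absolutely continuous on every compact interval contained in `U`. -/
def LocallyAC (f : ℝ → ℂ) (U : Set ℝ) : Prop :=
  ∀ a b : ℝ, uIcc a b ⊆ U → AbsolutelyContinuousOnInterval f a b

theorem AbsolutelyContinuousOnInterval.comp_lip {f : ℝ → ℂ} {a b : ℝ}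
    (hf : AbsolutelyContinuousOnInterval f a b) {g : ℂ → ℝ} (hg : ∀ x y, dist (g x) (g y) ≤ dist x y) :
    AbsolutelyContinuousOnInterval (fun x => g (f x)) a b := by
  refine squeeze_zero (fun _ => Finset.sum_nonneg fun _ _ => dist_nonneg) (fun E => ?_) hf
  exact Finset.sum_le_sum fun _ _ => hg _ _

theorem AbsolutelyContinuousOnInterval.congr_on {f g : ℝ → ℂ} {a b : ℝ}
    (hf : AbsolutelyContinuousOnInterval f a b) (h : ∀ t ∈ uIcc a b, f t = g t) :
    AbsolutelyContinuousOnInterval g a b := by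
  rw [absolutelyContinuousOnInterval_iff] at hf ⊢
  intro ε hε
  obtain ⟨δ, hδ, H⟩ := hf ε hε
  refine ⟨δ, hδ, fun E hE hlt => ?_⟩
  have := H E hE hlt
  refine lt_of_eq_of_lt (Finset.sum_congr rfl fun i hi => ?_) this
  have h1 := hE.1 i hi
  rw [h _ h1.1, h _ h1.2]

theorem AbsolutelyContinuousOnInterval.ae_diff {f : ℝ → ℂ} {a b : ℝ}
    (hf : AbsolutelyContinuousOnInterval f a b) :
    ∀ᵐ t, t ∈ uIcc a b → DifferentiableAt ℝ f t := by
  have h1 := (hf.comp_lip (g := Complex.re)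
    (fun x y => by
      rw [Real.dist_eq, Complex.dist_eq, ← Complex.sub_re]; exact Complex.abs_re_le_norm _)).ae_differentiableAt
  have h2 := (hf.comp_lip (g := Complex.im)
    (fun x y => by
      rw [Real.dist_eq, Complex.dist_eq, ← Complex.sub_im]; exact Complex.abs_im_le_norm _)).ae_differentiableAt
  filter_upwards [h1, h2] with t h1 h2 ht
  have h3 := (Complex.ofRealCLM.differentiableAt.comp t (h1 ht)).add
    ((Complex.ofRealCLM.differentiableAt.comp t (h2 ht)).mul_const Complex.I)
  have h4 : f = (Complex.ofRealCLM ∘ fun x => (f x).re) +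
      fun y => (Complex.ofRealCLM ∘ fun x => (f x).im) y * Complex.I := by
    funext s
    simp [Complex.re_add_im]
  rw [h4]
  exact h3

theorem AbsolutelyContinuousOnInterval.complex_ftc {f : ℝ → ℂ} {a b : ℝ}
    (hf : AbsolutelyContinuousOnInterval f a b) :
    IntervalIntegrable (deriv f) volume a b ∧ ∫ t in a..b, deriv f t = f b - f a := by
  have hre := hf.comp_lip (g := Complex.re) (fun x y => by
      rw [Real.dist_eq, Complex.dist_eq, ← Complex.sub_re]; exact Complex.abs_re_le_norm _)
  have him := hf.comp_lip (g := Complex.im) (fun x y => by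
      rw [Real.dist_eq, Complex.dist_eq, ← Complex.sub_im]; exact Complex.abs_im_le_norm _)
  have hi1 : IntervalIntegrable (fun t => ((deriv (fun s => (f s).re) t : ℝ) : ℂ)) volume a b :=
    ⟨hre.intervalIntegrable_deriv.1.ofReal, hre.intervalIntegrable_deriv.2.ofReal⟩
  have hi2 : IntervalIntegrable (fun t => ((deriv (fun s => (f s).im) t : ℝ) : ℂ) * Complex.I)
      volume a b :=
    IntervalIntegrable.mul_const
      ⟨him.intervalIntegrable_deriv.1.ofReal, him.intervalIntegrable_deriv.2.ofReal⟩ _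
  have hae : ∀ᵐ t, t ∈ uIoc a b → ((deriv (fun s => (f s).re) t : ℝ) : ℂ) +
      ((deriv (fun s => (f s).im) t : ℝ) : ℂ) * Complex.I = deriv f t := by
    filter_upwards [hf.ae_diff] with t ht hm
    have hd := (ht (uIoc_subset_uIcc hm)).hasDerivAt
    have h1 : deriv (fun s => (f s).re) t = (deriv f t).re :=
      (Complex.reCLM.hasFDerivAt.comp_hasDerivAt t hd).deriv
    have h2 : deriv (fun s => (f s).im) t = (deriv f t).im :=
      (Complex.imCLM.hasFDerivAt.comp_hasDerivAt t hd).deriv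
    rw [h1, h2, Complex.re_add_im]
  refine ⟨(hi1.add hi2).congr_ae ((ae_restrict_iff' measurableSet_uIoc).2 hae), ?_⟩
  rw [← intervalIntegral.integral_congr_ae hae, intervalIntegral.integral_add hi1 hi2,
    intervalIntegral.integral_mul_const, intervalIntegral.integral_ofReal,
    intervalIntegral.integral_ofReal, hre.integral_deriv_eq_sub, him.integral_deriv_eq_sub]
  apply Complex.ext <;> simp

theorem uIcc_subset_Ioo' {p q s t : ℝ} (hs : s ∈ Ioo p q) (ht : t ∈ Ioo p q) :
    uIcc s t ⊆ Ioo p q := by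
  intro r hr
  exact ⟨lt_of_lt_of_le (lt_min hs.1 ht.1) hr.1, lt_of_le_of_lt hr.2 (max_lt hs.2 ht.2)⟩

theorem LocallyAC.differentiableAt {u : ℝ → ℂ} {p q : ℝ} (hu : LocallyAC u (Ioo p q))
    (hu' : LocallyAC (deriv u) (Ioo p q)) {t : ℝ} (ht : t ∈ Ioo p q) : DifferentiableAt ℝ u t := by
  obtain ⟨c, hpc, hct⟩ := exists_between ht.1
  obtain ⟨e, hte, heq⟩ := exists_between ht.2
  have hc : c ∈ Ioo p q := ⟨hpc, hct.trans ht.2⟩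
  have he : e ∈ Ioo p q := ⟨ht.1.trans hte, heq⟩
  have hcont : ContinuousOn (deriv u) (Icc c e) := by
    have := (hu' c e (uIcc_subset_Ioo' hc he)).continuousOn
    rwa [uIcc_of_le (hct.trans hte).le] at this
  have hcat : ContinuousAt (deriv u) t := hcont.continuousAt (Icc_mem_nhds hct hte)
  have h1 := intervalIntegral.integral_hasDerivAt_right
    (hu c t (uIcc_subset_Ioo' hc ht)).complex_ftc.1
    ((hcont.mono Ioo_subset_Icc_self).stronglyMeasurableAtFilter isOpen_Ioo t ⟨hct, hte⟩) hcat
  have h2 : (fun s => u c + ∫ r in c..s, deriv u r) =ᶠ[𝓝 t] u := by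
    filter_upwards [Ioo_mem_nhds ht.1 ht.2] with s hs
    rw [(hu c s (uIcc_subset_Ioo' hc hs)).complex_ftc.2]
    ring
  exact ((h1.const_add (u c)).congr_of_eventuallyEq h2.symm).differentiableAt

/-- A locally absolutely continuous function with integrable derivative extends continuously to
the end points. -/
theorem LocallyAC.exists_extension {v : ℝ → ℂ} {p q : ℝ} (hpq : p < q)
    (hv : LocallyAC v (Ioo p q)) (hi : IntegrableOn (deriv v) (Ioo p q)) :
    ∃ G : ℝ → ℂ, ContinuousOn G (Icc p q) ∧ EqOn v G (Ioo p q) := by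
  obtain ⟨c, hpc, hcq⟩ := exists_between hpq
  refine ⟨fun t => v c + ∫ r in c..t, deriv v r, ?_, fun t ht => ?_⟩
  · have h1 : IntervalIntegrable (deriv v) volume p q :=
      (intervalIntegrable_iff_integrableOn_Ioo_of_le hpq.le).2 hi
    have h2 := intervalIntegral.continuousOn_primitive_interval' h1 (a := c)
      (by rw [uIcc_of_le hpq.le]; exact ⟨hpc.le, hcq.le⟩)
    rw [uIcc_of_le hpq.le] at h2
    exact continuousOn_const.add h2
  · simp only [(hv c t (uIcc_subset_Ioo' ⟨hpc, hcq⟩ ht)).complex_ftc.2]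
    ring

theorem exists_tendsto_of_extension {v G : ℝ → ℂ} {p q : ℝ} (hpq : p < q)
    (hG : ContinuousOn G (Icc p q)) (h : EqOn v G (Ioo p q)) :
    (∃ y, Tendsto v (𝓝[>] p) (𝓝 y)) ∧ ∃ y, Tendsto v (𝓝[<] q) (𝓝 y) := by
  refine ⟨⟨G p, ?_⟩, ⟨G q, ?_⟩⟩
  · have h1 : Tendsto G (𝓝[Ioo p q] p) (𝓝 (G p)) :=
      (hG p (left_mem_Icc.2 hpq.le)).mono Ioo_subset_Icc_self
    rw [nhdsWithin_Ioo_eq_nhdsGT hpq] at h1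
    exact h1.congr' (by filter_upwards [Ioo_mem_nhdsGT hpq] with t ht using (h ht).symm)
  · have h1 : Tendsto G (𝓝[Ioo p q] q) (𝓝 (G q)) :=
      (hG q (right_mem_Icc.2 hpq.le)).mono Ioo_subset_Icc_self
    rw [nhdsWithin_Ioo_eq_nhdsLT hpq] at h1
    exact h1.congr' (by filter_upwards [Ioo_mem_nhdsLT hpq] with t ht using (h ht).symm)

/-! ### The interval and the points -/

/-- A strictly increasing sequence `0 = x₀ < x₁ < x₂ < …` with limit `b ∈ (0, +∞]`. -/
structure PointSeq where
  x : ℕ → ℝ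
  b : EReal
  zero : x 0 = 0
  strictMono : StrictMono x
  tendsto : Tendsto (fun n => (x n : EReal)) atTop (𝓝 b)

namespace PointSeq

variable (X : PointSeq)

/-- The interval `I = [0, b)`. -/
def interval : Set ℝ := {t | 0 ≤ t ∧ (t : EReal) < X.b}

/-- The set `I \ X`. -/
def gaps : Set ℝ := X.interval \ range X.x

/-- The length of the `n`-th interval `[xₙ, xₙ₊₁]`, `n = 0, 1, …`. -/
def d (n : ℕ) : ℝ := X.x (n + 1) - X.x n

/-- Lebesgue measure on `I`. -/
abbrev vol : Measure ℝ := volume.restrict X.interval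

/-- `L²(I)`. -/
abbrev L2 : Type := Lp ℂ 2 X.vol

theorem lt_b (n : ℕ) : (X.x n : EReal) < X.b := by
  have h : Monotone fun n => (X.x n : EReal) :=
    fun i j hij => EReal.coe_le_coe_iff.2 (X.strictMono.monotone hij)
  exact lt_of_lt_of_le (EReal.coe_lt_coe_iff.2 (X.strictMono n.lt_succ_self))
    (h.ge_of_tendsto X.tendsto (n + 1))

theorem gaps_eq : X.gaps = ⋃ n, Ioo (X.x n) (X.x (n + 1)) := by
  ext t
  simp only [gaps, interval, Set.mem_sdiff, mem_ofPred_eq, mem_range, not_exists, mem_iUnion, mem_Ioo]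
  constructor
  · rintro ⟨⟨h0, hb⟩, hne⟩
    have hex : ∃ n, t < X.x n := by
      obtain ⟨n, hn⟩ := (X.tendsto.eventually (lt_mem_nhds hb)).exists
      exact ⟨n, EReal.coe_lt_coe_iff.1 hn⟩
    classical
    rcases hN : Nat.find hex with _ | n
    · have := Nat.find_spec hex
      rw [hN, X.zero] at this
      exact absurd this (not_lt.2 h0)
    · have h1 := Nat.find_spec hex
      rw [hN] at h1
      have h2 := Nat.find_min hex (m := n) (by omega)
      exact ⟨n, lt_of_le_of_ne (not_lt.1 h2) (hne n), h1⟩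
  · rintro ⟨n, h1, h2⟩
    refine ⟨⟨?_, (EReal.coe_lt_coe_iff.2 h2).trans (X.lt_b _)⟩, fun m hm => ?_⟩
    · have := X.strictMono.monotone (Nat.zero_le n)
      rw [X.zero] at this
      linarith
    · subst hm
      have h3 := X.strictMono.lt_iff_lt.1 h1
      have h4 := X.strictMono.lt_iff_lt.1 h2
      omega

theorem Ioo_subset_gaps (n : ℕ) : Ioo (X.x n) (X.x (n + 1)) ⊆ X.gaps := by
  rw [gaps_eq]
  exact subset_iUnion (fun n => Ioo (X.x n) (X.x (n + 1))) n

theorem ae_gaps : ∀ᵐ t ∂X.vol, t ∈ X.gaps := by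
  have h1 : ∀ᵐ t ∂X.vol, t ∉ range X.x :=
    ae_restrict_of_ae ((countable_range X.x).ae_notMem volume)
  have hm : MeasurableSet X.interval := by
    have h : X.interval = Ici 0 ∩ (fun t : ℝ => (t : EReal)) ⁻¹' Iio X.b := rfl
    rw [h]
    exact measurableSet_Ici.inter (measurable_coe_real_ereal measurableSet_Iio)
  filter_upwards [h1, ae_restrict_mem hm] with t h1 h2 using ⟨h2, h1⟩

/-- `u ∈ W^{2,2}(I \ X)`: `u ∈ L²(I)`, `u, u' ∈ AC_loc(I \ X)`, and `u'' ∈ L²(I)`. -/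
structure IsW22 (u : ℝ → ℂ) : Prop where
  memLp : MemLp u 2 X.vol
  ac : LocallyAC u X.gaps
  ac_deriv : LocallyAC (deriv u) X.gaps
  memLp_deriv2 : MemLp (deriv (deriv u)) 2 X.vol

variable {X}

theorem IsW22.diff {u : ℝ → ℂ} (hu : X.IsW22 u) {t : ℝ} (ht : t ∈ X.gaps) :
    DifferentiableAt ℝ u t := by
  rw [gaps_eq, mem_iUnion] at ht
  obtain ⟨n, hn⟩ := ht
  exact LocallyAC.differentiableAt (fun a b h => hu.ac a b (h.trans (X.Ioo_subset_gaps n)))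
    (fun a b h => hu.ac_deriv a b (h.trans (X.Ioo_subset_gaps n))) hn

theorem gaps_mem_nhds {t : ℝ} (ht : t ∈ X.gaps) : X.gaps ∈ 𝓝 t := by
  have h : IsOpen X.gaps := by
    rw [gaps_eq]
    exact isOpen_iUnion fun n => isOpen_Ioo
  exact h.mem_nhds ht

theorem IsW22.ae_diff2 {u : ℝ → ℂ} (hu : X.IsW22 u) :
    ∀ᵐ t ∂X.vol, DifferentiableAt ℝ (deriv u) t := by
  have h : ∀ a b : ℚ, uIcc (a : ℝ) b ⊆ X.gaps →
      ∀ᵐ t, t ∈ uIcc (a : ℝ) b → DifferentiableAt ℝ (deriv u) t :=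
    fun a b hab => (hu.ac_deriv a b hab).ae_diff
  have h2 : ∀ᵐ t, ∀ a b : ℚ, uIcc (a : ℝ) b ⊆ X.gaps →
      t ∈ uIcc (a : ℝ) b → DifferentiableAt ℝ (deriv u) t := by
    simp only [ae_all_iff]
    exact h
  filter_upwards [X.ae_gaps, ae_restrict_of_ae h2] with t ht h
  have hs := ht
  rw [gaps_eq, mem_iUnion] at ht
  obtain ⟨n, hn⟩ := ht
  obtain ⟨a, ha1, ha2⟩ := exists_rat_btwn hn.1
  obtain ⟨b, hb1, hb2⟩ := exists_rat_btwn hn.2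
  refine h a b ((uIcc_subset_Ioo' ⟨ha1, ha2.trans hn.2⟩ ⟨hn.1.trans hb1, hb2⟩).trans
    (X.Ioo_subset_gaps n)) ?_
  rw [uIcc_of_le (ha2.trans hb1).le]
  exact ⟨ha2.le, hb1.le⟩

theorem IsW22.exists_limits {u : ℝ → ℂ} (hu : X.IsW22 u) (n : ℕ) :
    ((∃ y, Tendsto u (𝓝[>] X.x n) (𝓝 y)) ∧ ∃ y, Tendsto u (𝓝[<] X.x (n + 1)) (𝓝 y)) ∧
    (∃ y, Tendsto (deriv u) (𝓝[>] X.x n) (𝓝 y)) ∧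
      ∃ y, Tendsto (deriv u) (𝓝[<] X.x (n + 1)) (𝓝 y) := by
  have hlt : X.x n < X.x (n + 1) := X.strictMono n.lt_succ_self
  have hsub : Ioo (X.x n) (X.x (n + 1)) ⊆ X.interval :=
    (X.Ioo_subset_gaps n).trans Set.sdiff_subset
  have h1 : IntegrableOn (deriv (deriv u)) (Ioo (X.x n) (X.x (n + 1))) := by
    have h : MemLp (deriv (deriv u)) 2 (volume.restrict (Ioo (X.x n) (X.x (n + 1)))) :=
      hu.memLp_deriv2.mono_measure (Measure.restrict_mono hsub le_rfl)
    exact h.integrable (by norm_num)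
  obtain ⟨G, hG, hGe⟩ := LocallyAC.exists_extension hlt
    (fun a b h => hu.ac_deriv a b (h.trans (X.Ioo_subset_gaps n))) h1
  have h2 : IntegrableOn (deriv u) (Ioo (X.x n) (X.x (n + 1))) :=
    ((hG.integrableOn_Icc).mono_set Ioo_subset_Icc_self).congr_fun hGe.symm measurableSet_Ioo
  obtain ⟨K, hK, hKe⟩ := LocallyAC.exists_extension hlt
    (fun a b h => hu.ac a b (h.trans (X.Ioo_subset_gaps n))) h2
  exact ⟨exists_tendsto_of_extension hlt hK hKe, exists_tendsto_of_extension hlt hG hGe⟩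

theorem IsW22.deriv_add {u v : ℝ → ℂ} (hu : X.IsW22 u) (hv : X.IsW22 v) :
    EqOn (deriv (u + v)) (deriv u + deriv v) X.gaps := by
  intro t ht
  exact _root_.deriv_add (hu.diff ht) (hv.diff ht)

theorem IsW22.deriv2_add {u v : ℝ → ℂ} (hu : X.IsW22 u) (hv : X.IsW22 v) :
    deriv (deriv (u + v)) =ᵐ[X.vol] deriv (deriv u) + deriv (deriv v) := by
  filter_upwards [X.ae_gaps, hu.ae_diff2, hv.ae_diff2] with t ht h1 h2
  have h : deriv (u + v) =ᶠ[𝓝 t] deriv u + deriv v := by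
    filter_upwards [gaps_mem_nhds ht] with s hs using hu.deriv_add hv hs
  rw [h.deriv_eq]
  exact _root_.deriv_add h1 h2

theorem IsW22.add {u v : ℝ → ℂ} (hu : X.IsW22 u) (hv : X.IsW22 v) : X.IsW22 (u + v) where
  memLp := hu.memLp.add hv.memLp
  ac := fun a b h => (hu.ac a b h).add (hv.ac a b h)
  ac_deriv := fun a b h => ((hu.ac_deriv a b h).add (hv.ac_deriv a b h)).congr_on
    fun _ ht => (hu.deriv_add hv (h ht)).symm
  memLp_deriv2 := (hu.memLp_deriv2.add hv.memLp_deriv2).ae_eq (hu.deriv2_add hv).symm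

theorem deriv_smul' (c : ℂ) (u : ℝ → ℂ) : deriv (c • u) = c • deriv u := by
  funext t
  exact deriv_const_smul_field c u

theorem IsW22.smul {u : ℝ → ℂ} (c : ℂ) (hu : X.IsW22 u) : X.IsW22 (c • u) where
  memLp := hu.memLp.const_smul c
  ac := fun a b h => (hu.ac a b h).const_smul c
  ac_deriv := fun a b h => by
    rw [deriv_smul']
    exact (hu.ac_deriv a b h).const_smul c
  memLp_deriv2 := by
    rw [deriv_smul', deriv_smul']
    exact hu.memLp_deriv2.const_smul c

theorem isW22_zero : X.IsW22 0 where
  memLp := MemLp.zero'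
  ac := fun a b _ => by
    exact (LipschitzWith.const (0 : ℂ)).lipschitzOnWith.absolutelyContinuousOnInterval
  ac_deriv := fun a b _ => by
    have h : deriv (0 : ℝ → ℂ) = fun _ => 0 := by
      funext t
      exact deriv_const t 0
    rw [h]
    exact (LipschitzWith.const (0 : ℂ)).lipschitzOnWith.absolutelyContinuousOnInterval
  memLp_deriv2 := by
    have h : deriv (0 : ℝ → ℂ) = 0 := by
      funext t
      exact deriv_const t 0
    rw [h, h]
    exact MemLp.zero'

variable (X)

/-- The space `W^{2,2}(I \ X)` of functions. -/
def W22 : Submodule ℂ (ℝ → ℂ) where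
  carrier := {u | X.IsW22 u}
  add_mem' := fun hu hv => hu.add hv
  zero_mem' := isW22_zero
  smul_mem' := fun c _ hu => hu.smul c

/-- The class in `L²(I)` of a function in `W^{2,2}(I \ X)`. -/
def toL2 : X.W22 →ₗ[ℂ] X.L2 where
  toFun u := u.2.memLp.toLp u.1
  map_add' u v := MemLp.toLp_add u.2.memLp v.2.memLp
  map_smul' c u := MemLp.toLp_const_smul c u.2.memLp

/-- The differential expression: `u ↦ -u'' ∈ L²(I)`. -/
def negD2 : X.W22 →ₗ[ℂ] X.L2 where
  toFun u := -(u.2.memLp_deriv2.toLp (deriv (deriv u.1)))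
  map_add' u v := by
    rw [← neg_add, ← MemLp.toLp_add]
    congr 1
    exact (MemLp.toLp_eq_toLp_iff _ _).2 (u.2.deriv2_add v.2)
  map_smul' c u := by
    rw [RingHom.id_apply, smul_neg, ← MemLp.toLp_const_smul]
    congr 1
    refine (MemLp.toLp_eq_toLp_iff _ _).2 (Eventually.of_forall fun t => ?_)
    change deriv (deriv (c • u.1)) t = (c • deriv (deriv u.1)) t
    rw [deriv_smul', deriv_smul']

/-! One-sided boundary values at the ends of the `n`-th interval `(xₙ, xₙ₊₁)`. -/

theorem rightLim_linear {u v : ℝ → ℂ} {p : ℝ} (hu : ∃ y, Tendsto u (𝓝[>] p) (𝓝 y))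
    (hv : ∃ y, Tendsto v (𝓝[>] p) (𝓝 y)) {w : ℝ → ℂ} (hw : w =ᶠ[𝓝[>] p] u + v) :
    Function.rightLim w p = Function.rightLim u p + Function.rightLim v p :=
  rightLim_eq_of_tendsto (((tendsto_rightLim_of_tendsto hu).add
    (tendsto_rightLim_of_tendsto hv)).congr' hw.symm)

theorem leftLim_linear {u v : ℝ → ℂ} {p : ℝ} (hu : ∃ y, Tendsto u (𝓝[<] p) (𝓝 y))
    (hv : ∃ y, Tendsto v (𝓝[<] p) (𝓝 y)) {w : ℝ → ℂ} (hw : w =ᶠ[𝓝[<] p] u + v) :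
    Function.leftLim w p = Function.leftLim u p + Function.leftLim v p :=
  leftLim_eq_of_tendsto (((tendsto_leftLim_of_tendsto hu).add
    (tendsto_leftLim_of_tendsto hv)).congr' hw.symm)

/-- `u(xₙ+)`. -/
def valL (n : ℕ) : X.W22 →ₗ[ℂ] ℂ where
  toFun u := Function.rightLim u.1 (X.x n)
  map_add' u v := rightLim_linear (u.2.exists_limits n).1.1 (v.2.exists_limits n).1.1
    (Eventually.of_forall fun _ => rfl)
  map_smul' c u := rightLim_eq_of_tendsto
    ((tendsto_rightLim_of_tendsto (u.2.exists_limits n).1.1).const_smul c)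

/-- `u(xₙ₊₁-)`. -/
def valR (n : ℕ) : X.W22 →ₗ[ℂ] ℂ where
  toFun u := Function.leftLim u.1 (X.x (n + 1))
  map_add' u v := leftLim_linear (u.2.exists_limits n).1.2 (v.2.exists_limits n).1.2
    (Eventually.of_forall fun _ => rfl)
  map_smul' c u := leftLim_eq_of_tendsto
    ((tendsto_leftLim_of_tendsto (u.2.exists_limits n).1.2).const_smul c)

/-- `u'(xₙ+)`. -/
def derivL (n : ℕ) : X.W22 →ₗ[ℂ] ℂ where
  toFun u := Function.rightLim (deriv u.1) (X.x n)
  map_add' u v := rightLim_linear (u.2.exists_limits n).2.1 (v.2.exists_limits n).2.1 (by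
    filter_upwards [Ioo_mem_nhdsGT (X.strictMono n.lt_succ_self)] with t ht
    exact u.2.deriv_add v.2 (X.Ioo_subset_gaps n ht))
  map_smul' c u := by
    change Function.rightLim (deriv (c • u.1)) _ = _
    rw [deriv_smul']
    exact rightLim_eq_of_tendsto
      ((tendsto_rightLim_of_tendsto (u.2.exists_limits n).2.1).const_smul c)

/-- `u'(xₙ₊₁-)`. -/
def derivR (n : ℕ) : X.W22 →ₗ[ℂ] ℂ where
  toFun u := Function.leftLim (deriv u.1) (X.x (n + 1))
  map_add' u v := leftLim_linear (u.2.exists_limits n).2.2 (v.2.exists_limits n).2.2 (by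
    filter_upwards [Ioo_mem_nhdsLT (X.strictMono n.lt_succ_self)] with t ht
    exact u.2.deriv_add v.2 (X.Ioo_subset_gaps n ht))
  map_smul' c u := by
    change Function.leftLim (deriv (c • u.1)) _ = _
    rw [deriv_smul']
    exact leftLim_eq_of_tendsto
      ((tendsto_leftLim_of_tendsto (u.2.exists_limits n).2.2).const_smul c)

/-- `W₀^{2,2}(I \ X)`: all boundary values of `u` and `u'` at the points of `X` vanish. -/
def W22zero : Submodule ℂ X.W22 :=
  ⨅ n, LinearMap.ker (X.valL n) ⊓ LinearMap.ker (X.valR n) ⊓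
    LinearMap.ker (X.derivL n) ⊓ LinearMap.ker (X.derivR n)

/-- The graph of the minimal operator `H_min = -d²/dx²`, `dom H_min = W₀^{2,2}(I \ X)`. -/
def Hmin : Submodule ℂ (X.L2 × X.L2) :=
  X.W22zero.map (X.toL2.prod X.negD2)

/-- The map `Γ₀⁽ⁿ⁾` with values in `ℂ²`. -/
def Gamma0 (n : ℕ) (u : X.W22) : EuclideanSpace ℂ (Fin 2) :=
  !₂[((X.d n ^ (1 / 2 : ℝ) : ℝ) : ℂ) * X.valL n u,
    -((X.d n ^ (1 / 2 : ℝ) : ℝ) : ℂ) * X.valR n u]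

/-- The map `Γ₁⁽ⁿ⁾` with values in `ℂ²`. -/
def Gamma1 (n : ℕ) (u : X.W22) : EuclideanSpace ℂ (Fin 2) :=
  !₂[((X.d n : ℂ) * X.derivL n u + (X.valL n u - X.valR n u)) / ((X.d n ^ (3 / 2 : ℝ) : ℝ) : ℂ),
    ((X.d n : ℂ) * X.derivR n u + (X.valL n u - X.valR n u)) / ((X.d n ^ (3 / 2 : ℝ) : ℝ) : ℂ)]

end PointSeq

/-- The boundary space `l₂(ℕ, ℂ²)`. -/
abbrev BoundarySpace : Type := lp (fun _ : ℕ => EuclideanSpace ℂ (Fin 2)) 2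

namespace PointSeq

variable (X : PointSeq)

/-- `{f | {Γ₀ f, Γ₁ f} ∈ Θ}`, where `Γⱼ = ⊕ Γⱼ⁽ⁿ⁾`. -/
def boundaryDomain (Θ : Submodule ℂ (BoundarySpace × BoundarySpace)) : Submodule ℂ X.L2 where
  carrier := {f | ∃ u : X.W22, X.toL2 u = f ∧
    ∃ ω ∈ Θ, ∀ n, ω.1 n = X.Gamma0 n u ∧ ω.2 n = X.Gamma1 n u}
  add_mem' := by
    rintro f g ⟨u, rfl, ω, hω, h⟩ ⟨v, rfl, η, hη, k⟩
    refine ⟨u + v, map_add _ _ _, ω + η, Θ.add_mem hω hη, fun n => ⟨?_, ?_⟩⟩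
    · rw [Prod.fst_add, lp.coeFn_add, Pi.add_apply, (h n).1, (k n).1]
      ext i
      fin_cases i <;> simp [Gamma0] <;> ring
    · rw [Prod.snd_add, lp.coeFn_add, Pi.add_apply, (h n).2, (k n).2]
      ext i
      fin_cases i <;> simp [Gamma1] <;> ring
  zero_mem' := by
    refine ⟨0, map_zero _, 0, Θ.zero_mem, fun n => ⟨?_, ?_⟩⟩
    · ext i
      fin_cases i <;> simp [Gamma0]
    · ext i
      fin_cases i <;> simp [Gamma1]
  smul_mem' := by
    rintro c f ⟨u, rfl, ω, hω, h⟩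
    refine ⟨c • u, map_smul _ _ _, c • ω, Θ.smul_mem c hω, fun n => ⟨?_, ?_⟩⟩
    · rw [Prod.smul_fst, lp.coeFn_smul, Pi.smul_apply, (h n).1]
      ext i
      fin_cases i <;> simp [Gamma0] <;> ring
    · rw [Prod.smul_snd, lp.coeFn_smul, Pi.smul_apply, (h n).2]
      ext i
      fin_cases i <;> simp [Gamma1] <;> ring

/-- The graph of `H_Θ`, the restriction of `H_min*` to
`{f ∈ dom H_min* | {Γ₀ f, Γ₁ f} ∈ Θ}`. -/
def H (Θ : Submodule ℂ (BoundarySpace × BoundarySpace)) : Submodule ℂ (X.L2 × X.L2) :=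
  X.Hmin.adjoint ⊓ (X.boundaryDomain Θ).comap (LinearMap.fst ℂ X.L2 X.L2)

end PointSeq

end

/-! The pair `(Γ₀, Γ₁)` is a boundary triple for the adjoint of the minimal operator. `adjoint_Hmin`
identifies this adjoint with the maximal operator: testing with functions supported in one gap gives
a weak equation there, and the local solutions are glued. Green's identity holds because the
difference `u(xₙ+) - u(xₙ₊₁-)` added in `Γ₁` contributes a symmetric term, which cancels. The
weights make the boundary map bounded with a bounded right inverse, uniformly over the gaps. Up to
the factor `d`, `d u'(xₙ+) + u(xₙ+) - u(xₙ₊₁-)` is the deviation of `u'` from its mean over the gap,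
so it is at most `d^{3/2}` times the `L²` norm of `u''`. The weighted traces in `Γ₀` are controlled
by `u` and `d² u''`, and here the boundedness of the lengths enters. Conversely, explicit
polynomials on each gap realize any square summable boundary data.

With such a triple, (i) and (iii) are formal. Adjoints of extensions correspond to adjoints of
boundary relations. Deficiency indices agree because the symplectic form descends to `T*/T` and is
definite there, with opposite signs, on the two defect spaces, so that form-preserving maps cannot
lower a dimension (`rank_le_defect`). Each difference of resolvents is obtained from the other by
multiplication by bounded operators on both sides, so only the ideal property of `𝔖_p` is needed.

Assertion (ii) rests on `hasSum_gapExcess`: the quadratic form of the maximal operator minus `(Γ₁u,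
Γ₀u)` is the sum of the excesses, an excess being the energy on a gap minus that of the linear
interpolant. If `Θ` is bounded below, a trace inequality bounds `‖Γ₀u‖²` by a large multiple of
`‖u‖²` plus a small multiple of the total excess. In the other direction, boundary data are lifted
by polynomials whose nonlinear part concentrates at the end points as its degree `m + 3` grows: the
excess tends to zero and `‖u‖²` is at most `4‖Γ₀u‖²` in the limit.

For (iv), discreteness means compactness of the resolvent at `i`. The Dirichlet relation `{0} × l₂`
has resolvent zero, so by (iii) with `p = ∞` the resolvents of `H_Θ` and of the Dirichlet
realization differ by a compact operator exactly when the resolvent of `Θ` is compact. The Dirichlet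
resolvent is compact if `dₙ → 0`. If `dₙ` does not tend to zero, bumps with zero boundary data on
infinitely many long gaps belong to every `H_Θ` and defeat compactness. -/

noncomputable section

universe u

/-! ### Linear relations and their symplectic form -/

namespace LinRel

variable {E F : Type u} [NormedAddCommGroup E] [InnerProductSpace ℂ E]
  [NormedAddCommGroup F] [InnerProductSpace ℂ F]

/-- The symplectic form `(x', y) - (x, y')` on `E × E`. -/
def sform (x y : E × E) : ℂ := inner ℂ x.2 y.1 - inner ℂ x.1 y.2

theorem mem_adjoint_iff_sform {T : Submodule ℂ (E × E)} {y : E × E} :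
    y ∈ T.adjoint ↔ ∀ x ∈ T, sform x y = 0 := by
  rw [Submodule.mem_adjoint_iff]
  exact ⟨fun h x hx => h x.1 x.2 hx, fun h a b hab => h (a, b) hab⟩

theorem sform_swap (x y : E × E) : sform y x = -(starRingEnd ℂ) (sform x y) := by
  simp [sform]

theorem sform_add_self (x y : E × E) :
    sform (x + y) (x + y) = sform x x + sform y y + (sform x y + sform y x) := by
  simp only [sform, Prod.fst_add, Prod.snd_add, inner_add_left, inner_add_right]
  ring

theorem sform_smul_self (c : ℂ) (f : E) :
    sform (f, c • f) (f, c • f) = ((starRingEnd ℂ) c - c) * (‖f‖ : ℂ) ^ 2 := by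
  simp only [sform, inner_smul_left, inner_smul_right, inner_self_eq_norm_sq_to_K]
  simp only [Complex.coe_algebraMap]
  ring

theorem isClosed_adjoint (T : Submodule ℂ (E × E)) : IsClosed (T.adjoint : Set (E × E)) := by
  have h : (T.adjoint : Set (E × E)) = ⋂ x ∈ T, {y | sform x y = 0} := by
    ext y
    simp only [SetLike.mem_coe, mem_adjoint_iff_sform, mem_iInter, mem_ofPred_eq]
  rw [h]
  refine isClosed_biInter fun x _ => isClosed_eq ?_ continuous_const
  unfold sform
  fun_prop

theorem adjoint_anti {S T : Submodule ℂ (E × E)} (h : S ≤ T) : T.adjoint ≤ S.adjoint := by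
  intro y hy
  rw [mem_adjoint_iff_sform] at hy ⊢
  exact fun x hx => hy x (h hx)

theorem mem_eigenspace {T : Submodule ℂ (E × E)} {z : ℂ} {f : E} :
    f ∈ eigenspace T z ↔ (f, z • f) ∈ T := Iff.rfl

/-! ### Deficiency indices -/

/-- Symmetry makes `(x', x)` real, so for `c = ±i` the cross term `c (x', x)` has no real part. -/
theorem norm_add_smul_sq_of_isSymmetric {T : Submodule ℂ (E × E)} (hT : IsSymmetric T) {c : ℂ}
    (hc : c = Complex.I ∨ c = -Complex.I) {x : E × E} (hx : x ∈ T) :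
    ‖x.2 + c • x.1‖ ^ 2 = ‖x.2‖ ^ 2 + ‖x.1‖ ^ 2 := by
  have h0 : sform x x = 0 := mem_adjoint_iff_sform.1 (hT hx) x hx
  have h1 : (inner ℂ x.2 x.1 : ℂ) = inner ℂ x.1 x.2 := sub_eq_zero.1 h0
  have h2 : (inner ℂ x.2 x.1 : ℂ).im = 0 := by
    have h3 := inner_conj_symm (𝕜 := ℂ) x.2 x.1
    rw [← h1] at h3
    exact Complex.conj_eq_iff_im.1 h3
  rw [@norm_add_sq ℂ]
  have h4 : ‖c‖ = 1 := by rcases hc with rfl | rfl <;> simp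
  rw [norm_smul, h4, one_mul, inner_smul_right]
  have h5 : (c * inner ℂ x.2 x.1).re = 0 := by
    rcases hc with rfl | rfl <;> simp [h2]
  simp only [RCLike.re_eq_complex_re, h5]
  ring

/-- The range of `T + c`. -/
def rangeAdd (T : Submodule ℂ (E × E)) (c : ℂ) : Submodule ℂ E :=
  T.map (LinearMap.snd ℂ E E + c • LinearMap.fst ℂ E E)

theorem mem_rangeAdd {T : Submodule ℂ (E × E)} {c : ℂ} {g : E} :
    g ∈ rangeAdd T c ↔ ∃ x ∈ T, x.2 + c • x.1 = g := Iff.rfl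

/-- The range of `T + c` is closed if `T` is closed and `T + c` is bounded below. -/
theorem isClosed_rangeAdd [CompleteSpace E] {T : Submodule ℂ (E × E)}
    (hT : IsClosed (T : Set (E × E))) {c : ℂ} {K : ℝ} (hK : ∀ x ∈ T, ‖x‖ ≤ K * ‖x.2 + c • x.1‖) :
    IsClosed (rangeAdd T c : Set E) := by
  have : CompleteSpace T := hT.completeSpace_coe
  let L : T →L[ℂ] E :=
    (ContinuousLinearMap.snd ℂ E E + c • ContinuousLinearMap.fst ℂ E E).comp T.subtypeL
  have hL : AntilipschitzWith K.toNNReal L := by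
    refine AddMonoidHomClass.antilipschitz_of_bound L fun x => ?_
    refine (hK x.1 x.2).trans ?_
    exact mul_le_mul_of_nonneg_right (Real.le_coe_toNNReal K) (norm_nonneg _)
  have h := hL.isClosed_range L.uniformContinuous
  convert h using 1
  ext g
  simp only [SetLike.mem_coe, mem_rangeAdd, mem_range, Subtype.exists]
  constructor
  · rintro ⟨x, hx, rfl⟩
    exact ⟨x, hx, rfl⟩
  · rintro ⟨x, hx, rfl⟩
    exact ⟨x, hx, rfl⟩

theorem isClosed_rangeAdd_of_isSymmetric [CompleteSpace E] {T : Submodule ℂ (E × E)}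
    (hT : IsClosed (T : Set (E × E))) (hs : IsSymmetric T) {c : ℂ}
    (hc : c = Complex.I ∨ c = -Complex.I) : IsClosed (rangeAdd T c : Set E) := by
  refine isClosed_rangeAdd hT (K := 1) fun x hx => ?_
  have h := norm_add_smul_sq_of_isSymmetric hs hc hx
  rw [one_mul, Prod.norm_def]
  refine max_le ?_ ?_
  · exact abs_le_of_sq_le_sq' (by nlinarith [sq_nonneg ‖x.2‖]) (norm_nonneg _) |>.2
  · exact abs_le_of_sq_le_sq' (by nlinarith [sq_nonneg ‖x.1‖]) (norm_nonneg _) |>.2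

/-- Orthogonality of `h` to `x' + c x` is the vanishing of the form between `x` and `{h, -c̄ h}`.
For `c = ±i` one has `-c̄ = c`, so the complement of the range of `T + c` is `ker (T* - c)`. -/
theorem mem_rangeAdd_orthogonal {T : Submodule ℂ (E × E)} {c : ℂ} {h : E} :
    h ∈ (rangeAdd T c)ᗮ ↔ h ∈ eigenspace T.adjoint (-(starRingEnd ℂ) c) := by
  rw [Submodule.mem_orthogonal, mem_eigenspace, mem_adjoint_iff_sform]
  constructor
  · intro H x hx
    have := H _ ⟨x, hx, rfl⟩
    simp only [LinearMap.add_apply, LinearMap.snd_apply, LinearMap.smul_apply,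
      LinearMap.fst_apply, inner_add_left, inner_smul_left] at this
    simp only [sform, inner_smul_right]
    linear_combination this
  · rintro H _ ⟨x, hx, rfl⟩
    have := H x hx
    simp only [sform, inner_smul_right] at this
    simp only [LinearMap.add_apply, LinearMap.snd_apply, LinearMap.smul_apply,
      LinearMap.fst_apply, inner_add_left, inner_smul_left]
    linear_combination this

theorem neg_conj_of_unit {c : ℂ} (hc : c = Complex.I ∨ c = -Complex.I) :
    (starRingEnd ℂ) c = -c := by
  rcases hc with rfl | rfl <;> simp

/-- On `T*` the form vanishes against `T`, and on elements `{f, c f}` and `{f, -c f}` it is definite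
with opposite signs. The projection of `f' + c f` onto the complement of the range of `T + c`
therefore detects every `γ f`: if it vanishes, `γ f` equals some `{n, -c n}` modulo `T`, and the two
signs force `f = 0`. Applied in both directions of a boundary triple, this gives equality of
deficiency indices. -/
theorem rank_le_defect [CompleteSpace F] {N : Submodule ℂ E} {T : Submodule ℂ (F × F)}
    (hT : IsClosed (T : Set (F × F))) (hs : IsSymmetric T) {c : ℂ}
    (hc : c = Complex.I ∨ c = -Complex.I) (γ : N →ₗ[ℂ] F × F) (hγ : ∀ f, γ f ∈ T.adjoint)
    (hform : ∀ f : N, sform (γ f) (γ f) = sform ((f : E), c • (f : E)) ((f : E), c • (f : E))) :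
    Module.rank ℂ N ≤ Module.rank ℂ (eigenspace T.adjoint c) := by
  have hcl := isClosed_rangeAdd_of_isSymmetric hT hs hc
  have : CompleteSpace (rangeAdd T c) := hcl.completeSpace_coe
  have heq : (rangeAdd T c)ᗮ = eigenspace T.adjoint c := by
    ext h
    rw [mem_rangeAdd_orthogonal, neg_conj_of_unit hc, neg_neg]
  rw [← heq]
  let φ : N →ₗ[ℂ] (rangeAdd T c)ᗮ :=
    (((rangeAdd T c)ᗮ.orthogonalProjectionOnto : F →L[ℂ] (rangeAdd T c)ᗮ) :
      F →ₗ[ℂ] (rangeAdd T c)ᗮ) ∘ₗ (LinearMap.snd ℂ F F + c • LinearMap.fst ℂ F F) ∘ₗ γ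
  refine LinearMap.rank_le_of_injective φ ((injective_iff_map_eq_zero φ).2 fun f hf => ?_)
  -- Closedness of the range lets a vanishing projection be read as membership in the range.
  have h1 : (γ f).2 + c • (γ f).1 ∈ rangeAdd T c := by
    rw [← Submodule.orthogonal_orthogonal (rangeAdd T c)]
    exact (Submodule.orthogonalProjectionOnto_eq_zero_iff).1 hf
  obtain ⟨t, ht, hte⟩ := mem_rangeAdd.1 h1
  have hn : γ f - t ∈ T.adjoint := T.adjoint.sub_mem (hγ f) (hs ht)
  have hn2 : (γ f - t) = ((γ f - t).1, (-c) • (γ f - t).1) := by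
    refine Prod.ext rfl ?_
    simp only [Prod.snd_sub, Prod.fst_sub]
    have h2 : (γ f).2 = t.2 + c • t.1 - c • (γ f).1 := by rw [hte, add_sub_cancel_right]
    rw [h2]
    module
  have h2 : sform (γ f) (γ f) = sform (γ f - t) (γ f - t) := by
    have h3 : γ f = t + (γ f - t) := by abel
    have h4 : sform t (γ f - t) = 0 := mem_adjoint_iff_sform.1 hn t ht
    have h5 : sform t t = 0 := mem_adjoint_iff_sform.1 (hs ht) t ht
    conv_lhs => rw [h3, sform_add_self, sform_swap t (γ f - t), h4, h5]
    simp
  rw [hform, hn2, sform_smul_self, sform_smul_self, map_neg, neg_conj_of_unit hc] at h2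
  have hc0 : c ≠ 0 := by rcases hc with rfl | rfl <;> simp
  -- With `c̄ = -c` the identity reads `-2c‖f‖² = 2c‖n‖²`, where `n` is the first component of `γ f
  -- - t`.
  have h6 : ((‖(f : E)‖ ^ 2 + ‖(γ f - t).1‖ ^ 2 : ℝ) : ℂ) = 0 := by
    push_cast
    have : (-2 * c) * ((‖(f : E)‖ : ℂ) ^ 2 + (‖(γ f - t).1‖ : ℂ) ^ 2) = 0 := by
      linear_combination h2
    exact (mul_eq_zero.1 this).resolve_left (mul_ne_zero (by norm_num) hc0)
  have h7 : ‖(f : E)‖ ^ 2 + ‖(γ f - t).1‖ ^ 2 = 0 := by exact_mod_cast h6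
  have h8 : ‖(f : E)‖ = 0 := by nlinarith [sq_nonneg ‖(f : E)‖, sq_nonneg ‖(γ f - t).1‖]
  exact Subtype.ext (norm_eq_zero.1 h8)

/-! ### Resolvents -/

theorem mem_shiftInv {T : Submodule ℂ (E × E)} {z : ℂ} {h f : E} :
    (h, f) ∈ shiftInv T z ↔ (f, h + z • f) ∈ T := by
  constructor
  · rintro ⟨x, hx, hxe⟩
    have h1 := congrArg Prod.fst hxe
    have h2 := congrArg Prod.snd hxe
    simp at h1 h2
    subst h2
    rw [← h1, sub_add_cancel]
    exact hx
  · intro H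
    exact ⟨_, H, by simp⟩

/-- A relation with a regular point is recovered from its resolvent. This equivalence replaces the
chosen operator in all later computations. -/
theorem mem_iff_resolvent {T : Submodule ℂ (E × E)} {z : ℂ} (hz : z ∈ resolventSet T) {x : E × E} :
    x ∈ T ↔ resolvent T z (x.2 - z • x.1) = x.1 := by
  have h : shiftInv T z = (resolvent T z : E →ₗ[ℂ] E).graph := by
    have hz' : ∃ R : E →L[ℂ] E, shiftInv T z = (R : E →ₗ[ℂ] E).graph := hz
    rw [resolvent, dif_pos hz']
    exact hz'.choose_spec
  have h2 : (x.2 - z • x.1, x.1) ∈ shiftInv T z ↔ x ∈ T := by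
    rw [mem_shiftInv, sub_add_cancel]
  rw [← h2, h, LinearMap.mem_graph_iff]
  exact eq_comm

theorem mem_resolventSet_of_forall {T : Submodule ℂ (E × E)} {z : ℂ} (R : E →L[ℂ] E)
    (h : ∀ x : E × E, x ∈ T ↔ R (x.2 - z • x.1) = x.1) : z ∈ resolventSet T := by
  refine ⟨R, ?_⟩
  ext ⟨g, f⟩
  rw [mem_shiftInv, h, LinearMap.mem_graph_iff]
  simp [eq_comm]

theorem resolvent_eq_of_forall {T : Submodule ℂ (E × E)} {z : ℂ} (R : E →L[ℂ] E)
    (h : ∀ x : E × E, x ∈ T ↔ R (x.2 - z • x.1) = x.1) : resolvent T z = R := by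
  have hz := mem_resolventSet_of_forall R h
  ext g
  have h1 : (R g, g + z • R g) ∈ T := (h _).2 (by simp)
  have h2 := (mem_iff_resolvent hz).1 h1
  simpa using h2

theorem resolvent_mem {T : Submodule ℂ (E × E)} {z : ℂ} (hz : z ∈ resolventSet T) (g : E) :
    (resolvent T z g, g + z • resolvent T z g) ∈ T :=
  (mem_iff_resolvent hz).2 (by simp)

/-! ### Schatten ideals -/

theorem singularNumber_nonneg (T : E →L[ℂ] E) (n : ℕ) : 0 ≤ singularNumber T n := by
  refine Real.sInf_nonneg ?_
  rintro r ⟨_, _, rfl⟩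
  exact norm_nonneg _

/-- If `K` has rank at most `n`, so has `B K C`, and `B T C - B K C = B (T - K) C`. -/
theorem singularNumber_comp_le (B : F →L[ℂ] E) (T : F →L[ℂ] F) (C : E →L[ℂ] F) (n : ℕ) :
    singularNumber (B ∘L T ∘L C) n ≤ (‖B‖ * ‖C‖) * singularNumber T n := by
  have hne : {r : ℝ | ∃ K : F →L[ℂ] F, LinearMap.rank (K : F →ₗ[ℂ] F) ≤ n ∧ r = ‖T - K‖}.Nonempty :=
    ⟨_, 0, by simp, rfl⟩
  rw [singularNumber, singularNumber, ← smul_eq_mul, ← Real.sInf_smul_of_nonneg (by positivity)]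
  refine le_csInf (hne.smul_set) ?_
  rintro _ ⟨_, ⟨K, hK, rfl⟩, rfl⟩
  have hbd : BddBelow {r : ℝ | ∃ K : E →L[ℂ] E, LinearMap.rank (K : E →ₗ[ℂ] E) ≤ n ∧
      r = ‖B ∘L T ∘L C - K‖} := by
    refine ⟨0, ?_⟩
    rintro r ⟨_, _, rfl⟩
    exact norm_nonneg _
  have hrk : LinearMap.rank ((B ∘L K ∘L C : E →L[ℂ] E) : E →ₗ[ℂ] E) ≤ n := by
    have h1 : ((B ∘L K ∘L C : E →L[ℂ] E) : E →ₗ[ℂ] E) =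
        (B : F →ₗ[ℂ] E) ∘ₗ ((K : F →ₗ[ℂ] F) ∘ₗ (C : E →ₗ[ℂ] F)) := rfl
    rw [h1]
    exact (LinearMap.rank_comp_le_right _ _).trans ((LinearMap.rank_comp_le_left _ _).trans hK)
  refine (csInf_le hbd ⟨B ∘L K ∘L C, hrk, rfl⟩).trans ?_
  · have h2 : B ∘L T ∘L C - B ∘L K ∘L C = B ∘L (T - K) ∘L C := by
      ext x
      simp
    rw [h2]
    calc ‖B ∘L (T - K) ∘L C‖ ≤ ‖B‖ * (‖T - K‖ * ‖C‖) :=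
          (ContinuousLinearMap.opNorm_comp_le _ _).trans
            (mul_le_mul_of_nonneg_left (ContinuousLinearMap.opNorm_comp_le _ _) (norm_nonneg _))
      _ = _ := by simp only [smul_eq_mul]; ring

/-- The two-sided ideal property is all that the comparison of resolvents uses; no additivity of
`𝔖_p` is required, and so `p < 1` needs no separate treatment. -/
theorem memSchatten_comp {p : ℝ≥0∞} {T : F →L[ℂ] F} (hT : MemSchatten p T)
    (B : F →L[ℂ] E) (C : E →L[ℂ] F) : MemSchatten p (B ∘L T ∘L C) := by
  unfold MemSchatten at hT ⊢
  split_ifs at hT ⊢ with h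
  · exact (hT.comp_clm C).clm_comp B
  · refine Summable.of_nonneg_of_le (fun n => Real.rpow_nonneg (singularNumber_nonneg _ n) _)
      (fun n => ?_) (hT.mul_left ((‖B‖ * ‖C‖) ^ p.toReal))
    rw [← Real.mul_rpow (by positivity) (singularNumber_nonneg _ n)]
    exact Real.rpow_le_rpow (singularNumber_nonneg _ n) (singularNumber_comp_le B T C n)
      ENNReal.toReal_nonneg

end LinRel

/-! ### A relation and its complement `{y, z y}` at a regular point -/

namespace LinRel

variable {E : Type u} [NormedAddCommGroup E] [InnerProductSpace ℂ E]

/-- The map `{f, f'} ↦ f - (T - z)⁻¹ (f' - z f)`, whose kernel is `T`. -/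
def residual (T : Submodule ℂ (E × E)) (z : ℂ) : E × E →L[ℂ] E :=
  ContinuousLinearMap.fst ℂ E E - resolvent T z ∘L
    (ContinuousLinearMap.snd ℂ E E - z • ContinuousLinearMap.fst ℂ E E)

theorem residual_apply (T : Submodule ℂ (E × E)) (z : ℂ) (x : E × E) :
    residual T z x = x.1 - resolvent T z (x.2 - z • x.1) := rfl

theorem residual_eq_of_sub_mem {T : Submodule ℂ (E × E)} {z : ℂ}
    (hz : z ∈ resolventSet T) {x y : E × E} (h : x - y ∈ T) : residual T z x = residual T z y := by
  rw [← sub_eq_zero, ← map_sub, residual_apply, sub_eq_zero]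
  exact ((mem_iff_resolvent hz).1 h).symm

/-- At a regular point `z`, every pair is uniquely an element of `T` plus a pair `{y, z y}`; the
residual is the coordinate `y` of this decomposition. -/
theorem sub_residual_mem {T : Submodule ℂ (E × E)} {z : ℂ}
    (hz : z ∈ resolventSet T) (x : E × E) : x - (residual T z x, z • residual T z x) ∈ T := by
  rw [mem_iff_resolvent hz, residual_apply]
  simp only [Prod.snd_sub, Prod.fst_sub, sub_sub_cancel]
  congr 1
  module

/-- The map `h ↦ {(T - z)⁻¹ h, h + z (T - z)⁻¹ h}`, a parametrization of `T`. -/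
def param (T : Submodule ℂ (E × E)) (z : ℂ) : E →L[ℂ] E × E :=
  (resolvent T z).prod (ContinuousLinearMap.id ℂ E + z • resolvent T z)

theorem param_mem {T : Submodule ℂ (E × E)} {z : ℂ}
    (hz : z ∈ resolventSet T) (h : E) : param T z h ∈ T := resolvent_mem hz h

theorem param_sub {T : Submodule ℂ (E × E)} {z : ℂ}
    (hz : z ∈ resolventSet T) {x : E × E} (hx : x ∈ T) : param T z (x.2 - z • x.1) = x := by
  have h := (mem_iff_resolvent hz).1 hx
  refine Prod.ext h ?_
  change (x.2 - z • x.1) + z • resolvent T z (x.2 - z • x.1) = x.2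
  rw [h, sub_add_cancel]

/-- A difference of resolvents measures how far the elements of `T` are from `T'`. In this form it
can be carried through a boundary map. -/
theorem residual_param (T T' : Submodule ℂ (E × E)) (z : ℂ) :
    residual T' z ∘L param T z = resolvent T z - resolvent T' z := by
  ext h
  change resolvent T z h - resolvent T' z ((h + z • resolvent T z h) - z • resolvent T z h) = _
  rw [add_sub_cancel_right]
  rfl

end LinRel

/-- A boundary triple for the adjoint of a linear relation `S`: the boundary map `Γ = (Γ₀, Γ₁)` is
bounded on `S*`, has a bounded right inverse, vanishes on `S` and satisfies Green's identity. -/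
structure BoundaryTriple {E : Type u} (F : Type u) [NormedAddCommGroup E] [InnerProductSpace ℂ E]
    [NormedAddCommGroup F] [InnerProductSpace ℂ F] (S : Submodule ℂ (E × E)) where
  Γ : S.adjoint →L[ℂ] F × F
  lift : F × F →L[ℂ] S.adjoint
  Γ_lift : ∀ ω, Γ (lift ω) = ω
  green : ∀ x y : S.adjoint, LinRel.sform (Γ x) (Γ y) = LinRel.sform (x : E × E) y
  le_adjoint : S ≤ S.adjoint
  vanish : ∀ x : S.adjoint, (x : E × E) ∈ S → Γ x = 0

/-! ### Extensions determined by boundary relations -/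

namespace BoundaryTriple

open LinRel

variable {E F : Type u} [NormedAddCommGroup E] [InnerProductSpace ℂ E]
  [NormedAddCommGroup F] [InnerProductSpace ℂ F] {S : Submodule ℂ (E × E)}
  (B : BoundaryTriple F S)

/-- The extension of `S` determined by the boundary relation `Θ`. -/
def ext (Θ : Submodule ℂ (F × F)) : Submodule ℂ (E × E) :=
  (Θ.comap (B.Γ : S.adjoint →ₗ[ℂ] F × F)).map S.adjoint.subtype

theorem mem_ext {Θ : Submodule ℂ (F × F)} {x : E × E} :
    x ∈ B.ext Θ ↔ ∃ h : x ∈ S.adjoint, B.Γ ⟨x, h⟩ ∈ Θ := by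
  constructor
  · rintro ⟨y, hy, rfl⟩
    exact ⟨y.2, hy⟩
  · rintro ⟨h, hx⟩
    exact ⟨⟨x, h⟩, hx, rfl⟩

theorem coe_mem_ext {Θ : Submodule ℂ (F × F)} {x : S.adjoint} :
    (x : E × E) ∈ B.ext Θ ↔ B.Γ x ∈ Θ := by
  rw [mem_ext]
  exact ⟨fun ⟨_, h⟩ => h, fun h => ⟨x.2, h⟩⟩

theorem lift_mem_ext {Θ : Submodule ℂ (F × F)} {ω : F × F} :
    (B.lift ω : E × E) ∈ B.ext Θ ↔ ω ∈ Θ := by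
  rw [coe_mem_ext, B.Γ_lift]

theorem le_ext (Θ : Submodule ℂ (F × F)) : S ≤ B.ext Θ := by
  intro x hx
  refine B.mem_ext.2 ⟨B.le_adjoint hx, ?_⟩
  rw [B.vanish _ hx]
  exact Θ.zero_mem

theorem isClosed_ext {Θ : Submodule ℂ (F × F)} (hΘ : IsClosed (Θ : Set (F × F))) :
    IsClosed (B.ext Θ : Set (E × E)) := by
  have h := (isClosed_adjoint S).isClosedEmbedding_subtypeVal.isClosedMap _
    (hΘ.preimage B.Γ.continuous)
  exact h

/-- An extension contains `S`, so its adjoint lies in `S*`, where Green's identity applies;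
surjectivity of `Γ`, through `lift`, supplies enough test elements to reach all of `Θ`. -/
theorem adjoint_ext (Θ : Submodule ℂ (F × F)) : (B.ext Θ).adjoint = B.ext Θ.adjoint := by
  ext y
  constructor
  · intro hy
    have hy' : y ∈ S.adjoint := adjoint_anti (B.le_ext Θ) hy
    refine B.mem_ext.2 ⟨hy', mem_adjoint_iff_sform.2 fun ω hω => ?_⟩
    have h1 := mem_adjoint_iff_sform.1 hy _ (B.lift_mem_ext.2 hω)
    rw [← B.Γ_lift ω, B.green]
    exact h1
  · intro hy
    obtain ⟨hy', h⟩ := B.mem_ext.1 hy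
    refine mem_adjoint_iff_sform.2 fun x hx => ?_
    obtain ⟨hx', hx2⟩ := B.mem_ext.1 hx
    have := B.green ⟨x, hx'⟩ ⟨y, hy'⟩
    rw [mem_adjoint_iff_sform.1 h _ hx2] at this
    exact this.symm

theorem ext_le_ext {Θ Θ' : Submodule ℂ (F × F)} : B.ext Θ ≤ B.ext Θ' ↔ Θ ≤ Θ' := by
  constructor
  · exact fun h ω hω => B.lift_mem_ext.1 (h (B.lift_mem_ext.2 hω))
  · intro h x hx
    obtain ⟨h1, h2⟩ := B.mem_ext.1 hx
    exact B.mem_ext.2 ⟨h1, h h2⟩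

theorem isSymmetric_ext {Θ : Submodule ℂ (F × F)} : IsSymmetric (B.ext Θ) ↔ IsSymmetric Θ := by
  rw [LinRel.IsSymmetric, adjoint_ext, ext_le_ext]
  rfl

theorem isSelfAdjoint_ext {Θ : Submodule ℂ (F × F)} :
    LinRel.IsSelfAdjoint (B.ext Θ) ↔ LinRel.IsSelfAdjoint Θ := by
  rw [LinRel.IsSelfAdjoint, adjoint_ext, LinRel.IsSelfAdjoint, le_antisymm_iff, le_antisymm_iff,
    ext_le_ext, ext_le_ext]

/-- `rank_le_defect` is used twice: with `Γ` on the defect space of the extension, and with `lift`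
on the defect space of `Θ`. Neither map need send eigenelements to eigenelements; it is enough that
both preserve the form and respect the adjoints. -/
theorem defect_ext [CompleteSpace E] [CompleteSpace F] {Θ : Submodule ℂ (F × F)}
    (hΘ : IsClosed (Θ : Set (F × F))) (hs : IsSymmetric Θ) {c : ℂ}
    (hc : c = Complex.I ∨ c = -Complex.I) : defect (B.ext Θ) c = defect Θ c := by
  unfold defect
  congr 1
  refine le_antisymm ?_ ?_
  · have hmem : ∀ f : eigenspace (B.ext Θ).adjoint c,
        ((f : E), c • (f : E)) ∈ S.adjoint := fun f =>
      adjoint_anti (B.le_ext Θ) f.2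
    let j : eigenspace (B.ext Θ).adjoint c →ₗ[ℂ] S.adjoint :=
      LinearMap.codRestrict S.adjoint
        ((LinearMap.prod LinearMap.id (c • LinearMap.id)) ∘ₗ Submodule.subtype _) fun f => by simpa using hmem f
    refine rank_le_defect hΘ hs hc ((B.Γ : S.adjoint →ₗ[ℂ] F × F) ∘ₗ j) (fun f => ?_)
      (fun f => B.green (j f) (j f))
    have h1 : ((j f : S.adjoint) : E × E) ∈ B.ext Θ.adjoint := by
      rw [← adjoint_ext]
      exact f.2
    exact B.coe_mem_ext.1 h1
  · let j : eigenspace Θ.adjoint c →ₗ[ℂ] F × F :=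
      (LinearMap.prod LinearMap.id (c • LinearMap.id)) ∘ₗ Submodule.subtype _
    refine rank_le_defect (B.isClosed_ext hΘ) (B.isSymmetric_ext.2 hs) hc
      (S.adjoint.subtype ∘ₗ (B.lift : F × F →ₗ[ℂ] S.adjoint) ∘ₗ j) (fun f => ?_) (fun f => ?_)
    · rw [adjoint_ext]
      exact B.lift_mem_ext.2 f.2
    · have := B.green (B.lift (j f)) (B.lift (j f))
      rw [B.Γ_lift] at this
      exact this.symm

/-! ### Differences of resolvents -/

/-- Let `x` run through the extension by `Θ`, so that `Γ x ∈ Θ`. Modulo `Θ'`, `Γ x` equals `{y, ζ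
y}`, with `y` the difference of the boundary resolvents at a bounded image `C g`. Hence `x` equals
the lift of `{y, ζ y}` modulo the extension by `Θ'`, and its residual depends boundedly on `y`. -/
theorem memSchatten_ext_of [CompleteSpace E] {Θ Θ' : Submodule ℂ (F × F)} {p : ℝ≥0∞} {z ζ : ℂ}
    (hz : z ∈ LinRel.resolventSet (B.ext Θ)) (hz' : z ∈ LinRel.resolventSet (B.ext Θ'))
    (hζ : ζ ∈ LinRel.resolventSet Θ) (hζ' : ζ ∈ LinRel.resolventSet Θ')
    (h : MemSchatten p (LinRel.resolvent Θ ζ - LinRel.resolvent Θ' ζ)) :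
    MemSchatten p (LinRel.resolvent (B.ext Θ) z - LinRel.resolvent (B.ext Θ') z) := by
  have hmem : ∀ h, param (B.ext Θ) z h ∈ S.adjoint := fun h =>
    (B.mem_ext.1 (param_mem hz h)).choose
  let J : E →L[ℂ] S.adjoint := (param (B.ext Θ) z).codRestrict S.adjoint hmem
  let C : E →L[ℂ] F :=
    (ContinuousLinearMap.snd ℂ F F - ζ • ContinuousLinearMap.fst ℂ F F) ∘L B.Γ ∘L J
  let D : F →L[ℂ] E := residual (B.ext Θ') z ∘L S.adjoint.subtypeL ∘L B.lift ∘L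
    (ContinuousLinearMap.id ℂ F).prod (ζ • ContinuousLinearMap.id ℂ F)
  have key : LinRel.resolvent (B.ext Θ) z - LinRel.resolvent (B.ext Θ') z =
      D ∘L (LinRel.resolvent Θ ζ - LinRel.resolvent Θ' ζ) ∘L C := by
    rw [← residual_param, ← residual_param]
    ext g
    have hJ : B.Γ (J g) ∈ Θ := B.coe_mem_ext.1 (param_mem hz g)
    have h1 : param Θ ζ (C g) = B.Γ (J g) := param_sub hζ hJ
    change residual (B.ext Θ') z (J g : E × E) = D (residual Θ' ζ (param Θ ζ (C g)))
    rw [h1]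
    refine residual_eq_of_sub_mem hz' ?_
    have h2 := sub_residual_mem hζ' (B.Γ (J g))
    have h3 : B.Γ (J g - B.lift (residual Θ' ζ (B.Γ (J g)), ζ • residual Θ' ζ (B.Γ (J g)))) ∈ Θ' := by
      rw [map_sub, B.Γ_lift]
      exact h2
    exact B.coe_mem_ext.2 h3
  rw [key]
  exact memSchatten_comp h D C

theorem isClosed_eigenspace {T : Submodule ℂ (E × E)} (hT : IsClosed (T : Set (E × E))) (z : ℂ) :
    IsClosed (eigenspace T z : Set E) :=
  hT.preimage (continuous_id.prodMk (continuous_id.const_smul z))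

/-- The previous factorization with the roles of the two spaces exchanged. The residual `y` now has
to be returned to the boundary through `Γ {y, z y}`, which makes sense only for `y ∈ ker (S* - z)`;
the orthogonal projection onto this closed subspace extends the left factor to the whole space. -/
theorem memSchatten_of_ext [CompleteSpace E] {Θ Θ' : Submodule ℂ (F × F)} {p : ℝ≥0∞} {z ζ : ℂ}
    (hz : z ∈ LinRel.resolventSet (B.ext Θ)) (hz' : z ∈ LinRel.resolventSet (B.ext Θ'))
    (hζ : ζ ∈ LinRel.resolventSet Θ) (hζ' : ζ ∈ LinRel.resolventSet Θ')
    (h : MemSchatten p (LinRel.resolvent (B.ext Θ) z - LinRel.resolvent (B.ext Θ') z)) :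
    MemSchatten p (LinRel.resolvent Θ ζ - LinRel.resolvent Θ' ζ) := by
  have hcl := isClosed_eigenspace (isClosed_adjoint S) z
  have : CompleteSpace (eigenspace S.adjoint z) := hcl.completeSpace_coe
  let J : F →L[ℂ] S.adjoint := B.lift ∘L param Θ ζ
  let C : F →L[ℂ] E := (ContinuousLinearMap.snd ℂ E E - z • ContinuousLinearMap.fst ℂ E E) ∘L
    S.adjoint.subtypeL ∘L J
  let N : eigenspace S.adjoint z →L[ℂ] S.adjoint :=
    (((ContinuousLinearMap.id ℂ E).prod (z • ContinuousLinearMap.id ℂ E)) ∘L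
      (eigenspace S.adjoint z).subtypeL).codRestrict S.adjoint fun f => f.2
  let D : E →L[ℂ] F := residual Θ' ζ ∘L B.Γ ∘L N ∘L
    (eigenspace S.adjoint z).orthogonalProjectionOnto
  have key : LinRel.resolvent Θ ζ - LinRel.resolvent Θ' ζ =
      D ∘L (LinRel.resolvent (B.ext Θ) z - LinRel.resolvent (B.ext Θ') z) ∘L C := by
    rw [← residual_param, ← residual_param]
    ext1 g
    have hJ : (J g : E × E) ∈ B.ext Θ := B.lift_mem_ext.2 (param_mem hζ g)
    have h1 : param (B.ext Θ) z (C g) = J g := param_sub hz hJ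
    change residual Θ' ζ (param Θ ζ g) = D (residual (B.ext Θ') z (param (B.ext Θ) z (C g)))
    rw [h1]
    set y := residual (B.ext Θ') z (J g : E × E) with hy
    have h2 : (J g : E × E) - (y, z • y) ∈ B.ext Θ' := sub_residual_mem hz' _
    obtain ⟨h3, h4⟩ := B.mem_ext.1 h2
    -- Both `J g` and its difference with `{y, z y}` lie in `S*`.
    have h5 : y ∈ eigenspace S.adjoint z := by
      have := S.adjoint.sub_mem (J g).2 h3
      rw [sub_sub_cancel] at this
      exact this
    have h6 : (eigenspace S.adjoint z).orthogonalProjectionOnto y = ⟨y, h5⟩ :=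
      Submodule.orthogonalProjectionOnto_mem_subspace_eq_self ⟨y, h5⟩
    change _ = residual Θ' ζ (B.Γ (N ((eigenspace S.adjoint z).orthogonalProjectionOnto y)))
    rw [h6]
    refine residual_eq_of_sub_mem hζ' ?_
    have h7 : param Θ ζ g = B.Γ (J g) := (B.Γ_lift _).symm
    rw [h7, ← map_sub]
    exact h4
  rw [key]
  exact memSchatten_comp h D C

theorem memSchatten_ext [CompleteSpace E] {Θ Θ' : Submodule ℂ (F × F)} {p : ℝ≥0∞} {z ζ : ℂ}
    (hz : z ∈ LinRel.resolventSet (B.ext Θ)) (hz' : z ∈ LinRel.resolventSet (B.ext Θ'))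
    (hζ : ζ ∈ LinRel.resolventSet Θ) (hζ' : ζ ∈ LinRel.resolventSet Θ') :
    MemSchatten p (LinRel.resolvent (B.ext Θ) z - LinRel.resolvent (B.ext Θ') z) ↔
      MemSchatten p (LinRel.resolvent Θ ζ - LinRel.resolvent Θ' ζ) :=
  ⟨B.memSchatten_of_ext hz hz' hζ hζ', B.memSchatten_ext_of hz hz' hζ hζ'⟩

end BoundaryTriple

namespace LinRel

variable {E : Type u} [NormedAddCommGroup E] [InnerProductSpace ℂ E]

/-! ### Discreteness of the spectrum and compactness of the resolvent -/

theorem eigenspace_eq_eigenspace_resolvent {T : Submodule ℂ (E × E)} {z μ : ℂ}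
    (hz : z ∈ resolventSet T) (hμ : μ ≠ 0) :
    eigenspace T (z + μ⁻¹) = Module.End.eigenspace (resolvent T z : E →ₗ[ℂ] E) μ := by
  ext f
  rw [mem_eigenspace, mem_iff_resolvent hz, Module.End.mem_eigenspace_iff]
  simp only [add_smul, add_sub_cancel_left, map_smul]
  rw [inv_smul_eq_iff₀ hμ]
  rfl

/-- Spectral mapping for `ν = z + μ⁻¹`. With `R` and `S` the resolvents at `z` and `ν`, the
resolvent identity gives `(μ - R)⁻¹ = μ⁻¹ + μ⁻² S`; conversely `S = μ (μ - R)⁻¹ R`. -/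
theorem mem_resolventSet_iff_resolvent {T : Submodule ℂ (E × E)} {z μ : ℂ}
    (hz : z ∈ resolventSet T) (hμ : μ ≠ 0) :
    z + μ⁻¹ ∈ resolventSet T ↔ μ ∈ _root_.resolventSet ℂ (resolvent T z) := by
  set R := resolvent T z with hR
  rw [spectrum.mem_resolventSet_iff]
  constructor
  · intro hν
    set S := resolvent T (z + μ⁻¹) with hS
    have h1 : ∀ k, R k + μ⁻¹ • R (S k) = S k := fun k => by
      have := (mem_iff_resolvent hz).1 (resolvent_mem hν k)
      simp only [add_smul, ← hS, ← hR] at this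
      rw [← map_smul, ← map_add, ← this]
      congr 1
      rw [this]
      abel
    have h2 : ∀ k, S k - μ⁻¹ • S (R k) = R k := fun k => by
      have := (mem_iff_resolvent hν).1 (resolvent_mem hz k)
      simp only [add_smul, ← hS, ← hR] at this
      rw [← map_smul, ← map_sub, ← this]
      congr 1
      rw [this]
      abel
    have hl : (algebraMap ℂ (E →L[ℂ] E) μ - R) * (μ⁻¹ • 1 + (μ⁻¹ * μ⁻¹) • S) = 1 := by
      ext k
      have h3 := h1 k
      simp only [mul_apply_eq_comp, _root_.sub_apply,
        Algebra.algebraMap_eq_smul_one, _root_.smul_apply,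
        _root_.add_apply, one_apply_eq_self, map_add, map_smul]
      have h4 : R k = S k - μ⁻¹ • R (S k) := eq_sub_of_add_eq h3
      rw [h4]
      match_scalars <;> field_simp <;> ring
    have hr : (μ⁻¹ • 1 + (μ⁻¹ * μ⁻¹) • S) * (algebraMap ℂ (E →L[ℂ] E) μ - R) = 1 := by
      ext k
      have h3 := h2 k
      simp only [mul_apply_eq_comp, _root_.sub_apply,
        Algebra.algebraMap_eq_smul_one, _root_.smul_apply,
        _root_.add_apply, one_apply_eq_self, map_sub, map_smul]
      have h4 : S k = R k + μ⁻¹ • S (R k) := sub_eq_iff_eq_add.1 h3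
      rw [h4]
      match_scalars <;> field_simp <;> ring
    exact ⟨⟨_, _, hl, hr⟩, rfl⟩
  · rintro ⟨⟨M, A, hMA, hAM⟩, hM⟩
    simp only at hM
    refine mem_resolventSet_of_forall (μ • (A * R)) fun x => ?_
    rw [mem_iff_resolvent hz, ← hR]
    set h := x.2 - (z + μ⁻¹) • x.1 with hh
    have h1 : x.2 - z • x.1 = h + μ⁻¹ • x.1 := by rw [hh]; module
    rw [h1, map_add, map_smul]
    have h2 : M x.1 = μ • x.1 - R x.1 := by
      rw [hM]
      simp [Algebra.algebraMap_eq_smul_one]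
    have hA1 : ∀ k, A (M k) = k := fun k => by
      rw [← mul_apply_eq_comp, hAM, one_apply_eq_self]
    have hM1 : ∀ k, M (A k) = k := fun k => by
      rw [← mul_apply_eq_comp, hMA, one_apply_eq_self]
    have h3 : R h + μ⁻¹ • R x.1 = x.1 ↔ μ • R h = M x.1 := by
      rw [h2]
      constructor
      · intro H
        rw [eq_sub_iff_add_eq]
        nth_rewrite 2 [← H]
        rw [smul_add, smul_smul, mul_inv_cancel₀ hμ, one_smul]
      · intro H
        have : R x.1 = μ • x.1 - μ • R h := by rw [H]; abel
        rw [this, smul_sub, smul_smul, smul_smul, inv_mul_cancel₀ hμ, one_smul, one_smul]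
        abel
    rw [h3]
    simp only [_root_.smul_apply, mul_apply_eq_comp]
    constructor
    · intro H
      rw [← map_smul, H, hA1]
    · intro H
      rw [← H, map_smul, hM1]

theorem IsSelfAdjoint.isClosed {T : Submodule ℂ (E × E)} (hT : IsSelfAdjoint T) :
    IsClosed (T : Set (E × E)) := by
  rw [hT]
  exact isClosed_adjoint T

theorem IsSelfAdjoint.isSymmetric {T : Submodule ℂ (E × E)} (hT : IsSelfAdjoint T) :
    IsSymmetric T := hT.le

theorem IsSelfAdjoint.sform_eq_zero {T : Submodule ℂ (E × E)} (hT : IsSelfAdjoint T) {x y : E × E}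
    (hx : x ∈ T) (hy : y ∈ T) : sform x y = 0 :=
  mem_adjoint_iff_sform.1 (hT.le hy) x hx

theorem IsSelfAdjoint.conj_eq_of_mem_eigenspace {T : Submodule ℂ (E × E)} (hT : IsSelfAdjoint T)
    {z : ℂ} {f : E} (hf : f ∈ eigenspace T z) (h0 : f ≠ 0) : (starRingEnd ℂ) z = z := by
  have h := hT.sform_eq_zero (mem_eigenspace.1 hf) (mem_eigenspace.1 hf)
  rw [sform_smul_self] at h
  have h1 : ((‖f‖ : ℂ)) ^ 2 ≠ 0 := pow_ne_zero 2 (by simpa using h0)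
  exact sub_eq_zero.1 ((mul_eq_zero.1 h).resolve_right h1)

theorem IsSelfAdjoint.inner_eq_zero {T : Submodule ℂ (E × E)} (hT : IsSelfAdjoint T)
    {z w : ℂ} (hzw : z ≠ w) {f g : E} (hf : f ∈ eigenspace T z) (hg : g ∈ eigenspace T w) :
    (inner ℂ f g : ℂ) = 0 := by
  by_cases h0 : f = 0
  · rw [h0, inner_zero_left]
  have h := hT.sform_eq_zero (mem_eigenspace.1 hf) (mem_eigenspace.1 hg)
  simp only [sform, inner_smul_left, inner_smul_right, hT.conj_eq_of_mem_eigenspace hf h0] at h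
  rw [← sub_mul] at h
  exact (mul_eq_zero.1 h).resolve_left (sub_ne_zero.2 hzw)

/-- The range of `T - i` is closed, and its complement is the eigenspace at `-i`, which is trivial
because eigenvalues are real. The norm identity for symmetric relations makes the inverse a
contraction. -/
theorem IsSelfAdjoint.I_mem_resolventSet [CompleteSpace E] {T : Submodule ℂ (E × E)}
    (hT : IsSelfAdjoint T) : Complex.I ∈ resolventSet T := by
  have hc : (-Complex.I) = Complex.I ∨ (-Complex.I) = -Complex.I := Or.inr rfl
  have hcl := isClosed_rangeAdd_of_isSymmetric hT.isClosed hT.isSymmetric hc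
  have : CompleteSpace (rangeAdd T (-Complex.I)) := hcl.completeSpace_coe
  have htop : rangeAdd T (-Complex.I) = ⊤ := by
    rw [← Submodule.orthogonal_eq_bot_iff, Submodule.eq_bot_iff]
    intro h hh
    rw [mem_rangeAdd_orthogonal, ← hT] at hh
    by_contra h0
    have := hT.conj_eq_of_mem_eigenspace hh h0
    simp only [map_neg, Complex.conj_I, neg_neg] at this
    exact absurd (congrArg Complex.im this) (by norm_num)
  have hnorm : ∀ x ∈ T, ‖x.1‖ ≤ ‖x.2 + (-Complex.I) • x.1‖ := fun x hx => by
    have h := norm_add_smul_sq_of_isSymmetric hT.isSymmetric hc hx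
    exact abs_le_of_sq_le_sq' (by nlinarith [sq_nonneg ‖x.2‖]) (norm_nonneg _) |>.2
  have hsurj : ∀ g : E, ∃ x ∈ T, x.2 + (-Complex.I) • x.1 = g := fun g => by
    rw [← mem_rangeAdd, htop]
    trivial
  have huniq : ∀ x ∈ T, ∀ y ∈ T, x.2 + (-Complex.I) • x.1 = y.2 + (-Complex.I) • y.1 →
      x.1 = y.1 := fun x hx y hy hxy => by
    have h := hnorm _ (T.sub_mem hx hy)
    have h2 : (x - y).2 + (-Complex.I) • (x - y).1 = 0 := by
      have : (x - y).2 + (-Complex.I) • (x - y).1 =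
          (x.2 + (-Complex.I) • x.1) - (y.2 + (-Complex.I) • y.1) := by
        simp only [Prod.snd_sub, Prod.fst_sub]
        module
      rw [this, hxy, sub_self]
    rw [h2, norm_zero] at h
    exact sub_eq_zero.1 (norm_le_zero_iff.1 h)
  choose X hX hXe using hsurj
  let R : E →ₗ[ℂ] E :=
    { toFun := fun g => (X g).1
      map_add' := fun g h => huniq _ (hX _) _ (T.add_mem (hX g) (hX h)) (by
        rw [hXe]
        conv_lhs => rw [← hXe g, ← hXe h]
        simp only [Prod.snd_add, Prod.fst_add]
        module)
      map_smul' := fun c g => huniq _ (hX _) _ (T.smul_mem c (hX g)) (by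
        rw [hXe]
        conv_lhs => rw [← hXe g]
        simp only [Prod.smul_snd, Prod.smul_fst]
        module) }
  let R' : E →L[ℂ] E := R.mkContinuous 1 fun g => by
    have h := hnorm _ (hX g)
    rw [hXe] at h
    rw [one_mul]
    exact h
  refine mem_resolventSet_of_forall R' fun x => ?_
  have hx1 : x.2 - Complex.I • x.1 = x.2 + (-Complex.I) • x.1 := by module
  rw [hx1]
  change x ∈ T ↔ (X _).1 = x.1
  constructor
  · exact fun hx => huniq _ (hX _) _ hx (hXe _)
  · intro h
    have h2 := hXe (x.2 + (-Complex.I) • x.1)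
    rw [h] at h2
    have h3 : X (x.2 + (-Complex.I) • x.1) = x := Prod.ext h (add_right_cancel h2)
    rw [← h3]
    exact hX _

/-- Riesz theory for the compact resolvent gives eigenvalues of finite multiplicity. If one were not
isolated, unit eigenvectors of eigenvalues converging to it would have a convergent subsequence; the
limit would be a unit eigenvector at the limit point, yet orthogonal to the whole sequence. -/
theorem IsSelfAdjoint.hasDiscreteSpectrum [CompleteSpace E] {T : Submodule ℂ (E × E)}
    (hT : IsSelfAdjoint T) (hR : IsCompactOperator (resolvent T Complex.I)) :
    HasDiscreteSpectrum T := by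
  have hI := hT.I_mem_resolventSet
  have hdec : ∀ ν ∈ spectrum T, ν - Complex.I ≠ 0 := fun ν hν h0 =>
    hν (by rwa [sub_eq_zero.1 h0])
  have heig : ∀ ν ∈ spectrum T, eigenspace T ν =
      Module.End.eigenspace (resolvent T Complex.I : E →ₗ[ℂ] E) (ν - Complex.I)⁻¹ := fun ν hν => by
    rw [← eigenspace_eq_eigenspace_resolvent hI (inv_ne_zero (hdec ν hν)), inv_inv,
      add_sub_cancel]
  have hne : ∀ ν ∈ spectrum T, eigenspace T ν ≠ ⊥ := fun ν hν => by
    rw [heig ν hν]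
    refine (hR.hasEigenvalue_or_mem_resolventSet (inv_ne_zero (hdec ν hν))).resolve_right fun h => ?_
    rw [← mem_resolventSet_iff_resolvent hI (inv_ne_zero (hdec ν hν)), inv_inv,
      add_sub_cancel] at h
    exact hν h
  intro ν hν
  refine ⟨?_, hne ν hν, ?_⟩
  · by_contra hcon
    have hseq : ∀ n : ℕ, ∃ ν' ∈ spectrum T, ν' ≠ ν ∧ dist ν' ν < 1 / ((n : ℝ) + 1) := fun n => by
      by_contra hno
      push Not at hno
      refine hcon ⟨Metric.ball ν (1 / ((n : ℝ) + 1)), Metric.ball_mem_nhds _ (by positivity), ?_⟩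
      ext ν'
      simp only [mem_inter_iff, Metric.mem_ball, mem_singleton_iff]
      constructor
      · rintro ⟨h1, h2⟩
        by_contra h3
        exact absurd h1 (not_lt.2 (hno ν' h2 h3))
      · rintro rfl
        exact ⟨by rw [dist_self]; positivity, hν⟩
    choose w hw hwne hwd using hseq
    have hwt : Tendsto w atTop (𝓝 ν) := by
      rw [tendsto_iff_dist_tendsto_zero]
      exact squeeze_zero (fun _ => dist_nonneg) (fun n => (hwd n).le)
        tendsto_one_div_add_atTop_nhds_zero_nat
    have hunit : ∀ n, ∃ e ∈ eigenspace T (w n), ‖e‖ = 1 := fun n => by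
      obtain ⟨f, hf, hf0⟩ := Submodule.exists_mem_ne_zero_of_ne_bot (hne _ (hw n))
      refine ⟨((‖f‖ : ℂ)⁻¹) • f, Submodule.smul_mem _ _ hf, ?_⟩
      rw [norm_smul, norm_inv, Complex.norm_real, norm_norm, inv_mul_cancel₀ (norm_ne_zero_iff.2 hf0)]
    choose e he hen using hunit
    obtain ⟨K, hK, hKsub⟩ := hR.image_closedBall_subset_compact (𝕜₁ := ℂ) (f := (resolvent T Complex.I : E →ₗ[ℂ] E)) 1
    obtain ⟨g, -, φ, hφ, hg⟩ := hK.tendsto_subseq (x := fun n => resolvent T Complex.I (e n))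
      fun n => hKsub ⟨e n, by simp [hen], rfl⟩
    have hRe : ∀ n, (w n - Complex.I) • resolvent T Complex.I (e n) = e n := fun n => by
      have := (mem_iff_resolvent hI).1 (mem_eigenspace.1 (he n))
      rw [← sub_smul, map_smul] at this
      exact this
    -- Each eigenvector equals `w n - i` times its image under the resolvent, so convergence of the
    -- images gives convergence of the vectors.
    have hlim : Tendsto (fun n => e (φ n)) atTop (𝓝 ((ν - Complex.I) • g)) := by
      have h1 : Tendsto (fun n => w (φ n) - Complex.I) atTop (𝓝 (ν - Complex.I)) :=
        (hwt.comp hφ.tendsto_atTop).sub_const _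
      refine (h1.smul hg).congr fun n => ?_
      exact hRe (φ n)
    set e₀ := (ν - Complex.I) • g with he₀
    have hg2 : resolvent T Complex.I e₀ = g :=
      tendsto_nhds_unique (((resolvent T Complex.I).continuous.tendsto _).comp hlim) hg
    have hmem : e₀ ∈ eigenspace T ν := by
      rw [mem_eigenspace, mem_iff_resolvent hI, ← sub_smul, map_smul, hg2]
    have h1 : Tendsto (fun n => ‖e (φ n)‖) atTop (𝓝 ‖e₀‖) := hlim.norm
    simp only [hen] at h1
    have h2 : ‖e₀‖ = 1 := (tendsto_nhds_unique h1 tendsto_const_nhds)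
    have h3 : Tendsto (fun n => (inner ℂ e₀ (e (φ n)) : ℂ)) atTop (𝓝 (inner ℂ e₀ e₀)) :=
      tendsto_const_nhds.inner hlim
    have h4 : (inner ℂ e₀ e₀ : ℂ) = 0 := by
      refine tendsto_nhds_unique h3 (tendsto_const_nhds.congr fun n => ?_)
      exact (hT.inner_eq_zero (hwne (φ n)).symm hmem (he (φ n))).symm
    rw [inner_self_eq_zero.1 h4, norm_zero] at h2
    exact zero_ne_one h2
  · rw [heig ν hν]
    exact ContinuousLinearMap.finite_dimensional_eigenspace hR _ (inv_ne_zero (hdec ν hν))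

theorem isCompactOperator_resolvent_of_mem {T : Submodule ℂ (E × E)} {z w : ℂ}
    (hz : z ∈ resolventSet T) (hw : w ∈ resolventSet T) (h : IsCompactOperator (resolvent T w)) :
    IsCompactOperator (resolvent T z) := by
  have key : ⇑(resolvent T z) =
      ⇑(resolvent T w) + (z - w) • (⇑(resolvent T z) ∘ ⇑(resolvent T w)) := by
    funext g
    have h1 := (mem_iff_resolvent hz).1 (resolvent_mem hw g)
    have h2 : g + w • resolvent T w g - z • resolvent T w g = g - (z - w) • resolvent T w g := by
      module
    rw [h2, map_sub, map_smul] at h1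
    simp only [Pi.add_apply, Pi.smul_apply, Function.comp_apply]
    exact sub_eq_iff_eq_add.1 h1
  rw [key]
  exact h.add ((h.clm_comp (resolvent T z)).smul (z - w))

theorem isCompactOperator_of_range_le {A : E →L[ℂ] E} {V : Submodule ℂ E}
    [FiniteDimensional ℂ V] (h : ∀ f, A f ∈ V) : IsCompactOperator A := by
  have h1 : IsCompactOperator (id : V → V) :=
    (isCompactOperator_id_iff_finiteDimensional (𝕜 := ℂ)).2 inferInstance
  exact (h1.comp_clm (A.codRestrict V h)).clm_comp V.subtypeL

/-- A bounded self-adjoint operator is compact if every nonzero point of its spectrum is isolated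
and its eigenspace has finite dimension. -/
theorem isCompactOperator_of_isolated [CompleteSpace E] {A : E →L[ℂ] E} (hA : _root_.IsSelfAdjoint A)
    (hiso : ∀ x ∈ _root_.spectrum ℝ A, x ≠ 0 → ∃ U ∈ 𝓝 x, U ∩ _root_.spectrum ℝ A ⊆ {x})
    (hfin : ∀ x ∈ _root_.spectrum ℝ A, x ≠ 0 →
      FiniteDimensional ℂ (Module.End.eigenspace (A : E →ₗ[ℂ] E) (x : ℂ))) :
    IsCompactOperator A := by
  classical
  set σ := _root_.spectrum ℝ A with hσ
  -- Isolation makes continuity on the spectrum automatic at every nonzero point, so any function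
  -- vanishing near `0` is admissible for the functional calculus.
  have hpure : ∀ x ∈ σ, x ≠ 0 → 𝓝[σ] x = pure x := fun x hx h0 => by
    obtain ⟨U, hU, hUs⟩ := hiso x hx h0
    refine le_antisymm ?_ (pure_le_nhdsWithin hx)
    rw [le_pure_iff]
    exact mem_of_superset (inter_mem_nhdsWithin σ hU) (by rw [inter_comm]; exact hUs)
  have hcont : ∀ f : ℝ → ℝ, f =ᶠ[𝓝 0] 0 → ContinuousOn f σ := fun f hf x hx => by
    by_cases h0 : x = 0
    · subst h0
      have : ContinuousAt f 0 := by
        rw [ContinuousAt, hf.eq_of_nhds]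
        exact tendsto_const_nhds.congr' hf.symm
      exact this.continuousWithinAt
    · rw [ContinuousWithinAt, hpure x hx h0]
      exact tendsto_pure_nhds _ _
  have hclosed : IsClosed {B : E →L[ℂ] E | IsCompactOperator B} := isClosed_setOfPred_isCompactOperator
  refine hclosed.closure_subset (Metric.mem_closure_iff.2 fun ε hε => ?_)
  set S : Set ℝ := σ ∩ {x | ε / 2 ≤ |x|} with hS
  have hS0 : ∀ x ∈ S, x ≠ 0 := by
    rintro x ⟨-, hx⟩ rfl
    simp only [mem_ofPred_eq, abs_zero] at hx
    linarith
  have hScomp : IsCompact S :=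
    (spectrum.isCompact A).inter_right (isClosed_le continuous_const continuous_abs)
  -- The part of the spectrum with `|x| ≥ ε / 2` is compact and discrete.
  have hSfin : S.Finite := by
    refine hScomp.finite ⟨discreteTopology_subtype_iff.2 fun x hx => ?_⟩
    obtain ⟨U, hU, hUs⟩ := hiso x hx.1 (hS0 x hx)
    rw [nhdsWithin, inf_assoc, inf_principal, ← nhdsWithin, ← empty_mem_iff_bot,
      mem_nhdsWithin_iff_exists_mem_nhds_inter]
    exact ⟨U, hU, fun y hy => hy.2.1 (hUs ⟨hy.1, hy.2.2.1⟩)⟩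
  let χ : ℝ → ℝ → ℝ := fun s x => if x = s then 1 else 0
  have hχ : ∀ s ∈ S, ContinuousOn (χ s) σ := fun s hs => hcont _ (by
    filter_upwards [isOpen_ne.mem_nhds (hS0 s hs).symm] with x hx
    exact if_neg hx)
  -- The finite sum of the spectral projections at the points of `S`, weighted by these points. Each
  -- projection maps into a finite-dimensional eigenspace, and `A - K` is given by a function
  -- bounded by `ε / 2` on the spectrum.
  let K : E →L[ℂ] E := ∑ s ∈ hSfin.toFinset, s • cfc (χ s) A
  have hKc : IsCompactOperator K := by
    refine Submodule.sum_mem (compactOperator (RingHom.id ℂ) E E) fun s hs => ?_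
    have hs' := hSfin.mem_toFinset.1 hs
    have := hfin s hs'.1 (hS0 s hs')
    refine isCompactOperator_of_range_le
      (V := Module.End.eigenspace (A : E →ₗ[ℂ] E) (s : ℂ)) fun f => ?_
    have h1 : A * cfc (χ s) A = s • cfc (χ s) A := by
      nth_rewrite 1 [← cfc_id ℝ A]
      rw [← cfc_mul id (χ s) A continuousOn_id (hχ s hs'), ← cfc_const_mul s (χ s) A (hχ s hs')]
      refine cfc_congr fun x _ => ?_
      by_cases hx : x = s <;> simp [χ, hx]
    have h2 : A (cfc (χ s) A f) = (s : ℂ) • cfc (χ s) A f := DFunLike.congr_fun h1 f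
    refine Submodule.smul_mem _ (s : ℂ) (Module.End.mem_eigenspace_iff.2 h2)
  refine ⟨K, hKc, ?_⟩
  have hid : cfc (id : ℝ → ℝ) A = A := cfc_id ℝ A
  have hKe : K = cfc (∑ s ∈ hSfin.toFinset, fun x => s * χ s x) A := by
    rw [cfc_sum (fun s x => s * χ s x) A hSfin.toFinset fun s hs =>
      continuousOn_const.mul (hχ s (hSfin.mem_toFinset.1 hs))]
    refine Finset.sum_congr rfl fun s hs => ?_
    rw [cfc_const_mul s (χ s) A (hχ s (hSfin.mem_toFinset.1 hs))]
  have hsum : ContinuousOn (∑ s ∈ hSfin.toFinset, fun x => s * χ s x) σ := by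
    have := continuousOn_finsetSum (t := σ) hSfin.toFinset (f := fun s x => s * χ s x)
      fun s hs => continuousOn_const.mul (hχ s (hSfin.mem_toFinset.1 hs))
    exact this.congr fun x _ => Finset.sum_apply _ _ _
  rw [dist_eq_norm, hKe]
  nth_rewrite 1 [← hid]
  rw [← cfc_sub _ _ A continuousOn_id hsum]
  refine lt_of_le_of_lt (norm_cfc_le (c := ε / 2) (by linarith) fun x hx => ?_) (by linarith)
  simp only [id, Finset.sum_apply]
  by_cases hxS : x ∈ S
  · have : ∑ s ∈ hSfin.toFinset, s * χ s x = x := by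
      rw [Finset.sum_eq_single x]
      · simp [χ]
      · intro s _ hs
        simp [χ, hs.symm]
      · intro h
        exact absurd (hSfin.mem_toFinset.2 hxS) h
    rw [this, sub_self, norm_zero]
    linarith
  · have : ∑ s ∈ hSfin.toFinset, s * χ s x = 0 := by
      refine Finset.sum_eq_zero fun s hs => ?_
      have : x ≠ s := by
        rintro rfl
        exact hxS (hSfin.mem_toFinset.1 hs)
      simp [χ, this]
    rw [this, sub_zero, Real.norm_eq_abs]
    by_contra hlt
    exact hxS ⟨hx, (not_le.1 hlt).le⟩

/-- At a real regular point `t` the resolvent is a bounded self-adjoint operator whose nonzero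
spectral points are the numbers `(ν - t)⁻¹` with `ν ∈ σ(T)`. They inherit isolation and finite
multiplicity, and compactness passes from `t` to `i` by the resolvent identity. -/
theorem IsSelfAdjoint.isCompactOperator_resolvent [CompleteSpace E] {T : Submodule ℂ (E × E)}
    (hT : IsSelfAdjoint T) (hd : HasDiscreteSpectrum T) :
    IsCompactOperator (resolvent T Complex.I) := by
  -- If `0` is not regular it is isolated in the spectrum, and then nearby nonzero reals are
  -- regular.
  have hreal : ∃ t : ℝ, (t : ℂ) ∈ resolventSet T := by
    by_contra hno
    push Not at hno
    have h0 : (0 : ℂ) ∈ spectrum T := fun h => hno 0 (by simpa using h)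
    obtain ⟨U, hU, hUs⟩ := (hd 0 h0).1
    have hc : Tendsto (fun t : ℝ => (t : ℂ)) (𝓝[≠] 0) (𝓝 0) := by
      have := Complex.continuous_ofReal.tendsto 0
      rw [Complex.ofReal_zero] at this
      exact this.mono_left nhdsWithin_le_nhds
    obtain ⟨t, ht, ht0⟩ := ((hc.eventually hU).and self_mem_nhdsWithin).exists
    have : (t : ℂ) ∈ U ∩ spectrum T := ⟨ht, hno t⟩
    rw [hUs] at this
    exact ht0 (by simpa using this)
  obtain ⟨t, ht⟩ := hreal
  refine isCompactOperator_resolvent_of_mem hT.I_mem_resolventSet ht ?_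
  set R := resolvent T (t : ℂ) with hR
  have hRs : _root_.IsSelfAdjoint R := by
    rw [ContinuousLinearMap.isSelfAdjoint_iff_isSymmetric]
    intro g h
    have h1 := hT.sform_eq_zero (resolvent_mem ht g) (resolvent_mem ht h)
    simp only [sform, inner_add_left, inner_add_right, inner_smul_left, inner_smul_right,
      Complex.conj_ofReal] at h1
    change (inner ℂ (R g) h : ℂ) = inner ℂ g (R h)
    linear_combination -h1
  have hsp : ∀ x : ℝ, x ≠ 0 → (x ∈ _root_.spectrum ℝ R ↔ (t : ℂ) + ((x : ℝ) : ℂ)⁻¹ ∈ spectrum T) :=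
    fun x hx => by
    rw [← spectrum.algebraMap_mem_iff ℂ, ← not_iff_not]
    have h1 := mem_resolventSet_iff_resolvent ht (μ := (x : ℂ)) (by exact_mod_cast hx)
    rw [spectrum, notMem_compl_iff, h1, _root_.spectrum, notMem_compl_iff]
    rfl
  refine isCompactOperator_of_isolated hRs (fun x hx h0 => ?_) (fun x hx h0 => ?_)
  · obtain ⟨U, hU, hUs⟩ := (hd _ ((hsp x h0).1 hx)).1
    have hc : ContinuousAt (fun y : ℝ => (t : ℂ) + (y : ℂ)⁻¹) x :=
      continuousAt_const.add (Complex.continuous_ofReal.continuousAt.inv₀ (by exact_mod_cast h0))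
    refine ⟨_, inter_mem (hc hU) (isOpen_ne.mem_nhds h0), ?_⟩
    rintro y ⟨⟨hyU, hy0⟩, hy⟩
    have : (t : ℂ) + (y : ℂ)⁻¹ ∈ U ∩ spectrum T := ⟨hyU, (hsp y hy0).1 hy⟩
    rw [hUs, mem_singleton_iff, add_right_inj, inv_inj] at this
    exact_mod_cast this
  · rw [← eigenspace_eq_eigenspace_resolvent ht (by exact_mod_cast h0)]
    exact (hd _ ((hsp x h0).1 hx)).2.2

theorem IsSelfAdjoint.hasDiscreteSpectrum_iff [CompleteSpace E] {T : Submodule ℂ (E × E)}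
    (hT : IsSelfAdjoint T) :
    HasDiscreteSpectrum T ↔ IsCompactOperator (resolvent T Complex.I) :=
  ⟨hT.isCompactOperator_resolvent, hT.hasDiscreteSpectrum⟩

end LinRel

/-! ### Calculus on a bounded interval -/

/-- The integral of `(‖g‖ - r)²` is nonnegative; the best choice of `r` is the mean of `‖g‖`. A
measure of total mass zero is treated apart. -/
theorem sq_integral_norm_le {α : Type*} [MeasurableSpace α] {μ : Measure α} [IsFiniteMeasure μ]
    {g : α → ℂ} (hg : MemLp g 2 μ) :
    (∫ t, ‖g t‖ ∂μ) ^ 2 ≤ μ.real univ * ∫ t, ‖g t‖ ^ 2 ∂μ := by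
  have h1 : Integrable (fun t => ‖g t‖) μ := (hg.integrable (by norm_num)).norm
  have h2 : Integrable (fun t => ‖g t‖ ^ 2) μ := hg.integrable_norm_pow (by norm_num)
  set A := ∫ t, ‖g t‖ ∂μ with hA
  set B := ∫ t, ‖g t‖ ^ 2 ∂μ with hB
  set L := μ.real univ with hL
  have hL0 : 0 ≤ L := measureReal_nonneg
  have key : ∀ r : ℝ, 0 ≤ B - 2 * r * A + r ^ 2 * L := fun r => by
    have h3 : ∫ t, (‖g t‖ - r) ^ 2 ∂μ = B - 2 * r * A + r ^ 2 * L := by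
      have : ∀ t, (‖g t‖ - r) ^ 2 = (‖g t‖ ^ 2 - (2 * r) * ‖g t‖) + r ^ 2 := fun t => by ring
      simp only [this]
      have h3 : Integrable (fun t => ‖g t‖ ^ 2 - (2 * r) * ‖g t‖) μ := h2.sub (h1.const_mul _)
      rw [integral_add h3 (integrable_const _), integral_sub h2 (h1.const_mul _), integral_const_mul, integral_const]
      simp only [smul_eq_mul]
      ring
    rw [← h3]
    exact integral_nonneg fun t => sq_nonneg _
  rcases hL0.eq_or_lt with h0 | h0
  · have hμ : μ = 0 := by
      have : μ univ = 0 := (measureReal_eq_zero_iff (measure_ne_top μ univ)).1 h0.symm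
      exact Measure.measure_univ_eq_zero.1 this
    have : A = 0 := by rw [hA, hμ, integral_zero_measure]
    rw [this, ← h0]
    simp
  · have := key (A / L)
    have h4 : B - 2 * (A / L) * A + (A / L) ^ 2 * L = B - A ^ 2 / L := by
      field_simp
      ring
    rw [h4] at this
    have h5 : A ^ 2 / L ≤ B := by linarith
    rw [div_le_iff₀ h0] at h5
    linarith

theorem AbsolutelyContinuousOnInterval.of_dist_le {f : ℝ → ℂ} {g : ℝ → ℝ} {a b : ℝ}
    (hg : AbsolutelyContinuousOnInterval g a b)
    (h : ∀ s ∈ uIcc a b, ∀ t ∈ uIcc a b, dist (f s) (f t) ≤ dist (g s) (g t)) :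
    AbsolutelyContinuousOnInterval f a b := by
  rw [absolutelyContinuousOnInterval_iff] at hg ⊢
  intro ε hε
  obtain ⟨δ, hδ, H⟩ := hg ε hε
  refine ⟨δ, hδ, fun E hE hlt => lt_of_le_of_lt (Finset.sum_le_sum fun i hi => ?_) (H E hE hlt)⟩
  exact h _ (hE.1 i hi).1 _ (hE.1 i hi).2

/-- Increments of `f` are dominated by those of the primitive of `‖w‖`. -/
theorem absolutelyContinuousOnInterval_of_primitive {f w : ℝ → ℂ} {a c : ℝ}
    (hw : IntervalIntegrable w volume a c)
    (hf : ∀ t ∈ uIcc a c, f t = f a + ∫ s in a..t, w s) :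
    AbsolutelyContinuousOnInterval f a c := by
  refine (hw.norm.absolutelyContinuousOnInterval_intervalIntegral left_mem_uIcc).of_dist_le
    fun s hs t ht => ?_
  have hi : ∀ r ∈ uIcc a c, IntervalIntegrable w volume a r := fun r hr =>
    hw.mono_set (uIcc_subset_uIcc_left hr)
  rw [hf s hs, hf t ht, dist_add_left, dist_comm, dist_eq_norm, dist_comm, dist_eq_norm,
    intervalIntegral.integral_interval_sub_left (hi t ht) (hi s hs),
    intervalIntegral.integral_interval_sub_left (hi t ht).norm (hi s hs).norm]
  exact intervalIntegral.norm_integral_le_abs_integral_norm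

/-- `U` is a function on `[a, c]` with absolutely continuous derivative `V` and second derivative
`w` in `L²`. -/
structure IsSob (a c : ℝ) (U V w : ℝ → ℂ) : Prop where
  lt : a < c
  memLp : MemLp w 2 (volume.restrict (Ioo a c))
  V_eq : ∀ t ∈ Icc a c, V t = V a + ∫ s in a..t, w s
  U_eq : ∀ t ∈ Icc a c, U t = U a + ∫ s in a..t, V s

theorem memLp_two_of_continuousOn {a c : ℝ} {f : ℝ → ℂ} (hf : ContinuousOn f (Icc a c)) :
    MemLp f 2 (volume.restrict (Ioo a c)) := by
  obtain ⟨C, hC⟩ := isCompact_Icc.exists_bound_of_continuousOn hf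
  refine MemLp.of_bound ((hf.mono Ioo_subset_Icc_self).aestronglyMeasurable measurableSet_Ioo) C ?_
  filter_upwards [ae_restrict_mem measurableSet_Ioo] with t ht using hC t (Ioo_subset_Icc_self ht)

theorem setIntegral_Ioo_eq {a c : ℝ} (h : a ≤ c) {G : Type*} [NormedAddCommGroup G]
    [NormedSpace ℝ G] (f : ℝ → G) : ∫ t in Ioo a c, f t = ∫ t in a..c, f t := by
  rw [intervalIntegral.integral_of_le h, integral_Ioc_eq_integral_Ioo]

/-- Cauchy–Schwarz on a subinterval. -/
theorem norm_integral_sq_le {a c : ℝ} {g : ℝ → ℂ} (hg : MemLp g 2 (volume.restrict (Ioo a c)))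
    {s t : ℝ} (hs : s ∈ Icc a c) (ht : t ∈ Icc a c) :
    ‖∫ r in s..t, g r‖ ^ 2 ≤ |t - s| * ∫ r in a..c, ‖g r‖ ^ 2 := by
  wlog hst : s ≤ t generalizing s t
  · rw [intervalIntegral.integral_symm, norm_neg, abs_sub_comm]
    exact this ht hs (le_of_not_ge hst)
  have hac : a ≤ c := hs.1.trans hs.2
  have hsub : Ioo s t ⊆ Ioo a c := Ioo_subset_Ioo hs.1 ht.2
  have hg' : MemLp g 2 (volume.restrict (Ioo s t)) :=
    hg.mono_measure (Measure.restrict_mono hsub le_rfl)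
  have h1 : ‖∫ r in s..t, g r‖ ≤ ∫ r in Ioo s t, ‖g r‖ := by
    rw [← setIntegral_Ioo_eq hst]
    exact norm_integral_le_integral_norm _
  have h2 := sq_integral_norm_le hg'
  have h3 : (volume.restrict (Ioo s t)).real univ = |t - s| := by
    rw [measureReal_restrict_apply_univ, Real.volume_real_Ioo_of_le hst,
      abs_of_nonneg (sub_nonneg.2 hst)]
  rw [h3] at h2
  have h4 : ∫ r in Ioo s t, ‖g r‖ ^ 2 ≤ ∫ r in a..c, ‖g r‖ ^ 2 := by
    rw [← setIntegral_Ioo_eq hac]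
    exact setIntegral_mono_set (hg.integrable_norm_pow (by norm_num))
      (Eventually.of_forall fun _ => sq_nonneg _) hsub.eventuallyLE
  calc ‖∫ r in s..t, g r‖ ^ 2 ≤ (∫ r in Ioo s t, ‖g r‖) ^ 2 :=
        pow_le_pow_left₀ (norm_nonneg _) h1 2
    _ ≤ |t - s| * ∫ r in Ioo s t, ‖g r‖ ^ 2 := h2
    _ ≤ _ := mul_le_mul_of_nonneg_left h4 (abs_nonneg _)

theorem MemLp.intervalIntegrable_Ioo {a c : ℝ} (hac : a ≤ c) {g : ℝ → ℂ}
    (hg : MemLp g 2 (volume.restrict (Ioo a c))) : IntervalIntegrable g volume a c :=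
  (intervalIntegrable_iff_integrableOn_Ioo_of_le hac).2 (hg.integrable (by norm_num))

namespace IsSob

variable {a c : ℝ} {U V w : ℝ → ℂ}

theorem intervalIntegrable (h : IsSob a c U V w) : IntervalIntegrable w volume a c :=
  MemLp.intervalIntegrable_Ioo h.lt.le h.memLp

theorem ac_V (h : IsSob a c U V w) : AbsolutelyContinuousOnInterval V a c :=
  absolutelyContinuousOnInterval_of_primitive h.intervalIntegrable
    (by rw [uIcc_of_le h.lt.le]; exact h.V_eq)

theorem continuousOn_V (h : IsSob a c U V w) : ContinuousOn V (Icc a c) := by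
  rw [← uIcc_of_le h.lt.le]
  exact h.ac_V.continuousOn

theorem intervalIntegrable_V (h : IsSob a c U V w) : IntervalIntegrable V volume a c :=
  h.continuousOn_V.intervalIntegrable_of_Icc h.lt.le

theorem ac_U (h : IsSob a c U V w) : AbsolutelyContinuousOnInterval U a c :=
  absolutelyContinuousOnInterval_of_primitive h.intervalIntegrable_V
    (by rw [uIcc_of_le h.lt.le]; exact h.U_eq)

theorem continuousOn_U (h : IsSob a c U V w) : ContinuousOn U (Icc a c) := by
  rw [← uIcc_of_le h.lt.le]
  exact h.ac_U.continuousOn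

theorem hasDerivAt_U (h : IsSob a c U V w) {t : ℝ} (ht : t ∈ Ioo a c) : HasDerivAt U (V t) t := by
  have hca : ContinuousAt V t := h.continuousOn_V.continuousAt (Icc_mem_nhds ht.1 ht.2)
  have h1 := intervalIntegral.integral_hasDerivAt_right
    (h.intervalIntegrable_V.mono_set (uIcc_subset_uIcc_left
      (by rw [uIcc_of_le h.lt.le]; exact Ioo_subset_Icc_self ht)))
    ((h.continuousOn_V.mono Ioo_subset_Icc_self).stronglyMeasurableAtFilter isOpen_Ioo t ht) hca
  refine (h1.const_add (U a)).congr_of_eventuallyEq ?_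
  filter_upwards [Ioo_mem_nhds ht.1 ht.2] with s hs using h.U_eq s (Ioo_subset_Icc_self hs)

theorem ae_hasDerivAt_V (h : IsSob a c U V w) :
    ∀ᵐ t, t ∈ Ioo a c → HasDerivAt V (w t) t := by
  filter_upwards [h.intervalIntegrable.ae_hasDerivAt_integral] with t ht hm
  have h1 := ht (by rw [uIcc_of_le h.lt.le]; exact Ioo_subset_Icc_self hm) a left_mem_uIcc
  refine (h1.const_add (V a)).congr_of_eventuallyEq ?_
  filter_upwards [Ioo_mem_nhds hm.1 hm.2] with s hs using h.V_eq s (Ioo_subset_Icc_self hs)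

theorem V_sub (h : IsSob a c U V w) {s t : ℝ} (hs : s ∈ Icc a c) (ht : t ∈ Icc a c) :
    V t - V s = ∫ r in s..t, w r := by
  have hi : ∀ r ∈ Icc a c, IntervalIntegrable w volume a r := fun r hr =>
    h.intervalIntegrable.mono_set (uIcc_subset_uIcc_left (by rwa [uIcc_of_le h.lt.le]))
  rw [h.V_eq t ht, h.V_eq s hs, add_sub_add_left_eq_sub,
    intervalIntegral.integral_interval_sub_left (hi t ht) (hi s hs)]

theorem U_sub (h : IsSob a c U V w) {s t : ℝ} (hs : s ∈ Icc a c) (ht : t ∈ Icc a c) :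
    U t - U s = ∫ r in s..t, V r := by
  have hi : ∀ r ∈ Icc a c, IntervalIntegrable V volume a r := fun r hr =>
    h.intervalIntegrable_V.mono_set (uIcc_subset_uIcc_left (by rwa [uIcc_of_le h.lt.le]))
  rw [h.U_eq t ht, h.U_eq s hs, add_sub_add_left_eq_sub,
    intervalIntegral.integral_interval_sub_left (hi t ht) (hi s hs)]

theorem norm_V_sub_sq_le (h : IsSob a c U V w) {s t : ℝ} (hs : s ∈ Icc a c) (ht : t ∈ Icc a c) :
    ‖V t - V s‖ ^ 2 ≤ (c - a) * ∫ r in a..c, ‖w r‖ ^ 2 := by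
  rw [h.V_sub hs ht]
  refine (norm_integral_sq_le h.memLp hs ht).trans (mul_le_mul_of_nonneg_right ?_ ?_)
  · rw [abs_le]
    constructor <;> linarith [hs.1, hs.2, ht.1, ht.2]
  · exact intervalIntegral.integral_nonneg h.lt.le fun _ _ => sq_nonneg _

/-- Integration by parts. -/
theorem integral_mul_conj (h : IsSob a c U V w) {U₂ V₂ w₂ : ℝ → ℂ} (h₂ : IsSob a c U₂ V₂ w₂) :
    ∫ t in a..c, w t * (starRingEnd ℂ) (U₂ t) =
      V c * (starRingEnd ℂ) (U₂ c) - V a * (starRingEnd ℂ) (U₂ a)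
        - ∫ t in a..c, V t * (starRingEnd ℂ) (V₂ t) := by
  have hconj : AbsolutelyContinuousOnInterval (fun t => (starRingEnd ℂ) (U₂ t)) a c := by
    refine squeeze_zero (fun _ => Finset.sum_nonneg fun _ _ => dist_nonneg) (fun E => ?_) h₂.ac_U
    refine Finset.sum_le_sum fun _ _ => ?_
    rw [Complex.dist_conj_conj]
  have hprod : AbsolutelyContinuousOnInterval (fun t => V t * (starRingEnd ℂ) (U₂ t)) a c :=
    h.ac_V.smul hconj
  have hI1 : IntervalIntegrable (fun t => w t * (starRingEnd ℂ) (U₂ t)) volume a c :=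
    h.intervalIntegrable.mul_continuousOn hconj.continuousOn
  have hcV : ContinuousOn (fun t => (starRingEnd ℂ) (V₂ t)) (Icc a c) :=
    Complex.continuous_conj.comp_continuousOn h₂.continuousOn_V
  have hI2 : IntervalIntegrable (fun t => V t * (starRingEnd ℂ) (V₂ t)) volume a c :=
    (h.continuousOn_V.mul hcV).intervalIntegrable_of_Icc h.lt.le
  have hae : ∀ᵐ t, t ∈ uIoc a c → deriv (fun t => V t * (starRingEnd ℂ) (U₂ t)) t =
      w t * (starRingEnd ℂ) (U₂ t) + V t * (starRingEnd ℂ) (V₂ t) := by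
    have hne : ∀ᵐ t : ℝ, t ≠ c := by simp [ae_iff, measure_singleton]
    filter_upwards [h.ae_hasDerivAt_V, hne] with t ht htc hm
    rw [uIoc_of_le h.lt.le] at hm
    have hm' : t ∈ Ioo a c := ⟨hm.1, lt_of_le_of_ne hm.2 htc⟩
    have hd : HasDerivAt (fun t => (starRingEnd ℂ) (U₂ t)) ((starRingEnd ℂ) (V₂ t)) t :=
      (h₂.hasDerivAt_U hm').star
    exact ((ht hm').mul hd).deriv
  have hftc := hprod.complex_ftc.2
  rw [intervalIntegral.integral_congr_ae hae, intervalIntegral.integral_add hI1 hI2] at hftc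
  linear_combination hftc

/-- The mean value of the derivative. -/
def slope (a c : ℝ) (U : ℝ → ℂ) : ℂ := (U c - U a) / ((c - a : ℝ) : ℂ)

/-- The part of the energy above that of the linear interpolation. -/
def excess (a c : ℝ) (U V : ℝ → ℂ) : ℝ := ∫ t in a..c, ‖V t - slope a c U‖ ^ 2

theorem excess_nonneg (h : IsSob a c U V w) : 0 ≤ excess a c U V :=
  intervalIntegral.integral_nonneg h.lt.le fun _ _ => sq_nonneg _

theorem slope_mul (h : IsSob a c U V w) :
    slope a c U * ((c - a : ℝ) : ℂ) = U c - U a := by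
  rw [slope, div_mul_cancel₀]
  exact_mod_cast (sub_pos.2 h.lt).ne'

theorem intervalIntegrable_norm_sq_V (h : IsSob a c U V w) :
    IntervalIntegrable (fun t => ‖V t‖ ^ 2) volume a c :=
  (h.continuousOn_V.norm.pow 2).intervalIntegrable_of_Icc h.lt.le

/-- A variance formula: `slope` is the mean of `V`, so the cross term equals minus twice the energy
of the linear interpolant. The subtracted quotient is the term that the modified `Γ₁` produces. -/
theorem excess_eq (h : IsSob a c U V w) :
    excess a c U V = (∫ t in a..c, ‖V t‖ ^ 2) - ‖U c - U a‖ ^ 2 / (c - a) := by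
  have hd : 0 < c - a := sub_pos.2 h.lt
  set m := slope a c U with hm
  have hpt : ∀ t, ‖V t - m‖ ^ 2 = ‖V t‖ ^ 2 - 2 * ((starRingEnd ℂ) m * V t).re + ‖m‖ ^ 2 := by
    intro t
    rw [@norm_sub_sq ℂ]
    simp only [RCLike.inner_apply, RCLike.re_eq_complex_re]
    congr 3
    simp [Complex.mul_re]
  have hI : IntervalIntegrable (fun t => (starRingEnd ℂ) m * V t) volume a c :=
    h.intervalIntegrable_V.const_mul _
  have hIre : IntervalIntegrable (fun t => ((starRingEnd ℂ) m * V t).re) volume a c :=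
    ⟨hI.1.re, hI.2.re⟩
  have hre : ∫ t in a..c, ((starRingEnd ℂ) m * V t).re = ‖m‖ ^ 2 * (c - a) := by
    have h1 : ∫ t in a..c, ((starRingEnd ℂ) m * V t).re =
        (∫ t in a..c, (starRingEnd ℂ) m * V t).re := by
      rw [intervalIntegral.integral_of_le h.lt.le, intervalIntegral.integral_of_le h.lt.le]
      exact integral_re hI.1
    rw [h1, intervalIntegral.integral_const_mul,
      ← h.U_sub (left_mem_Icc.2 h.lt.le) (right_mem_Icc.2 h.lt.le), ← h.slope_mul, ← hm,
      ← mul_assoc, mul_comm _ m, Complex.mul_conj, Complex.normSq_eq_norm_sq, ← Complex.ofReal_mul,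
      Complex.ofReal_re]
  have hnm : ‖U c - U a‖ ^ 2 / (c - a) = ‖m‖ ^ 2 * (c - a) := by
    rw [← h.slope_mul, norm_mul, Complex.norm_real, Real.norm_of_nonneg hd.le, ← hm]
    field_simp
  rw [excess, ← hm, hnm]
  simp only [hpt]
  rw [intervalIntegral.integral_add (h.intervalIntegrable_norm_sq_V.sub (hIre.const_mul 2))
    intervalIntegrable_const, intervalIntegral.integral_sub h.intervalIntegrable_norm_sq_V
    (hIre.const_mul 2), intervalIntegral.integral_const_mul, hre, intervalIntegral.integral_const]
  simp only [smul_eq_mul]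
  ring

/-- Since `slope` is the mean of `V`, `V t - slope` is the mean of `V t - V r` over `r`, and each
such difference is bounded by Cauchy–Schwarz. -/
theorem norm_V_sub_slope_sq_le (h : IsSob a c U V w) {t : ℝ} (ht : t ∈ Icc a c) :
    ‖V t - slope a c U‖ ^ 2 ≤ (c - a) * ∫ r in a..c, ‖w r‖ ^ 2 := by
  have hd : 0 < c - a := sub_pos.2 h.lt
  set W := ∫ r in a..c, ‖w r‖ ^ 2 with hW
  have hW0 : 0 ≤ W := intervalIntegral.integral_nonneg h.lt.le fun _ _ => sq_nonneg _
  have h1 : (V t - slope a c U) * ((c - a : ℝ) : ℂ) = ∫ r in a..c, (V t - V r) := by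
    rw [intervalIntegral.integral_sub intervalIntegrable_const h.intervalIntegrable_V,
      intervalIntegral.integral_const, ← h.U_sub (left_mem_Icc.2 h.lt.le) (right_mem_Icc.2 h.lt.le),
      sub_mul, h.slope_mul, Complex.real_smul]
    ring
  have h2 : ‖∫ r in a..c, (V t - V r)‖ ≤ Real.sqrt ((c - a) * W) * |c - a| := by
    refine intervalIntegral.norm_integral_le_of_norm_le_const fun r hr => ?_
    rw [uIoc_of_le h.lt.le] at hr
    exact Real.le_sqrt_of_sq_le (h.norm_V_sub_sq_le (Ioc_subset_Icc_self hr) ht)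
  rw [← h1, norm_mul, Complex.norm_real, Real.norm_of_nonneg hd.le, abs_of_pos hd] at h2
  have h3 := le_of_mul_le_mul_right h2 hd
  calc _ ≤ Real.sqrt ((c - a) * W) ^ 2 := pow_le_pow_left₀ (norm_nonneg _) h3 2
    _ = _ := Real.sq_sqrt (by positivity)

theorem excess_le (h : IsSob a c U V w) :
    excess a c U V ≤ (c - a) ^ 2 * ∫ r in a..c, ‖w r‖ ^ 2 := by
  have hd : 0 < c - a := sub_pos.2 h.lt
  have hc : ContinuousOn (fun t => ‖V t - slope a c U‖ ^ 2) (Icc a c) :=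
    (h.continuousOn_V.sub continuousOn_const).norm.pow 2
  have h1 := intervalIntegral.integral_mono_on (μ := volume) h.lt.le (hc.intervalIntegrable_of_Icc h.lt.le)
    intervalIntegrable_const fun t ht => h.norm_V_sub_slope_sq_le ht
  rw [intervalIntegral.integral_const, smul_eq_mul] at h1
  exact h1.trans (le_of_eq (by ring))

/-- The boundary values `d U'(a) + U(a) - U(c)` and `d U'(c) + U(a) - U(c)`. -/
theorem norm_mul_V_sub_sq_le (h : IsSob a c U V w) {t : ℝ} (ht : t ∈ Icc a c) :
    ‖((c - a : ℝ) : ℂ) * V t + (U a - U c)‖ ^ 2 ≤ (c - a) ^ 3 * ∫ r in a..c, ‖w r‖ ^ 2 := by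
  have hd : 0 < c - a := sub_pos.2 h.lt
  have h1 : ((c - a : ℝ) : ℂ) * V t + (U a - U c) =
      ((c - a : ℝ) : ℂ) * (V t - slope a c U) := by
    rw [mul_sub, mul_comm _ (slope a c U), h.slope_mul]
    ring
  rw [h1, norm_mul, mul_pow, Complex.norm_real, Real.norm_of_nonneg hd.le]
  calc _ ≤ (c - a) ^ 2 * ((c - a) * ∫ r in a..c, ‖w r‖ ^ 2) :=
        mul_le_mul_of_nonneg_left (h.norm_V_sub_slope_sq_le ht) (by positivity)
    _ = _ := by ring

end IsSob

/-- A trace inequality for perturbations of linear functions. -/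
theorem trace_le_of_affine_approx {φ : ℝ → ℂ} {m : ℂ} {d δ Q : ℝ} (hδ : 0 < δ) (hδd : δ ≤ d)
    (hφ : ContinuousOn φ (Icc 0 d))
    (h : ∀ s ∈ Icc 0 d, ‖φ s - φ 0 - s * m‖ ^ 2 ≤ s * Q) :
    δ * ‖φ 0‖ ^ 2 ≤ 36 * (∫ s in 0..d, ‖φ s‖ ^ 2) + 6 * δ ^ 2 * Q := by
  have hd : 0 < d := hδ.trans_le hδd
  -- The combination `2 φ(s) - φ(2s)` reproduces `φ(0)` and cancels the linear term, so the slope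
  -- `m`, over which there is no control, costs nothing. The errors at `s` and `2s` contribute `4 (4
  -- s Q + 2 s Q) = 24 Q s`; integration over `[0, δ/2]` then gives the constants `36` and `6`.
  have hpt : ∀ s ∈ Icc 0 (δ / 2),
      ‖φ 0‖ ^ 2 ≤ 16 * ‖φ s‖ ^ 2 + 4 * ‖φ (2 * s)‖ ^ 2 + 24 * Q * s := by
    intro s hs
    have e1 := h s ⟨hs.1, by linarith [hs.2]⟩
    have e2 := h (2 * s) ⟨by linarith [hs.1], by linarith [hs.2]⟩
    have h1 : φ 0 = 2 * φ s - φ (2 * s) - 2 * (φ s - φ 0 - s * m) +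
        (φ (2 * s) - φ 0 - ((2 * s : ℝ) : ℂ) * m) := by
      push_cast
      ring
    set A := ‖φ s‖
    set B := ‖φ (2 * s)‖
    set C := ‖φ s - φ 0 - s * m‖
    set D := ‖φ (2 * s) - φ 0 - ((2 * s : ℝ) : ℂ) * m‖
    have h2 : ‖φ 0‖ ≤ 2 * A + B + 2 * C + D := by
      rw [h1]
      refine (norm_add_le _ _).trans (add_le_add ((norm_sub_le _ _).trans (add_le_add
        ((norm_sub_le _ _).trans (add_le_add ?_ le_rfl)) ?_)) le_rfl)
      · rw [norm_mul]; simp [A]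
      · rw [norm_mul]; simp [C]
    have h3 : ‖φ 0‖ ^ 2 ≤ (2 * A + B + 2 * C + D) ^ 2 := pow_le_pow_left₀ (norm_nonneg _) h2 2
    have h4 : (2 * A + B + 2 * C + D) ^ 2 ≤ 4 * (4 * A ^ 2 + B ^ 2 + 4 * C ^ 2 + D ^ 2) := by
      nlinarith [sq_nonneg (2 * A - B), sq_nonneg (2 * A - 2 * C), sq_nonneg (2 * A - D),
        sq_nonneg (B - 2 * C), sq_nonneg (B - D), sq_nonneg (2 * C - D)]
    linarith
  have hc1 : ContinuousOn (fun s => ‖φ s‖ ^ 2) (Icc 0 d) := hφ.norm.pow 2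
  have hc2 : ContinuousOn (fun s => ‖φ (2 * s)‖ ^ 2) (Icc 0 (δ / 2)) :=
    hc1.comp (f := fun s => 2 * s) (by fun_prop)
      fun s hs => ⟨by linarith [hs.1], by linarith [hs.2]⟩
  have hI1 : IntervalIntegrable (fun s => ‖φ s‖ ^ 2) volume 0 (δ / 2) :=
    (hc1.mono (Icc_subset_Icc_right (by linarith))).intervalIntegrable_of_Icc (by linarith)
  have hI2 : IntervalIntegrable (fun s => ‖φ (2 * s)‖ ^ 2) volume 0 (δ / 2) :=
    hc2.intervalIntegrable_of_Icc (by linarith)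
  have hI3 : IntervalIntegrable (fun s : ℝ => 24 * Q * s) volume 0 (δ / 2) :=
    (by fun_prop : Continuous fun s : ℝ => 24 * Q * s).intervalIntegrable _ _
  have hint := intervalIntegral.integral_mono_on (by linarith : (0 : ℝ) ≤ δ / 2)
    intervalIntegrable_const (((hI1.const_mul 16).add (hI2.const_mul 4)).add hI3) hpt
  rw [intervalIntegral.integral_const, intervalIntegral.integral_add
    ((hI1.const_mul 16).add (hI2.const_mul 4)) hI3, intervalIntegral.integral_add
    (hI1.const_mul 16) (hI2.const_mul 4), intervalIntegral.integral_const_mul,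
    intervalIntegral.integral_const_mul, intervalIntegral.integral_const_mul, integral_id,
    intervalIntegral.integral_comp_mul_left (fun s => ‖φ s‖ ^ 2) (by norm_num : (2 : ℝ) ≠ 0)] at hint
  have hmono : ∀ e, 0 ≤ e → e ≤ d → ∫ s in 0..e, ‖φ s‖ ^ 2 ≤ ∫ s in 0..d, ‖φ s‖ ^ 2 :=
    fun e he hed => intervalIntegral.integral_mono_interval le_rfl he hed
      (Eventually.of_forall fun _ => sq_nonneg _) (hc1.intervalIntegrable_of_Icc hd.le)
  have h1 := hmono (δ / 2) (by linarith) (by linarith)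
  have h2 := hmono (2 * (δ / 2)) (by linarith) (by linarith)
  simp only [smul_eq_mul, mul_zero, sub_zero] at hint
  nlinarith [hint, h1, h2]

namespace IsSob

variable {a c : ℝ} {U V w : ℝ → ℂ}

theorem affine_approx (h : IsSob a c U V w) {s t : ℝ} (hs : s ∈ Icc a c) (ht : t ∈ Icc a c) :
    ‖U t - U s - ((t - s : ℝ) : ℂ) * slope a c U‖ ^ 2 ≤ |t - s| * excess a c U V := by
  have h1 : U t - U s - ((t - s : ℝ) : ℂ) * slope a c U =
      ∫ r in s..t, (V r - slope a c U) := by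
    rw [intervalIntegral.integral_sub (h.intervalIntegrable_V.mono_set ?_) intervalIntegrable_const,
      intervalIntegral.integral_const, h.U_sub hs ht, Complex.real_smul]
    rw [uIcc_of_le h.lt.le]
    exact uIcc_subset_Icc hs ht
  rw [h1]
  exact norm_integral_sq_le (memLp_two_of_continuousOn
    (h.continuousOn_V.sub continuousOn_const)) hs ht

theorem trace_left (h : IsSob a c U V w) {δ : ℝ} (hδ : 0 < δ) (hδd : δ ≤ c - a) :
    δ * ‖U a‖ ^ 2 ≤ 36 * (∫ s in a..c, ‖U s‖ ^ 2) + 6 * δ ^ 2 * excess a c U V := by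
  have hcont : ContinuousOn (fun s => U (a + s)) (Icc 0 (c - a)) :=
    h.continuousOn_U.comp (f := fun s => a + s) (by fun_prop)
      fun s hs => ⟨by linarith [hs.1], by linarith [hs.2]⟩
  have h1 := trace_le_of_affine_approx (φ := fun s => U (a + s)) (m := slope a c U)
    (Q := excess a c U V) hδ hδd hcont (fun s hs => by
      have h2 := h.affine_approx (s := a) (t := a + s) (left_mem_Icc.2 h.lt.le)
        ⟨by linarith [hs.1], by linarith [hs.2]⟩
      rw [add_sub_cancel_left, abs_of_nonneg hs.1] at h2
      simpa using h2)
  rw [intervalIntegral.integral_comp_add_left (fun s => ‖U s‖ ^ 2), add_zero, add_sub_cancel] at h1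
  exact h1

theorem trace_right (h : IsSob a c U V w) {δ : ℝ} (hδ : 0 < δ) (hδd : δ ≤ c - a) :
    δ * ‖U c‖ ^ 2 ≤ 36 * (∫ s in a..c, ‖U s‖ ^ 2) + 6 * δ ^ 2 * excess a c U V := by
  have hcont : ContinuousOn (fun s => U (c - s)) (Icc 0 (c - a)) :=
    h.continuousOn_U.comp (f := fun s => c - s) (by fun_prop)
      fun s hs => ⟨by linarith [hs.2], by linarith [hs.1]⟩
  have h1 := trace_le_of_affine_approx (φ := fun s => U (c - s)) (m := -slope a c U)
    (Q := excess a c U V) hδ hδd hcont (fun s hs => by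
      have h2 := h.affine_approx (s := c) (t := c - s) (right_mem_Icc.2 h.lt.le)
        ⟨by linarith [hs.2], by linarith [hs.1]⟩
      rw [sub_sub_cancel_left, abs_neg, abs_of_nonneg hs.1] at h2
      simpa using h2)
  rw [intervalIntegral.integral_comp_sub_left (fun s => ‖U s‖ ^ 2), sub_zero, sub_sub_cancel] at h1
  exact h1

/-- With zero end values the linear interpolant vanishes and the excess is the whole energy. -/
theorem integral_norm_V_sq_le_of_dirichlet (h : IsSob a c U V w) (ha : U a = 0) (hc : U c = 0) :
    ∫ t in a..c, ‖V t‖ ^ 2 ≤ (c - a) ^ 2 * ∫ t in a..c, ‖w t‖ ^ 2 := by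
  have h1 := h.excess_le
  rw [h.excess_eq, ha, hc, sub_self, norm_zero] at h1
  simpa using h1

theorem integral_norm_U_sub_sq_le (h : IsSob a c U V w) {s t : ℝ} (hs : s ∈ Icc a c)
    (ht : t ∈ Icc a c) (hst : s ≤ t) :
    ∫ r in s..t, ‖U r - U s‖ ^ 2 ≤ (t - s) ^ 2 * ∫ r in s..t, ‖V r‖ ^ 2 := by
  have hsub : Icc s t ⊆ Icc a c := Icc_subset_Icc hs.1 ht.2
  have hc1 : ContinuousOn (fun r => ‖U r - U s‖ ^ 2) (Icc s t) :=
    ((h.continuousOn_U.mono hsub).sub continuousOn_const).norm.pow 2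
  set K := ∫ r in s..t, ‖V r‖ ^ 2 with hK
  have hK0 : 0 ≤ K := intervalIntegral.integral_nonneg hst fun _ _ => sq_nonneg _
  have h1 := intervalIntegral.integral_mono_on (μ := volume) hst (hc1.intervalIntegrable_of_Icc hst)
    (intervalIntegrable_const (c := (t - s) * K)) fun r hr => by
      rw [h.U_sub hs (hsub hr)]
      refine (norm_integral_sq_le (memLp_two_of_continuousOn (h.continuousOn_V.mono hsub))
        (left_mem_Icc.2 hst) hr).trans (mul_le_mul_of_nonneg_right ?_ hK0)
      rw [abs_of_nonneg (by linarith [hr.1])]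
      linarith [hr.2]
  rw [intervalIntegral.integral_const, smul_eq_mul] at h1
  exact h1.trans (le_of_eq (by ring))

end IsSob

namespace PointSeq

variable (X : PointSeq)

/-! ### Decomposition into the intervals `(xₙ, xₙ₊₁)` -/

theorem lt_succ (n : ℕ) : X.x n < X.x (n + 1) := X.strictMono n.lt_succ_self

theorem d_pos (n : ℕ) : 0 < X.d n := sub_pos.2 (X.lt_succ n)

theorem disjoint_gaps : Pairwise (Function.onFun Disjoint fun n => Ioo (X.x n) (X.x (n + 1))) := by
  have key : ∀ i j, i < j → Disjoint (Ioo (X.x i) (X.x (i + 1))) (Ioo (X.x j) (X.x (j + 1))) := by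
    intro i j hij
    rw [Set.disjoint_left]
    intro t h1 h2
    exact absurd (h1.2.trans_le (X.strictMono.monotone hij)) (not_lt.2 h2.1.le)
  intro i j hij
  rcases lt_or_gt_of_ne hij with h | h
  · exact key i j h
  · exact (key j i h).symm

theorem eq_of_mem_gap {m n : ℕ} {t : ℝ} (hm : t ∈ Ioo (X.x m) (X.x (m + 1)))
    (hn : t ∈ Ioo (X.x n) (X.x (n + 1))) : m = n := by
  by_contra h
  exact Set.disjoint_left.1 (X.disjoint_gaps h) hm hn

theorem vol_eq : X.vol = volume.restrict (⋃ n, Ioo (X.x n) (X.x (n + 1))) := by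
  rw [← X.gaps_eq]
  refine Measure.restrict_congr_set ?_
  exact (sdiff_null_ae_eq_self ((countable_range X.x).measure_zero volume)).symm

theorem restrict_gap_le (n : ℕ) : volume.restrict (Ioo (X.x n) (X.x (n + 1))) ≤ X.vol := by
  rw [vol_eq]
  exact Measure.restrict_mono (subset_iUnion (fun n => Ioo (X.x n) (X.x (n + 1))) n) le_rfl

theorem hasSum_integral {G : Type*} [NormedAddCommGroup G] [NormedSpace ℝ G] {f : ℝ → G}
    (hf : Integrable f X.vol) :
    HasSum (fun n => ∫ t in X.x n..X.x (n + 1), f t) (∫ t, f t ∂X.vol) := by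
  rw [vol_eq] at hf ⊢
  have h := hasSum_integral_iUnion (fun n => measurableSet_Ioo) X.disjoint_gaps hf
  refine h.congr_fun fun n => ?_
  exact (setIntegral_Ioo_eq (X.lt_succ n).le f).symm

theorem ae_vol_of_forall {p : ℝ → Prop}
    (h : ∀ n, ∀ᵐ t, t ∈ Ioo (X.x n) (X.x (n + 1)) → p t) : ∀ᵐ t ∂X.vol, p t := by
  rw [vol_eq, ae_restrict_iUnion_iff]
  exact fun n => (ae_restrict_iff' measurableSet_Ioo).2 (h n)

theorem ae_gap_of_ae_vol {p : ℝ → Prop} (h : ∀ᵐ t ∂X.vol, p t) (n : ℕ) :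
    ∀ᵐ t, t ∈ Ioo (X.x n) (X.x (n + 1)) → p t :=
  (ae_restrict_iff' measurableSet_Ioo).1 ((X.restrict_gap_le n).absolutelyContinuous.ae_le h)

theorem memLp_vol {f : ℝ → ℂ} (h : ∀ n, MemLp f 2 (volume.restrict (Ioo (X.x n) (X.x (n + 1)))))
    (hs : Summable fun n => ∫ t in X.x n..X.x (n + 1), ‖f t‖ ^ 2) : MemLp f 2 X.vol := by
  have hm : AEStronglyMeasurable f X.vol := by
    rw [vol_eq, aestronglyMeasurable_iUnion_iff]
    exact fun n => (h n).1
  rw [memLp_two_iff_integrable_sq_norm hm, vol_eq]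
  refine integrableOn_iUnion_of_summable_integral_norm (fun n => ?_) ?_
  · exact (h n).integrable_norm_pow (by norm_num)
  · refine hs.congr fun n => ?_
    rw [setIntegral_Ioo_eq (X.lt_succ n).le]
    simp

theorem hasSum_norm_sq {f : ℝ → ℂ} (hf : MemLp f 2 X.vol) :
    HasSum (fun n => ∫ t in X.x n..X.x (n + 1), ‖f t‖ ^ 2) (‖hf.toLp f‖ ^ 2) := by
  have h1 : ‖hf.toLp f‖ ^ 2 = ∫ t, ‖f t‖ ^ 2 ∂X.vol := by
    have h2 : (inner ℂ (hf.toLp f) (hf.toLp f) : ℂ) = ((∫ t, ‖f t‖ ^ 2 ∂X.vol : ℝ) : ℂ) := by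
      rw [L2.inner_def, ← integral_complex_ofReal]
      refine integral_congr_ae ?_
      filter_upwards [hf.coeFn_toLp] with t ht
      rw [ht, inner_self_eq_norm_sq_to_K]
      simp
    rw [inner_self_eq_norm_sq_to_K] at h2
    refine Complex.ofReal_injective ?_
    rw [Complex.ofReal_pow]
    exact h2
  rw [h1]
  exact X.hasSum_integral (hf.integrable_norm_pow (by norm_num))

theorem hasSum_inner {f g : ℝ → ℂ} (hf : MemLp f 2 X.vol) (hg : MemLp g 2 X.vol) :
    HasSum (fun n => ∫ t in X.x n..X.x (n + 1), g t * (starRingEnd ℂ) (f t))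
      (inner ℂ (hf.toLp f) (hg.toLp g)) := by
  have hae : (fun t => (inner ℂ (hf.toLp f t) (hg.toLp g t) : ℂ)) =ᵐ[X.vol]
      fun t => g t * (starRingEnd ℂ) (f t) := by
    filter_upwards [hf.coeFn_toLp, hg.coeFn_toLp] with t h1 h2
    rw [h1, h2, RCLike.inner_apply]
  have hint : Integrable (fun t => g t * (starRingEnd ℂ) (f t)) X.vol :=
    (L2.integrable_inner (𝕜 := ℂ) (hf.toLp f) (hg.toLp g)).congr hae
  rw [L2.inner_def, integral_congr_ae hae]
  exact X.hasSum_integral hint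

/-! ### Representatives on the closed intervals -/

variable {X}

/-- Square integrability of `u''` up to the ends of the gap makes the primitives continuous on the
closed interval. -/
theorem IsW22.exists_isSob {u : ℝ → ℂ} (hu : X.IsW22 u) (n : ℕ) :
    ∃ U V, IsSob (X.x n) (X.x (n + 1)) U V (deriv (deriv u)) ∧
      EqOn u U (Ioo (X.x n) (X.x (n + 1))) ∧ EqOn (deriv u) V (Ioo (X.x n) (X.x (n + 1))) := by
  set a := X.x n
  set c := X.x (n + 1)
  have hac : a < c := X.lt_succ n
  have hw : MemLp (deriv (deriv u)) 2 (volume.restrict (Ioo a c)) :=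
    hu.memLp_deriv2.mono_measure (X.restrict_gap_le n)
  have hwi : IntervalIntegrable (deriv (deriv u)) volume a c :=
    MemLp.intervalIntegrable_Ioo hac.le hw
  -- The primitives start at an interior point, because the values of `u` at the points of `X` are
  -- arbitrary.
  obtain ⟨e, hae, hec⟩ := exists_between hac
  have hsub := X.Ioo_subset_gaps n
  have hiw : ∀ p ∈ Icc a c, ∀ q ∈ Icc a c, IntervalIntegrable (deriv (deriv u)) volume p q :=
    fun p hp q hq => hwi.mono_set (by rw [uIcc_of_le hac.le]; exact uIcc_subset_Icc hp hq)
  have he : e ∈ Icc a c := ⟨hae.le, hec.le⟩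
  have ha : a ∈ Icc a c := left_mem_Icc.2 hac.le
  let V : ℝ → ℂ := fun t => deriv u e + ∫ r in e..t, deriv (deriv u) r
  have hV : EqOn (deriv u) V (Ioo a c) := fun t ht => by
    simp only [V, (hu.ac_deriv e t ((uIcc_subset_Ioo' ⟨hae, hec⟩ ht).trans hsub)).complex_ftc.2]
    ring
  have hVeq : ∀ t ∈ Icc a c, V t = V a + ∫ s in a..t, deriv (deriv u) s := fun t ht => by
    simp only [V]
    rw [add_assoc, intervalIntegral.integral_add_adjacent_intervals (hiw e he a ha) (hiw a ha t ht)]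
  have hVc : ContinuousOn V (Icc a c) := by
    have := (absolutelyContinuousOnInterval_of_primitive hwi
      (by rw [uIcc_of_le hac.le]; exact hVeq)).continuousOn
    rwa [uIcc_of_le hac.le] at this
  have hiV : ∀ p ∈ Icc a c, ∀ q ∈ Icc a c, IntervalIntegrable V volume p q :=
    fun p hp q hq => (hVc.mono (uIcc_subset_Icc hp hq)).intervalIntegrable
  let U : ℝ → ℂ := fun t => u e + ∫ r in e..t, V r
  refine ⟨U, V, ⟨hac, hw, hVeq, fun t ht => ?_⟩, fun t ht => ?_, hV⟩
  · simp only [U]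
    rw [add_assoc, intervalIntegral.integral_add_adjacent_intervals (hiV e he a ha) (hiV a ha t ht)]
  · have h1 := (hu.ac e t ((uIcc_subset_Ioo' ⟨hae, hec⟩ ht).trans hsub)).complex_ftc.2
    have h2 : ∫ r in e..t, deriv u r = ∫ r in e..t, V r :=
      intervalIntegral.integral_congr fun r hr => hV (uIcc_subset_Ioo' ⟨hae, hec⟩ ht hr)
    simp only [U]
    rw [← h2, h1]
    ring

variable (X)

/-- The continuous extension of `u` to the closed interval `[xₙ, xₙ₊₁]`. -/
def repU (u : X.W22) (n : ℕ) : ℝ → ℂ := (u.2.exists_isSob n).choose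

/-- The continuous extension of `u'` to the closed interval `[xₙ, xₙ₊₁]`. -/
def repV (u : X.W22) (n : ℕ) : ℝ → ℂ := (u.2.exists_isSob n).choose_spec.choose

theorem isSob_rep (u : X.W22) (n : ℕ) :
    IsSob (X.x n) (X.x (n + 1)) (X.repU u n) (X.repV u n) (deriv (deriv u.1)) :=
  (u.2.exists_isSob n).choose_spec.choose_spec.1

theorem eqOn_repU (u : X.W22) (n : ℕ) : EqOn u.1 (X.repU u n) (Ioo (X.x n) (X.x (n + 1))) :=
  (u.2.exists_isSob n).choose_spec.choose_spec.2.1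

theorem eqOn_repV (u : X.W22) (n : ℕ) : EqOn (deriv u.1) (X.repV u n) (Ioo (X.x n) (X.x (n + 1))) :=
  (u.2.exists_isSob n).choose_spec.choose_spec.2.2

variable {X}

theorem rightLim_eq_of_eqOn {v G : ℝ → ℂ} {p q : ℝ} (hpq : p < q)
    (hG : ContinuousOn G (Icc p q)) (h : EqOn v G (Ioo p q)) : Function.rightLim v p = G p := by
  refine rightLim_eq_of_tendsto ?_
  have h1 : Tendsto G (𝓝[Ioo p q] p) (𝓝 (G p)) :=
    (hG p (left_mem_Icc.2 hpq.le)).mono Ioo_subset_Icc_self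
  rw [nhdsWithin_Ioo_eq_nhdsGT hpq] at h1
  exact h1.congr' (by filter_upwards [Ioo_mem_nhdsGT hpq] with t ht using (h ht).symm)

theorem leftLim_eq_of_eqOn {v G : ℝ → ℂ} {p q : ℝ} (hpq : p < q)
    (hG : ContinuousOn G (Icc p q)) (h : EqOn v G (Ioo p q)) : Function.leftLim v q = G q := by
  refine leftLim_eq_of_tendsto ?_
  have h1 : Tendsto G (𝓝[Ioo p q] q) (𝓝 (G q)) :=
    (hG q (right_mem_Icc.2 hpq.le)).mono Ioo_subset_Icc_self
  rw [nhdsWithin_Ioo_eq_nhdsLT hpq] at h1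
  exact h1.congr' (by filter_upwards [Ioo_mem_nhdsLT hpq] with t ht using (h ht).symm)

variable (X)

theorem valL_eq {u : X.W22} {n : ℕ} {U V w : ℝ → ℂ} (h : IsSob (X.x n) (X.x (n + 1)) U V w)
    (hU : EqOn u.1 U (Ioo (X.x n) (X.x (n + 1)))) : X.valL n u = U (X.x n) :=
  rightLim_eq_of_eqOn h.lt h.continuousOn_U hU

theorem valR_eq {u : X.W22} {n : ℕ} {U V w : ℝ → ℂ} (h : IsSob (X.x n) (X.x (n + 1)) U V w)
    (hU : EqOn u.1 U (Ioo (X.x n) (X.x (n + 1)))) : X.valR n u = U (X.x (n + 1)) :=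
  leftLim_eq_of_eqOn h.lt h.continuousOn_U hU

theorem deriv_eqOn {u : ℝ → ℂ} {n : ℕ} {U V w : ℝ → ℂ} (h : IsSob (X.x n) (X.x (n + 1)) U V w)
    (hU : EqOn u U (Ioo (X.x n) (X.x (n + 1)))) : EqOn (deriv u) V (Ioo (X.x n) (X.x (n + 1))) := by
  intro t ht
  have h1 : u =ᶠ[𝓝 t] U := by
    filter_upwards [Ioo_mem_nhds ht.1 ht.2] with s hs using hU hs
  rw [h1.deriv_eq, (h.hasDerivAt_U ht).deriv]

theorem derivL_eq {u : X.W22} {n : ℕ} {U V w : ℝ → ℂ} (h : IsSob (X.x n) (X.x (n + 1)) U V w)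
    (hU : EqOn u.1 U (Ioo (X.x n) (X.x (n + 1)))) : X.derivL n u = V (X.x n) :=
  rightLim_eq_of_eqOn h.lt h.continuousOn_V (X.deriv_eqOn h hU)

theorem derivR_eq {u : X.W22} {n : ℕ} {U V w : ℝ → ℂ} (h : IsSob (X.x n) (X.x (n + 1)) U V w)
    (hU : EqOn u.1 U (Ioo (X.x n) (X.x (n + 1)))) : X.derivR n u = V (X.x (n + 1)) :=
  leftLim_eq_of_eqOn h.lt h.continuousOn_V (X.deriv_eqOn h hU)

/-! ### Gluing -/

open Classical in
/-- The function that equals `U n` on `(xₙ, xₙ₊₁)`. -/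
def glue (U : ℕ → ℝ → ℂ) (t : ℝ) : ℂ :=
  if h : ∃ n, t ∈ Ioo (X.x n) (X.x (n + 1)) then U h.choose t else 0

theorem glue_eqOn (U : ℕ → ℝ → ℂ) (n : ℕ) : EqOn (X.glue U) (U n) (Ioo (X.x n) (X.x (n + 1))) := by
  intro t ht
  have h : ∃ n, t ∈ Ioo (X.x n) (X.x (n + 1)) := ⟨n, ht⟩
  rw [glue, dif_pos h, X.eq_of_mem_gap h.choose_spec ht]

theorem exists_uIcc_subset_gap {p q : ℝ} (h : uIcc p q ⊆ X.gaps) :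
    ∃ n, uIcc p q ⊆ Ioo (X.x n) (X.x (n + 1)) := by
  have hp : min p q ∈ uIcc p q := by
    rcases le_total p q with hpq | hpq <;> simp [hpq]
  have hp' := h hp
  rw [gaps_eq, mem_iUnion] at hp'
  obtain ⟨n, hn⟩ := hp'
  refine ⟨n, fun t ht => ⟨hn.1.trans_le ht.1, ?_⟩⟩
  by_contra hle
  have h1 : X.x (n + 1) ∈ uIcc p q := ⟨hn.2.le, (not_lt.1 hle).trans ht.2⟩
  exact (h h1).2 ⟨n + 1, rfl⟩

theorem isW22_glue {U V w : ℕ → ℝ → ℂ}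
    (h : ∀ n, IsSob (X.x n) (X.x (n + 1)) (U n) (V n) (w n))
    (hU : Summable fun n => ∫ t in X.x n..X.x (n + 1), ‖U n t‖ ^ 2)
    (hw : Summable fun n => ∫ t in X.x n..X.x (n + 1), ‖w n t‖ ^ 2) :
    X.IsW22 (X.glue U) ∧ ∀ n, ∀ᵐ t, t ∈ Ioo (X.x n) (X.x (n + 1)) →
      deriv (deriv (X.glue U)) t = w n t := by
  have hd : ∀ n, EqOn (deriv (X.glue U)) (V n) (Ioo (X.x n) (X.x (n + 1))) := fun n =>
    X.deriv_eqOn (h n) (X.glue_eqOn U n)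
  have hdd : ∀ n, ∀ᵐ t, t ∈ Ioo (X.x n) (X.x (n + 1)) → deriv (deriv (X.glue U)) t = w n t := by
    intro n
    filter_upwards [(h n).ae_hasDerivAt_V] with t ht hm
    have h1 : deriv (X.glue U) =ᶠ[𝓝 t] V n := by
      filter_upwards [Ioo_mem_nhds hm.1 hm.2] with s hs using hd n hs
    rw [h1.deriv_eq, (ht hm).deriv]
  refine ⟨⟨X.memLp_vol (fun n => ?_) (hU.congr fun n => ?_), fun p q hpq => ?_, fun p q hpq => ?_,
    X.memLp_vol (fun n => ?_) (hw.congr fun n => ?_)⟩, hdd⟩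
  · refine (memLp_two_of_continuousOn (h n).continuousOn_U).ae_eq ?_
    filter_upwards [ae_restrict_mem measurableSet_Ioo] with t ht using (X.glue_eqOn U n ht).symm
  · rw [← setIntegral_Ioo_eq (X.lt_succ n).le, ← setIntegral_Ioo_eq (X.lt_succ n).le]
    exact setIntegral_congr_fun measurableSet_Ioo fun t ht => by
      simp only [X.glue_eqOn U n ht]
  · obtain ⟨n, hn⟩ := X.exists_uIcc_subset_gap hpq
    refine ((h n).ac_U.mono ?_).congr_on fun t ht => (X.glue_eqOn U n (hn ht)).symm
    rw [uIcc_of_le (X.lt_succ n).le]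
    exact hn.trans Ioo_subset_Icc_self
  · obtain ⟨n, hn⟩ := X.exists_uIcc_subset_gap hpq
    refine ((h n).ac_V.mono ?_).congr_on fun t ht => (hd n (hn ht)).symm
    rw [uIcc_of_le (X.lt_succ n).le]
    exact hn.trans Ioo_subset_Icc_self
  · refine (h n).memLp.ae_eq ?_
    filter_upwards [(ae_restrict_iff' measurableSet_Ioo).2 (hdd n)] with t ht using ht.symm
  · rw [← setIntegral_Ioo_eq (X.lt_succ n).le, ← setIntegral_Ioo_eq (X.lt_succ n).le]
    refine setIntegral_congr_ae measurableSet_Ioo ?_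
    filter_upwards [hdd n] with t ht hm
    rw [ht hm]

end PointSeq

/-! ### Weak second derivatives on one interval -/

namespace IsSob

variable {a c : ℝ} {U V w : ℝ → ℂ}

theorem of_memLp (hac : a < c) (hw : MemLp w 2 (volume.restrict (Ioo a c))) :
    IsSob a c (fun t => ∫ s in a..t, ∫ r in a..s, w r) (fun t => ∫ r in a..t, w r) w :=
  ⟨hac, hw, fun t _ => by simp, fun t _ => by simp⟩

theorem zero (hac : a < c) : IsSob a c (fun _ => 0) (fun _ => 0) (fun _ => 0) :=
  ⟨hac, MemLp.zero', fun t _ => by simp, fun t _ => by simp⟩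

theorem affine (hac : a < c) (α β : ℂ) :
    IsSob a c (fun t => α + ((t - a : ℝ) : ℂ) * β) (fun _ => β) (fun _ => 0) := by
  refine ⟨hac, MemLp.zero', fun t _ => by simp, fun t _ => ?_⟩
  rw [intervalIntegral.integral_const, Complex.real_smul]
  simp

theorem add (h : IsSob a c U V w) {U₂ V₂ w₂ : ℝ → ℂ} (h₂ : IsSob a c U₂ V₂ w₂) :
    IsSob a c (fun t => U t + U₂ t) (fun t => V t + V₂ t) (fun t => w t + w₂ t) := by
  have hs : ∀ t ∈ Icc a c, uIcc a t ⊆ uIcc a c := fun t ht =>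
    uIcc_subset_uIcc_left (by rwa [uIcc_of_le h.lt.le])
  refine ⟨h.lt, h.memLp.add h₂.memLp, fun t ht => ?_, fun t ht => ?_⟩
  · rw [intervalIntegral.integral_add (h.intervalIntegrable.mono_set (hs t ht))
      (h₂.intervalIntegrable.mono_set (hs t ht))]
    linear_combination h.V_eq t ht + h₂.V_eq t ht
  · rw [intervalIntegral.integral_add (h.intervalIntegrable_V.mono_set (hs t ht))
      (h₂.intervalIntegrable_V.mono_set (hs t ht))]
    linear_combination h.U_eq t ht + h₂.U_eq t ht

end IsSob

theorem conj_integral_mul_conj (a c : ℝ) (p q : ℝ → ℂ) :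
    (starRingEnd ℂ) (∫ t in a..c, p t * (starRingEnd ℂ) (q t)) =
      ∫ t in a..c, q t * (starRingEnd ℂ) (p t) := by
  simp only [intervalIntegral, map_sub, ← integral_conj, map_mul, Complex.conj_conj, mul_comm]

/-- A function in `L²(a, c)` that is orthogonal, up to a double primitive, to the second derivatives
of all functions with vanishing boundary values, has a weak second derivative. -/
theorem exists_isSob_of_weak {a c : ℝ} (hac : a < c) {f g : ℝ → ℂ}
    (hf : MemLp f 2 (volume.restrict (Ioo a c))) (hg : MemLp g 2 (volume.restrict (Ioo a c)))
    (h : ∀ v V k, IsSob a c v V k → v a = 0 → v c = 0 → V a = 0 → V c = 0 →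
      ∫ t in a..c, f t * (starRingEnd ℂ) (k t) = ∫ t in a..c, g t * (starRingEnd ℂ) (v t)) :
    ∃ U V, IsSob a c U V g ∧ ∀ᵐ t, t ∈ Ioo a c → f t = U t := by
  have hd : 0 < c - a := sub_pos.2 hac
  have hd0 : ((c - a : ℝ) : ℂ) ≠ 0 := by exact_mod_cast hd.ne'
  have h₀ := IsSob.of_memLp hac hg
  set U₀ : ℝ → ℂ := fun t => ∫ s in a..t, ∫ r in a..s, g r with hU₀
  set V₀ : ℝ → ℂ := fun t => ∫ r in a..t, g r with hV₀
  have hk₀ : MemLp (fun t => f t - U₀ t) 2 (volume.restrict (Ioo a c)) :=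
    hf.sub (memLp_two_of_continuousOn h₀.continuousOn_U)
  have hk₀i := MemLp.intervalIntegrable_Ioo hac.le hk₀
  have hlin : Continuous fun t : ℝ => ((t - a : ℝ) : ℂ) := by fun_prop
  set A₀ := ∫ t in a..c, (f t - U₀ t) with hA₀
  set A₁ := ∫ t in a..c, (f t - U₀ t) * ((t - a : ℝ) : ℂ) with hA₁
  set D : ℂ := ((c - a : ℝ) : ℂ) with hD
  -- `α` and `β` solve the two linear equations which make `k = f - U₀ - ℓ` orthogonal to `1` and to
  -- `t - a`: from `A₀ = α D + β D²/2` and `A₁ = α D²/2 + β D³/3` one gets `A₁ - (D/2) A₀ = β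
  -- D³/12`.
  set β : ℂ := 12 / D ^ 3 * (A₁ - D / 2 * A₀) with hβ
  set α : ℂ := A₀ / D - β * D / 2 with hα
  have hℓ := IsSob.affine hac α β
  set ℓ : ℝ → ℂ := fun t => α + ((t - a : ℝ) : ℂ) * β with hℓd
  have hℓc : Continuous ℓ := by
    rw [hℓd]
    fun_prop
  set k : ℝ → ℂ := fun t => f t - U₀ t - ℓ t with hk
  have hkm : MemLp k 2 (volume.restrict (Ioo a c)) :=
    hk₀.sub (memLp_two_of_continuousOn hℓ.continuousOn_U)
  have hki := MemLp.intervalIntegrable_Ioo hac.le hkm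
  have m1 : ∫ t in a..c, ((t - a : ℝ) : ℂ) = D ^ 2 / 2 := by
    rw [intervalIntegral.integral_ofReal, intervalIntegral.integral_comp_sub_right (fun t => t),
      integral_id, hD]
    push_cast
    ring
  have m2 : ∫ t in a..c, ((t - a : ℝ) : ℂ) * ((t - a : ℝ) : ℂ) = D ^ 3 / 3 := by
    have : ∀ t : ℝ, ((t - a : ℝ) : ℂ) * ((t - a : ℝ) : ℂ) = (((t - a) ^ 2 : ℝ) : ℂ) := fun t => by
      push_cast
      ring
    simp only [this]
    rw [intervalIntegral.integral_ofReal, intervalIntegral.integral_comp_sub_right (fun t => t ^ 2),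
      integral_pow, hD]
    push_cast
    ring
  have hk0 : ∫ t in a..c, k t = 0 := by
    rw [hk, intervalIntegral.integral_sub hk₀i (hℓc.intervalIntegrable _ _)]
    simp only [hℓd]
    rw [intervalIntegral.integral_add intervalIntegrable_const
        (by apply Continuous.intervalIntegrable; fun_prop),
      intervalIntegral.integral_mul_const, m1, intervalIntegral.integral_const, Complex.real_smul,
      ← hD, ← hA₀, hα]
    field_simp
    ring
  have hk1 : ∫ t in a..c, k t * ((t - a : ℝ) : ℂ) = 0 := by
    have e1 : ∀ t, k t * ((t - a : ℝ) : ℂ) = (f t - U₀ t) * ((t - a : ℝ) : ℂ) -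
        (((t - a : ℝ) : ℂ) * α + ((t - a : ℝ) : ℂ) * ((t - a : ℝ) : ℂ) * β) := fun t => by
      rw [hk, hℓd]
      ring
    simp only [e1]
    rw [intervalIntegral.integral_sub (hk₀i.mul_continuousOn hlin.continuousOn)
      (by apply Continuous.intervalIntegrable; fun_prop),
      intervalIntegral.integral_add (by apply Continuous.intervalIntegrable; fun_prop)
      (by apply Continuous.intervalIntegrable; fun_prop), intervalIntegral.integral_mul_const,
      intervalIntegral.integral_mul_const, m1, m2, ← hA₁, hα, hβ]
    field_simp
    ring
  -- The double primitive of `k` is an admissible test function: the two orthogonality relations say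
  -- exactly that it and its derivative vanish at `c`.
  have hv := IsSob.of_memLp hac hkm
  set V : ℝ → ℂ := fun t => ∫ r in a..t, k r with hV
  set v : ℝ → ℂ := fun t => ∫ s in a..t, V s with hvd
  have hVa : V a = 0 := by simp [hV]
  have hVc : V c = 0 := hk0
  have hva : v a = 0 := by simp [hvd]
  have hvc : v c = 0 := by
    have h1 := hv.integral_mul_conj (IsSob.affine hac 0 1)
    simp only [zero_add, mul_one, Complex.conj_ofReal, map_one] at h1
    rw [hk1, hVc, hVa] at h1
    simp only [zero_mul, sub_zero, zero_sub] at h1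
    exact neg_eq_zero.1 h1.symm
  have hweak := h v V k hv hva hvc hVa hVc
  have hparts : ∫ t in a..c, g t * (starRingEnd ℂ) (v t) =
      ∫ t in a..c, U₀ t * (starRingEnd ℂ) (k t) := by
    have h1 := h₀.integral_mul_conj hv
    have h2 := hv.integral_mul_conj h₀
    rw [hva, hvc] at h1
    rw [hVa, hVc] at h2
    rw [h1, ← conj_integral_mul_conj _ _ k, h2]
    simp only [map_zero, mul_zero, sub_zero, zero_mul, zero_sub, map_neg, conj_integral_mul_conj]
  have hkcI : IntervalIntegrable (fun t => (starRingEnd ℂ) (k t)) volume a c :=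
    MemLp.intervalIntegrable_Ioo hac.le hkm.star
  have hℓk : ∫ t in a..c, ℓ t * (starRingEnd ℂ) (k t) = 0 := by
    rw [← conj_integral_mul_conj]
    have e1 : ∀ t, k t * (starRingEnd ℂ) (ℓ t) = k t * (starRingEnd ℂ) α +
        k t * ((t - a : ℝ) : ℂ) * (starRingEnd ℂ) β := fun t => by
      rw [hℓd]
      simp only [map_add, map_mul, Complex.conj_ofReal]
      ring
    simp only [e1]
    rw [intervalIntegral.integral_add (hki.mul_const _)
      ((hki.mul_continuousOn hlin.continuousOn).mul_const _), intervalIntegral.integral_mul_const,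
      intervalIntegral.integral_mul_const, hk0, hk1]
    simp
  have hint : ∀ p : ℝ → ℂ, MemLp p 2 (volume.restrict (Ioo a c)) →
      IntervalIntegrable (fun t => p t * (starRingEnd ℂ) (k t)) volume a c := fun p hp =>
    (intervalIntegrable_iff_integrableOn_Ioo_of_le hac.le).2 (hp.integrable_mul hkm.star)
  -- The weak equation gives `(f, k) = (g, v)`, two integrations by parts give `(g, v) = (U₀, k)`,
  -- and `(ℓ, k) = 0`; hence `k` is orthogonal to itself and `f = U₀ + ℓ` almost everywhere.
  have hkk : ∫ t in a..c, k t * (starRingEnd ℂ) (k t) = 0 := by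
    have e1 : ∀ t, k t * (starRingEnd ℂ) (k t) = f t * (starRingEnd ℂ) (k t) -
        U₀ t * (starRingEnd ℂ) (k t) - ℓ t * (starRingEnd ℂ) (k t) := fun t => by
      simp only [hk]
      ring
    rw [intervalIntegral.integral_congr fun t _ => e1 t]
    rw [intervalIntegral.integral_sub ((hint f hf).sub
      (hint U₀ (memLp_two_of_continuousOn h₀.continuousOn_U)))
      (hint ℓ (memLp_two_of_continuousOn hℓ.continuousOn_U)),
      intervalIntegral.integral_sub (hint f hf)
      (hint U₀ (memLp_two_of_continuousOn h₀.continuousOn_U)), hℓk, hweak, hparts]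
    simp
  have hkz : ∫ t in Ioo a c, ‖k t‖ ^ 2 = 0 := by
    have e1 : ∀ t, k t * (starRingEnd ℂ) (k t) = ((‖k t‖ ^ 2 : ℝ) : ℂ) := fun t => by
      rw [Complex.mul_conj, Complex.normSq_eq_norm_sq]
    simp only [e1] at hkk
    rw [intervalIntegral.integral_ofReal] at hkk
    rw [setIntegral_Ioo_eq hac.le]
    exact_mod_cast hkk
  rw [integral_eq_zero_iff_of_nonneg (fun _ => sq_nonneg _)
    (hkm.integrable_norm_pow (by norm_num))] at hkz
  refine ⟨_, _, by simpa using h₀.add hℓ, ?_⟩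
  filter_upwards [(ae_restrict_iff' measurableSet_Ioo).1 hkz] with t ht hm
  have h1 : ‖k t‖ ^ 2 = 0 := ht hm
  have h2 : k t = 0 := by simpa using h1
  rw [hk] at h2
  simp only at h2
  linear_combination h2

/-! ### The boundary form and the adjoint of the minimal operator -/

namespace PointSeq

variable (X : PointSeq)

/-- The element of `W^{2,2}(I \ X)` with the given pieces. -/
def glueW {U V w : ℕ → ℝ → ℂ} (h : ∀ n, IsSob (X.x n) (X.x (n + 1)) (U n) (V n) (w n))
    (hU : Summable fun n => ∫ t in X.x n..X.x (n + 1), ‖U n t‖ ^ 2)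
    (hw : Summable fun n => ∫ t in X.x n..X.x (n + 1), ‖w n t‖ ^ 2) : X.W22 :=
  ⟨X.glue U, (X.isW22_glue h hU hw).1⟩

/-- The map `u ↦ {u, -u''}`, a parametrization of the maximal operator. -/
def graphMap : X.W22 →ₗ[ℂ] X.L2 × X.L2 := X.toL2.prod X.negD2

theorem mem_W22zero {u : X.W22} : u ∈ X.W22zero ↔
    ∀ n, X.valL n u = 0 ∧ X.valR n u = 0 ∧ X.derivL n u = 0 ∧ X.derivR n u = 0 := by
  simp only [W22zero, Submodule.mem_iInf, Submodule.mem_inf, LinearMap.mem_ker, and_assoc]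

/-- The boundary form on the `n`-th interval. -/
def gapForm (n : ℕ) (u v : X.W22) : ℂ :=
  (X.derivR n v * (starRingEnd ℂ) (X.valR n u) - X.derivL n v * (starRingEnd ℂ) (X.valL n u)) -
  (X.valR n v * (starRingEnd ℂ) (X.derivR n u) - X.valL n v * (starRingEnd ℂ) (X.derivL n u))

theorem valL_rep (u : X.W22) (n : ℕ) : X.valL n u = X.repU u n (X.x n) :=
  X.valL_eq (X.isSob_rep u n) (X.eqOn_repU u n)

theorem valR_rep (u : X.W22) (n : ℕ) : X.valR n u = X.repU u n (X.x (n + 1)) :=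
  X.valR_eq (X.isSob_rep u n) (X.eqOn_repU u n)

theorem derivL_rep (u : X.W22) (n : ℕ) : X.derivL n u = X.repV u n (X.x n) :=
  X.derivL_eq (X.isSob_rep u n) (X.eqOn_repU u n)

theorem derivR_rep (u : X.W22) (n : ℕ) : X.derivR n u = X.repV u n (X.x (n + 1)) :=
  X.derivR_eq (X.isSob_rep u n) (X.eqOn_repU u n)

theorem integral_gap_congr {G : Type*} [NormedAddCommGroup G] [NormedSpace ℝ G] {f g : ℝ → G}
    {n : ℕ} (h : ∀ t ∈ Ioo (X.x n) (X.x (n + 1)), f t = g t) :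
    ∫ t in X.x n..X.x (n + 1), f t = ∫ t in X.x n..X.x (n + 1), g t := by
  rw [← setIntegral_Ioo_eq (X.lt_succ n).le, ← setIntegral_Ioo_eq (X.lt_succ n).le]
  exact setIntegral_congr_fun measurableSet_Ioo h

theorem integral_deriv2_mul (n : ℕ) (u v : X.W22) :
    ∫ t in X.x n..X.x (n + 1), deriv (deriv v.1) t * (starRingEnd ℂ) (u.1 t) =
      X.derivR n v * (starRingEnd ℂ) (X.valR n u) - X.derivL n v * (starRingEnd ℂ) (X.valL n u) -
        ∫ t in X.x n..X.x (n + 1), X.repV v n t * (starRingEnd ℂ) (X.repV u n t) := by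
  have h := (X.isSob_rep v n).integral_mul_conj (X.isSob_rep u n)
  rw [valR_rep, valL_rep, derivL_rep, derivR_rep, ← h]
  exact X.integral_gap_congr fun t ht => by rw [X.eqOn_repU u n ht]

theorem integral_mul_deriv2 (n : ℕ) (u v : X.W22) :
    ∫ t in X.x n..X.x (n + 1), v.1 t * (starRingEnd ℂ) (deriv (deriv u.1) t) =
      X.valR n v * (starRingEnd ℂ) (X.derivR n u) - X.valL n v * (starRingEnd ℂ) (X.derivL n u) -
        ∫ t in X.x n..X.x (n + 1), X.repV v n t * (starRingEnd ℂ) (X.repV u n t) := by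
  rw [← conj_integral_mul_conj, integral_deriv2_mul, map_sub, conj_integral_mul_conj]
  simp only [map_sub, map_mul, Complex.conj_conj]
  ring

theorem hasSum_inner_negD2_right (u v : X.W22) :
    HasSum (fun n => -∫ t in X.x n..X.x (n + 1), deriv (deriv v.1) t * (starRingEnd ℂ) (u.1 t))
      (inner ℂ (X.toL2 u) (X.negD2 v)) := by
  have h := (X.hasSum_inner u.2.memLp v.2.memLp_deriv2).neg
  rw [← inner_neg_right] at h
  exact h

theorem hasSum_inner_negD2_left (u v : X.W22) :
    HasSum (fun n => -∫ t in X.x n..X.x (n + 1), v.1 t * (starRingEnd ℂ) (deriv (deriv u.1) t))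
      (inner ℂ (X.negD2 u) (X.toL2 v)) := by
  have h := (X.hasSum_inner u.2.memLp_deriv2 v.2.memLp).neg
  rw [← inner_neg_left] at h
  exact h

theorem hasSum_gapForm (u v : X.W22) :
    HasSum (fun n => X.gapForm n u v) (LinRel.sform (X.graphMap u) (X.graphMap v)) := by
  refine ((X.hasSum_inner_negD2_left u v).sub (X.hasSum_inner_negD2_right u v)).congr_fun
    fun n => ?_
  rw [integral_deriv2_mul, integral_mul_deriv2, gapForm]
  ring

theorem graphMap_mem_adjoint (u : X.W22) : X.graphMap u ∈ X.Hmin.adjoint := by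
  rw [LinRel.mem_adjoint_iff_sform]
  rintro _ ⟨v, hv, rfl⟩
  refine (X.hasSum_gapForm v u).unique ?_
  have h := X.mem_W22zero.1 hv
  have h0 : (fun n => X.gapForm n v u) = fun _ => 0 := by
    funext n
    simp [gapForm, h n]
  rw [h0]
  exact hasSum_zero

/-- The defining relation of the adjoint, tested with functions living on a single gap, is the weak
form of `f'' = -g` there. The local solutions are glued, and summability comes from `f` and `g`
being in `L²` already. -/
theorem adjoint_Hmin : X.Hmin.adjoint = LinearMap.range X.graphMap := by
  refine le_antisymm ?_ ?_
  · intro y hy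
    rw [LinRel.mem_adjoint_iff_sform] at hy
    obtain ⟨f, g⟩ := y
    have hf : MemLp f 2 X.vol := Lp.memLp f
    have hg : MemLp (fun t => -g t) 2 X.vol := (Lp.memLp g).neg
    have key : ∀ n, ∃ U V, IsSob (X.x n) (X.x (n + 1)) U V (fun t => -g t) ∧
        ∀ᵐ t, t ∈ Ioo (X.x n) (X.x (n + 1)) → f t = U t := by
      intro n
      refine exists_isSob_of_weak (X.lt_succ n) (hf.mono_measure (X.restrict_gap_le n))
        (hg.mono_measure (X.restrict_gap_le n)) fun v V k hv h1 h2 h3 h4 => ?_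
      classical
      -- The local test function on the `n`-th gap is continued by zero; all its boundary values
      -- vanish, so it belongs to the domain of the minimal operator.
      let Uv : ℕ → ℝ → ℂ := fun m => if m = n then v else fun _ => 0
      let Vv : ℕ → ℝ → ℂ := fun m => if m = n then V else fun _ => 0
      let wv : ℕ → ℝ → ℂ := fun m => if m = n then k else fun _ => 0
      have hs : ∀ m, IsSob (X.x m) (X.x (m + 1)) (Uv m) (Vv m) (wv m) := fun m => by
        by_cases hm : m = n
        · subst hm
          simpa [Uv, Vv, wv] using hv
        · simpa [Uv, Vv, wv, hm] using IsSob.zero (X.lt_succ m)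
      have hsU : Summable fun m => ∫ t in X.x m..X.x (m + 1), ‖Uv m t‖ ^ 2 :=
        summable_of_ne_finset_zero (s := {n}) fun m hm => by
          simp [Uv, Finset.notMem_singleton.1 hm]
      have hsw : Summable fun m => ∫ t in X.x m..X.x (m + 1), ‖wv m t‖ ^ 2 :=
        summable_of_ne_finset_zero (s := {n}) fun m hm => by
          simp [wv, Finset.notMem_singleton.1 hm]
      have hae := (X.isW22_glue hs hsU hsw).2
      set ψ : X.W22 := X.glueW hs hsU hsw with hψ
      have hψe : ∀ m, EqOn ψ.1 (Uv m) (Ioo (X.x m) (X.x (m + 1))) := fun m => X.glue_eqOn Uv m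
      have hψ0 : ψ ∈ X.W22zero := by
        rw [mem_W22zero]
        intro m
        rw [X.valL_eq (hs m) (hψe m), X.valR_eq (hs m) (hψe m), X.derivL_eq (hs m) (hψe m),
          X.derivR_eq (hs m) (hψe m)]
        by_cases hm : m = n
        · subst hm
          simp [Uv, Vv, h1, h2, h3, h4]
        · simp [Uv, Vv, hm]
      have hz := hy _ ⟨ψ, hψ0, rfl⟩
      have e1 := (X.hasSum_inner ψ.2.memLp_deriv2 hf).neg
      have e2 := X.hasSum_inner ψ.2.memLp hg
      have hgc : (hg.toLp (fun t => -g t) : X.L2) = -g := by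
        have h5 : hg.toLp (fun t => -g t) = -((Lp.memLp g).toLp g) := MemLp.toLp_neg _
        rw [h5, Lp.toLp_coeFn]
      rw [Lp.toLp_coeFn, ← inner_neg_left] at e1
      rw [hgc, inner_neg_right] at e2
      have e3 := (e1.add e2)
      have hz' : inner ℂ (X.negD2 ψ) f + -inner ℂ (X.toL2 ψ) g = 0 := hz
      have e4 : HasSum (fun m => -(∫ t in X.x m..X.x (m + 1),
          f t * (starRingEnd ℂ) (deriv (deriv ψ.1) t)) + ∫ t in X.x m..X.x (m + 1),
          -g t * (starRingEnd ℂ) (ψ.1 t)) 0 := by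
        rw [← hz']
        exact e3
      have hcongr : ∀ m, ∫ t in X.x m..X.x (m + 1), f t * (starRingEnd ℂ) (deriv (deriv ψ.1) t) =
          ∫ t in X.x m..X.x (m + 1), f t * (starRingEnd ℂ) (wv m t) := fun m => by
        rw [← setIntegral_Ioo_eq (X.lt_succ m).le, ← setIntegral_Ioo_eq (X.lt_succ m).le]
        refine setIntegral_congr_ae measurableSet_Ioo ?_
        filter_upwards [hae m] with t ht hm
        have : deriv (deriv ψ.1) t = wv m t := ht hm
        rw [this]
      have hcongr2 : ∀ m, ∫ t in X.x m..X.x (m + 1), -g t * (starRingEnd ℂ) (ψ.1 t) =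
          ∫ t in X.x m..X.x (m + 1), -g t * (starRingEnd ℂ) (Uv m t) := fun m =>
        X.integral_gap_congr fun t ht => by rw [hψe m ht]
      simp only [hcongr, hcongr2] at e4
      -- Only the `n`-th gap contributes to the global identity.
      have e5 := hasSum_single (f := fun m => -(∫ t in X.x m..X.x (m + 1),
          f t * (starRingEnd ℂ) (wv m t)) + ∫ t in X.x m..X.x (m + 1),
          -g t * (starRingEnd ℂ) (Uv m t)) n fun m hm => by simp [Uv, wv, hm]
      have e6 := e4.unique e5
      simp only [Uv, wv, if_true] at e6
      linear_combination e6
    choose U V hUV hae using key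
    have hU : Summable fun n => ∫ t in X.x n..X.x (n + 1), ‖U n t‖ ^ 2 := by
      refine (X.hasSum_norm_sq hf).summable.congr fun n => ?_
      rw [← setIntegral_Ioo_eq (X.lt_succ n).le, ← setIntegral_Ioo_eq (X.lt_succ n).le]
      refine setIntegral_congr_ae measurableSet_Ioo ?_
      filter_upwards [hae n] with t ht hm
      rw [ht hm]
    have hw := (X.hasSum_norm_sq hg).summable
    refine ⟨X.glueW hUV hU hw, Prod.ext ?_ ?_⟩
    · change (X.glueW hUV hU hw).2.memLp.toLp _ = f
      rw [← Lp.toLp_coeFn f hf, MemLp.toLp_eq_toLp_iff]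
      refine X.ae_vol_of_forall fun n => ?_
      filter_upwards [hae n] with t ht hm
      rw [ht hm]
      exact X.glue_eqOn U n hm
    · have h1 : (X.glueW hUV hU hw).2.memLp_deriv2.toLp _ = hg.toLp (fun t => -g t) := by
        refine (MemLp.toLp_eq_toLp_iff _ _).2 ?_
        exact X.ae_vol_of_forall fun n => (X.isW22_glue hUV hU hw).2 n
      have h5 : hg.toLp (fun t => -g t) = -((Lp.memLp g).toLp g) := MemLp.toLp_neg _
      change -((X.glueW hUV hU hw).2.memLp_deriv2.toLp _) = g
      rw [h1, h5, Lp.toLp_coeFn, neg_neg]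
  · rintro _ ⟨u, rfl⟩
    exact X.graphMap_mem_adjoint u

end PointSeq

/-! ### The boundary space -/

namespace BoundarySpace

theorem hasSum_norm_sq (ω : BoundarySpace) : HasSum (fun n => ‖ω n‖ ^ 2) (‖ω‖ ^ 2) := by
  have h := lp.hasSum_norm (p := 2) (by norm_num) ω
  simpa using h

/-- The element of the boundary space with the given components. -/
def mk (f : ℕ → EuclideanSpace ℂ (Fin 2)) (hf : Summable fun n => ‖f n‖ ^ 2) : BoundarySpace :=
  ⟨f, memℓp_gen (by simpa using hf)⟩

theorem norm_sq_eq (v : EuclideanSpace ℂ (Fin 2)) : ‖v‖ ^ 2 = ‖v 0‖ ^ 2 + ‖v 1‖ ^ 2 := by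
  rw [EuclideanSpace.norm_sq_eq, Fin.sum_univ_two]

theorem inner_eq (v w : EuclideanSpace ℂ (Fin 2)) :
    (inner ℂ v w : ℂ) = w 0 * (starRingEnd ℂ) (v 0) + w 1 * (starRingEnd ℂ) (v 1) := by
  rw [PiLp.inner_apply, Fin.sum_univ_two, RCLike.inner_apply, RCLike.inner_apply]

end BoundarySpace

/-! ### The boundary map: Green's identity and bounds -/

namespace PointSeq

variable (X : PointSeq)

/-- The square root of the length of the `n`-th interval. -/
def r (n : ℕ) : ℝ := X.d n ^ (1 / 2 : ℝ)

theorem r_pos (n : ℕ) : 0 < X.r n := Real.rpow_pos_of_pos (X.d_pos n) _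

theorem r_sq (n : ℕ) : X.r n ^ 2 = X.d n := by
  rw [r, ← Real.rpow_natCast, ← Real.rpow_mul (X.d_pos n).le]
  norm_num

theorem rpow_three_half (n : ℕ) : X.d n ^ (3 / 2 : ℝ) = X.r n ^ 3 := by
  rw [r, ← Real.rpow_natCast, ← Real.rpow_mul (X.d_pos n).le]
  norm_num

theorem Gamma0_zero (n : ℕ) (u : X.W22) : X.Gamma0 n u 0 = (X.r n : ℂ) * X.valL n u := rfl

theorem Gamma0_one (n : ℕ) (u : X.W22) : X.Gamma0 n u 1 = -(X.r n : ℂ) * X.valR n u := rfl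

theorem Gamma1_zero (n : ℕ) (u : X.W22) : X.Gamma1 n u 0 =
    ((X.d n : ℂ) * X.derivL n u + (X.valL n u - X.valR n u)) / (X.r n : ℂ) ^ 3 := by
  rw [← Complex.ofReal_pow, ← rpow_three_half]
  rfl

theorem Gamma1_one (n : ℕ) (u : X.W22) : X.Gamma1 n u 1 =
    ((X.d n : ℂ) * X.derivR n u + (X.valL n u - X.valR n u)) / (X.r n : ℂ) ^ 3 := by
  rw [← Complex.ofReal_pow, ← rpow_three_half]
  rfl

theorem d_eq (n : ℕ) : (X.d n : ℂ) = (X.r n : ℂ) ^ 2 := by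
  rw [← Complex.ofReal_pow, r_sq]

theorem r_ne_zero (n : ℕ) : (X.r n : ℂ) ≠ 0 := by exact_mod_cast (X.r_pos n).ne'

/-- Apart from the usual boundary terms there appears `|u(xₙ+) - u(xₙ₊₁-)|² / dₙ` (for `u = v`), the
energy of the linear interpolant. It turns the energy in the form of the operator into the excess.
-/
theorem inner_Gamma0_Gamma1 (n : ℕ) (u v : X.W22) :
    (inner ℂ (X.Gamma0 n u) (X.Gamma1 n v) : ℂ) =
      X.derivL n v * (starRingEnd ℂ) (X.valL n u) - X.derivR n v * (starRingEnd ℂ) (X.valR n u) +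
      (X.valL n v - X.valR n v) * (starRingEnd ℂ) (X.valL n u - X.valR n u) / X.d n := by
  have hr := X.r_ne_zero n
  rw [BoundarySpace.inner_eq, Gamma0_zero, Gamma0_one, Gamma1_zero, Gamma1_one, d_eq]
  simp only [map_mul, map_neg, Complex.conj_ofReal, map_sub]
  field_simp
  ring

/-- The extra term of `Γ₁` is Hermitian in `u` and `v`, so it drops out of the difference. -/
theorem inner_Gamma_sub (n : ℕ) (u v : X.W22) :
    (inner ℂ (X.Gamma1 n u) (X.Gamma0 n v) : ℂ) - inner ℂ (X.Gamma0 n u) (X.Gamma1 n v) =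
      X.gapForm n u v := by
  rw [← inner_conj_symm, inner_Gamma0_Gamma1, inner_Gamma0_Gamma1, gapForm]
  simp only [map_add, map_sub, map_mul, map_div₀, Complex.conj_conj, Complex.conj_ofReal]
  ring

/-- The integral of `|u|²` over the `n`-th interval. -/
theorem integral_repU (n : ℕ) (u : X.W22) :
    ∫ t in X.x n..X.x (n + 1), ‖X.repU u n t‖ ^ 2 = ∫ t in X.x n..X.x (n + 1), ‖u.1 t‖ ^ 2 :=
  X.integral_gap_congr fun t ht => by rw [X.eqOn_repU u n ht]

/-- The excess of energy of `u` on the `n`-th interval. -/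
def gapExcess (n : ℕ) (u : X.W22) : ℝ :=
  IsSob.excess (X.x n) (X.x (n + 1)) (X.repU u n) (X.repV u n)

theorem gapExcess_nonneg (n : ℕ) (u : X.W22) : 0 ≤ X.gapExcess n u :=
  (X.isSob_rep u n).excess_nonneg

theorem gapExcess_le (n : ℕ) (u : X.W22) : X.gapExcess n u ≤
    X.d n ^ 2 * ∫ t in X.x n..X.x (n + 1), ‖deriv (deriv u.1) t‖ ^ 2 :=
  (X.isSob_rep u n).excess_le

theorem norm_sq_Gamma0 (n : ℕ) (u : X.W22) :
    ‖X.Gamma0 n u‖ ^ 2 = X.d n * ‖X.valL n u‖ ^ 2 + X.d n * ‖X.valR n u‖ ^ 2 := by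
  rw [BoundarySpace.norm_sq_eq, Gamma0_zero, Gamma0_one, norm_mul, norm_mul, norm_neg,
    Complex.norm_real, Real.norm_of_nonneg (X.r_pos n).le, mul_pow, mul_pow, r_sq]

theorem norm_sq_Gamma0_le (n : ℕ) (u : X.W22) {δ : ℝ} (hδ : 0 < δ) (hδd : δ ≤ X.d n) :
    δ * ‖X.Gamma0 n u‖ ^ 2 ≤ X.d n *
      (72 * (∫ t in X.x n..X.x (n + 1), ‖u.1 t‖ ^ 2) + 12 * δ ^ 2 * X.gapExcess n u) := by
  have h1 := (X.isSob_rep u n).trace_left hδ hδd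
  have h2 := (X.isSob_rep u n).trace_right hδ hδd
  rw [integral_repU, ← valL_rep] at h1
  rw [integral_repU, ← valR_rep] at h2
  have h3 : δ * ‖X.Gamma0 n u‖ ^ 2 =
      X.d n * (δ * ‖X.valL n u‖ ^ 2 + δ * ‖X.valR n u‖ ^ 2) := by
    rw [norm_sq_Gamma0]
    ring
  rw [h3]
  refine mul_le_mul_of_nonneg_left ?_ (X.d_pos n).le
  rw [gapExcess]
  linarith

theorem norm_sq_Gamma0_le_of_d_le {D : ℝ} (hD : ∀ n, X.d n ≤ D) (n : ℕ) (u : X.W22) :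
    ‖X.Gamma0 n u‖ ^ 2 ≤ 72 * (∫ t in X.x n..X.x (n + 1), ‖u.1 t‖ ^ 2) +
      12 * D ^ 4 * ∫ t in X.x n..X.x (n + 1), ‖deriv (deriv u.1) t‖ ^ 2 := by
  have hd := X.d_pos n
  -- The trace inequality with `δ` the full length of the gap.
  have h1 := le_of_mul_le_mul_left (X.norm_sq_Gamma0_le n u hd le_rfl) hd
  have h2 := X.gapExcess_le n u
  have hw : 0 ≤ ∫ t in X.x n..X.x (n + 1), ‖deriv (deriv u.1) t‖ ^ 2 :=
    intervalIntegral.integral_nonneg (X.lt_succ n).le fun _ _ => sq_nonneg _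
  have h3 : X.d n ^ 4 ≤ D ^ 4 := pow_le_pow_left₀ hd.le (hD n) 4
  calc _ ≤ _ := h1
    _ ≤ 72 * (∫ t in X.x n..X.x (n + 1), ‖u.1 t‖ ^ 2) + 12 * X.d n ^ 2 *
        (X.d n ^ 2 * ∫ t in X.x n..X.x (n + 1), ‖deriv (deriv u.1) t‖ ^ 2) := by gcongr
    _ = 72 * (∫ t in X.x n..X.x (n + 1), ‖u.1 t‖ ^ 2) + 12 * X.d n ^ 4 *
        ∫ t in X.x n..X.x (n + 1), ‖deriv (deriv u.1) t‖ ^ 2 := by ring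
    _ ≤ _ := by gcongr

/-- The factor `dₙ³` in the bound for the two boundary values is exactly removed by the weight
`dₙ^{-3/2}`; no bound on the lengths enters. -/
theorem norm_sq_Gamma1_le (n : ℕ) (u : X.W22) :
    ‖X.Gamma1 n u‖ ^ 2 ≤ 2 * ∫ t in X.x n..X.x (n + 1), ‖deriv (deriv u.1) t‖ ^ 2 := by
  have hS := X.isSob_rep u n
  have h1 := hS.norm_mul_V_sub_sq_le (left_mem_Icc.2 hS.lt.le)
  have h2 := hS.norm_mul_V_sub_sq_le (right_mem_Icc.2 hS.lt.le)
  rw [← valL_rep, ← valR_rep, ← derivL_rep] at h1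
  rw [← valL_rep, ← valR_rep, ← derivR_rep] at h2
  change _ ≤ X.d n ^ 3 * _ at h1
  change _ ≤ X.d n ^ 3 * _ at h2
  have hr3 : 0 < X.d n ^ 3 := pow_pos (X.d_pos n) 3
  rw [BoundarySpace.norm_sq_eq, Gamma1_zero, Gamma1_one, norm_div, norm_div, norm_pow,
    Complex.norm_real, Real.norm_of_nonneg (X.r_pos n).le, div_pow, div_pow, ← pow_mul,
    show 3 * 2 = 2 * 3 from rfl, pow_mul, r_sq, ← add_div, div_le_iff₀ hr3]
  change ‖((X.d n : ℝ) : ℂ) * _ + _‖ ^ 2 ≤ _ at h1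
  change ‖((X.d n : ℝ) : ℂ) * _ + _‖ ^ 2 ≤ _ at h2
  linarith

theorem hasSum_toL2 (u : X.W22) :
    HasSum (fun n => ∫ t in X.x n..X.x (n + 1), ‖u.1 t‖ ^ 2) (‖X.toL2 u‖ ^ 2) :=
  X.hasSum_norm_sq u.2.memLp

theorem hasSum_negD2 (u : X.W22) :
    HasSum (fun n => ∫ t in X.x n..X.x (n + 1), ‖deriv (deriv u.1) t‖ ^ 2) (‖X.negD2 u‖ ^ 2) := by
  have h := X.hasSum_norm_sq u.2.memLp_deriv2
  rw [← norm_neg] at h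
  exact h

theorem Gamma0_add (n : ℕ) (u v : X.W22) : X.Gamma0 n (u + v) = X.Gamma0 n u + X.Gamma0 n v := by
  ext i
  fin_cases i <;> simp [Gamma0] <;> ring

theorem Gamma0_smul (n : ℕ) (c : ℂ) (u : X.W22) : X.Gamma0 n (c • u) = c • X.Gamma0 n u := by
  ext i
  fin_cases i <;> simp [Gamma0] <;> ring

theorem Gamma1_add (n : ℕ) (u v : X.W22) : X.Gamma1 n (u + v) = X.Gamma1 n u + X.Gamma1 n v := by
  ext i
  fin_cases i <;> simp [Gamma1] <;> ring

theorem Gamma1_smul (n : ℕ) (c : ℂ) (u : X.W22) : X.Gamma1 n (c • u) = c • X.Gamma1 n u := by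
  ext i
  fin_cases i <;> simp [Gamma1] <;> ring

variable {X} in
theorem summable_Gamma0 (hd : BddAbove (range X.d)) (u : X.W22) :
    Summable fun n => ‖X.Gamma0 n u‖ ^ 2 := by
  obtain ⟨D, hD⟩ := hd
  exact Summable.of_nonneg_of_le (fun _ => sq_nonneg _)
    (fun n => X.norm_sq_Gamma0_le_of_d_le (fun n => hD ⟨n, rfl⟩) n u)
    (((X.hasSum_toL2 u).summable.mul_left _).add ((X.hasSum_negD2 u).summable.mul_left _))

theorem summable_Gamma1 (u : X.W22) : Summable fun n => ‖X.Gamma1 n u‖ ^ 2 :=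
  Summable.of_nonneg_of_le (fun _ => sq_nonneg _) (fun n => X.norm_sq_Gamma1_le n u)
    ((X.hasSum_negD2 u).summable.mul_left _)

/-- The boundary map `u ↦ {Γ₀ u, Γ₁ u}`. -/
def gamma (hd : BddAbove (range X.d)) : X.W22 →ₗ[ℂ] BoundarySpace × BoundarySpace where
  toFun u := (BoundarySpace.mk (fun n => X.Gamma0 n u) (summable_Gamma0 hd u),
    BoundarySpace.mk (fun n => X.Gamma1 n u) (X.summable_Gamma1 u))
  map_add' u v := Prod.ext (lp.ext (funext fun n => X.Gamma0_add n u v))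
    (lp.ext (funext fun n => X.Gamma1_add n u v))
  map_smul' c u := Prod.ext (lp.ext (funext fun n => X.Gamma0_smul n c u))
    (lp.ext (funext fun n => X.Gamma1_smul n c u))

variable (hd : BddAbove (range X.d))

theorem gamma_fst (u : X.W22) (n : ℕ) : (X.gamma hd u).1 n = X.Gamma0 n u := rfl

theorem gamma_snd (u : X.W22) (n : ℕ) : (X.gamma hd u).2 n = X.Gamma1 n u := rfl

theorem norm_gamma_fst_sq_le {D : ℝ} (hD : ∀ n, X.d n ≤ D) (u : X.W22) :
    ‖(X.gamma hd u).1‖ ^ 2 ≤ 72 * ‖X.toL2 u‖ ^ 2 + 12 * D ^ 4 * ‖X.negD2 u‖ ^ 2 :=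
  hasSum_le (fun n => X.norm_sq_Gamma0_le_of_d_le hD n u)
    (BoundarySpace.hasSum_norm_sq (X.gamma hd u).1)
    (((X.hasSum_toL2 u).mul_left _).add ((X.hasSum_negD2 u).mul_left _))

theorem norm_gamma_snd_sq_le (u : X.W22) :
    ‖(X.gamma hd u).2‖ ^ 2 ≤ 2 * ‖X.negD2 u‖ ^ 2 :=
  hasSum_le (fun n => X.norm_sq_Gamma1_le n u) (BoundarySpace.hasSum_norm_sq (X.gamma hd u).2)
    ((X.hasSum_negD2 u).mul_left _)

theorem exists_norm_gamma_le : ∃ C, ∀ u : X.W22, ‖X.gamma hd u‖ ≤ C * ‖X.graphMap u‖ := by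
  have hd' := hd
  obtain ⟨D, hD⟩ := hd'
  refine ⟨Real.sqrt (72 + 12 * D ^ 4), fun u => ?_⟩
  have h1 := X.norm_gamma_fst_sq_le hd (fun n => hD ⟨n, rfl⟩) u
  have h2 := X.norm_gamma_snd_sq_le hd u
  have n1 : ‖X.toL2 u‖ ≤ ‖X.graphMap u‖ := norm_fst_le (X.graphMap u)
  have n2 : ‖X.negD2 u‖ ≤ ‖X.graphMap u‖ := norm_snd_le (X.graphMap u)
  have n1' : ‖X.toL2 u‖ ^ 2 ≤ ‖X.graphMap u‖ ^ 2 := pow_le_pow_left₀ (norm_nonneg _) n1 2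
  have n2' : ‖X.negD2 u‖ ^ 2 ≤ ‖X.graphMap u‖ ^ 2 := pow_le_pow_left₀ (norm_nonneg _) n2 2
  have hD4 : 0 ≤ D ^ 4 := by positivity
  rw [← Real.sqrt_sq (norm_nonneg (X.graphMap u)), ← Real.sqrt_mul (by positivity), Prod.norm_def]
  refine max_le (Real.le_sqrt_of_sq_le (h1.trans ?_)) (Real.le_sqrt_of_sq_le (h2.trans ?_))
  · rw [add_mul]
    gcongr
  · nlinarith [sq_nonneg ‖X.graphMap u‖, mul_nonneg hD4 (sq_nonneg ‖X.graphMap u‖)]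

theorem sform_gamma (u v : X.W22) :
    LinRel.sform (X.gamma hd u) (X.gamma hd v) =
      LinRel.sform (X.graphMap u) (X.graphMap v) := by
  refine HasSum.unique ?_ (X.hasSum_gapForm u v)
  refine ((lp.hasSum_inner (𝕜 := ℂ) (X.gamma hd u).2 (X.gamma hd v).1).sub
    (lp.hasSum_inner (𝕜 := ℂ) (X.gamma hd u).1 (X.gamma hd v).2)).congr_fun fun n => ?_
  exact (X.inner_Gamma_sub n u v).symm

/-- The form of the maximal operator in terms of the boundary values. -/
theorem hasSum_gapExcess (u : X.W22) :
    HasSum (fun n => X.gapExcess n u) ((inner ℂ (X.toL2 u) (X.negD2 u) : ℂ).re -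
      (inner ℂ (X.gamma hd u).1 (X.gamma hd u).2 : ℂ).re) := by
  have h := (X.hasSum_inner_negD2_right u u).sub
    (lp.hasSum_inner (𝕜 := ℂ) (X.gamma hd u).1 (X.gamma hd u).2)
  have h2 := Complex.hasSum_re h
  rw [Complex.sub_re] at h2
  refine h2.congr_fun fun n => ?_
  rw [gamma_fst, gamma_snd, integral_deriv2_mul, inner_Gamma0_Gamma1, gapExcess,
    (X.isSob_rep u n).excess_eq, ← valL_rep, ← valR_rep]
  have e1 : ∫ t in X.x n..X.x (n + 1), X.repV u n t * (starRingEnd ℂ) (X.repV u n t) =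
      ((∫ t in X.x n..X.x (n + 1), ‖X.repV u n t‖ ^ 2 : ℝ) : ℂ) := by
    rw [← intervalIntegral.integral_ofReal]
    refine intervalIntegral.integral_congr fun t _ => ?_
    simp only [Complex.mul_conj, Complex.normSq_eq_norm_sq]
  have e2 : (X.valL n u - X.valR n u) * (starRingEnd ℂ) (X.valL n u - X.valR n u) / X.d n =
      ((‖X.valR n u - X.valL n u‖ ^ 2 / (X.x (n + 1) - X.x n) : ℝ) : ℂ) := by
    rw [Complex.mul_conj, Complex.normSq_eq_norm_sq, norm_sub_rev, ← Complex.ofReal_div]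
    rfl
  rw [e1, e2]
  simp only [Complex.sub_re, Complex.neg_re, Complex.add_re, Complex.ofReal_re]
  ring

/-- A function in `W22` that is zero almost everywhere is zero on each gap by continuity, hence so
is its second derivative. Only its values outside the gaps remain free. -/
theorem graphMap_eq_zero {u : X.W22} (h : X.toL2 u = 0) : X.graphMap u = 0 := by
  have h0 : ∀ n, EqOn u.1 (fun _ => 0) (Ioo (X.x n) (X.x (n + 1))) := by
    intro n
    have h1 : u.1 =ᵐ[X.vol] 0 := by
      have h2 : u.2.memLp.toLp u.1 = MemLp.toLp (0 : ℝ → ℂ) MemLp.zero :=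
        Eq.trans h (MemLp.toLp_zero _).symm
      rwa [MemLp.toLp_eq_toLp_iff] at h2
    refine Measure.eqOn_open_of_ae_eq (μ := volume) ?_ isOpen_Ioo ?_ continuousOn_const
    · exact (ae_restrict_iff' measurableSet_Ioo).2 (X.ae_gap_of_ae_vol h1 n)
    · exact (((X.isSob_rep u n).continuousOn_U).mono Ioo_subset_Icc_self).congr (X.eqOn_repU u n)
  have h2 : u.2.memLp_deriv2.toLp (deriv (deriv u.1)) = 0 := by
    have h3 : deriv (deriv u.1) =ᵐ[X.vol] 0 := by
      refine X.ae_vol_of_forall fun n => Eventually.of_forall fun t ht => ?_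
      have hz := IsSob.zero (X.lt_succ n)
      have h4 : deriv u.1 =ᶠ[𝓝 t] fun _ => 0 := by
        filter_upwards [Ioo_mem_nhds ht.1 ht.2] with s hs using X.deriv_eqOn hz (h0 n) hs
      rw [h4.deriv_eq]
      simp
    exact (MemLp.toLp_congr u.2.memLp_deriv2 MemLp.zero h3).trans (MemLp.toLp_zero _)
  refine Prod.ext h ?_
  change -(u.2.memLp_deriv2.toLp (deriv (deriv u.1))) = 0
  rw [h2, neg_zero]

/-- The bound by the graph norm makes the boundary values independent of the representative. -/
theorem gamma_eq_of_graphMap_eq {u v : X.W22} (h : X.graphMap u = X.graphMap v) :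
    X.gamma hd u = X.gamma hd v := by
  obtain ⟨C, hC⟩ := X.exists_norm_gamma_le hd
  have := hC (u - v)
  rw [map_sub, map_sub, h, sub_self, norm_zero, mul_zero] at this
  exact sub_eq_zero.1 (norm_le_zero_iff.1 this)

theorem gamma_eq_of_toL2_eq {u v : X.W22} (h : X.toL2 u = X.toL2 v) :
    X.gamma hd u = X.gamma hd v := by
  refine X.gamma_eq_of_graphMap_eq hd ?_
  rw [← sub_eq_zero, ← map_sub]
  exact X.graphMap_eq_zero (by rw [map_sub, h, sub_self])

end PointSeq

/-! ### Polynomials with prescribed boundary values -/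

/-- The polynomial `s^{m+2} - s^{m+3}`. -/
def bump (m : ℕ) (s : ℝ) : ℝ := s ^ (m + 2) - s ^ (m + 3)

/-- The derivative of `bump`. -/
def bump' (m : ℕ) (s : ℝ) : ℝ := ((m : ℝ) + 2) * s ^ (m + 1) - ((m : ℝ) + 3) * s ^ (m + 2)

/-- The second derivative of `bump`. -/
def bump'' (m : ℕ) (s : ℝ) : ℝ :=
  ((m : ℝ) + 2) * (((m : ℝ) + 1) * s ^ m) - ((m : ℝ) + 3) * (((m : ℝ) + 2) * s ^ (m + 1))

theorem hasDerivAt_bump (m : ℕ) (s : ℝ) : HasDerivAt (bump m) (bump' m s) s := by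
  have h := (hasDerivAt_pow (m + 2) s).sub (hasDerivAt_pow (m + 3) s)
  refine h.congr_deriv ?_
  simp [bump']

theorem hasDerivAt_bump' (m : ℕ) (s : ℝ) : HasDerivAt (bump' m) (bump'' m s) s := by
  have h := ((hasDerivAt_pow (m + 1) s).const_mul ((m : ℝ) + 2)).sub
    ((hasDerivAt_pow (m + 2) s).const_mul ((m : ℝ) + 3))
  refine h.congr_deriv ?_
  simp [bump'']

theorem continuous_bump (m : ℕ) : Continuous (bump m) := by unfold bump; fun_prop

theorem continuous_bump' (m : ℕ) : Continuous (bump' m) := by unfold bump'; fun_prop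

theorem continuous_bump'' (m : ℕ) : Continuous (bump'' m) := by unfold bump''; fun_prop

/-- The polynomial is `s^m` times a factor between `0` and `1`, so it concentrates at `s = 1` as `m`
grows. -/
theorem integral_bump_sq_le (m : ℕ) : ∫ s in (0 : ℝ)..1, bump m s ^ 2 ≤ 1 / ((m : ℝ) + 1) := by
  have h1 : ∫ s in (0 : ℝ)..1, bump m s ^ 2 ≤ ∫ s in (0 : ℝ)..1, s ^ m := by
    refine intervalIntegral.integral_mono_on zero_le_one
      (((continuous_bump m).pow 2).intervalIntegrable _ _)
      ((continuous_pow m).intervalIntegrable _ _) fun s hs => ?_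
    have e1 : bump m s = s ^ m * (s ^ 2 * (1 - s)) := by rw [bump]; ring
    have h0 : 0 ≤ s ^ m := pow_nonneg hs.1 m
    have h1 : s ^ m ≤ 1 := pow_le_one₀ hs.1 hs.2
    have h2 : 0 ≤ s ^ 2 * (1 - s) := mul_nonneg (sq_nonneg _) (by linarith [hs.2])
    have h3 : s ^ 2 * (1 - s) ≤ 1 :=
      mul_le_one₀ (pow_le_one₀ hs.1 hs.2) (by linarith [hs.2]) (by linarith [hs.1])
    rw [e1, mul_pow]
    calc (s ^ m) ^ 2 * (s ^ 2 * (1 - s)) ^ 2 ≤ (s ^ m) ^ 2 * 1 :=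
          mul_le_mul_of_nonneg_left (pow_le_one₀ h2 h3) (sq_nonneg _)
      _ ≤ s ^ m := by nlinarith
  rw [integral_pow] at h1
  simpa using h1

/-- The slope at `s = 1` is `-1` for every `m`, while the energy, exactly `(m + 2) / ((2m + 3)(2m +
5))`, tends to zero. Thus end slopes can be prescribed at arbitrarily small cost in energy. -/
theorem integral_bump'_sq_le (m : ℕ) : ∫ s in (0 : ℝ)..1, bump' m s ^ 2 ≤ 1 / ((m : ℝ) + 1) := by
  have e1 : ∀ s : ℝ, bump' m s ^ 2 = ((m : ℝ) + 2) ^ 2 * s ^ (2 * m + 2) -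
      2 * ((m : ℝ) + 2) * ((m : ℝ) + 3) * s ^ (2 * m + 3) +
      ((m : ℝ) + 3) ^ 2 * s ^ (2 * m + 4) := fun s => by
    rw [bump']
    ring
  have hi : ∀ (C : ℝ) (k : ℕ), IntervalIntegrable (fun s : ℝ => C * s ^ k) volume 0 1 :=
    fun C k => (by fun_prop : Continuous fun s : ℝ => C * s ^ k).intervalIntegrable _ _
  simp only [e1]
  rw [intervalIntegral.integral_add ((hi _ _).sub (hi _ _)) (hi _ _),
    intervalIntegral.integral_sub (hi _ _) (hi _ _), intervalIntegral.integral_const_mul,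
    intervalIntegral.integral_const_mul, intervalIntegral.integral_const_mul, integral_pow,
    integral_pow, integral_pow]
  simp only [one_pow, ne_eq, not_false_eq_true, zero_pow, sub_zero, Nat.succ_ne_zero]
  push_cast
  have hm : (0 : ℝ) ≤ m := Nat.cast_nonneg m
  have e2 : ((m : ℝ) + 2) ^ 2 * (1 / (2 * (m : ℝ) + 2 + 1)) -
      2 * ((m : ℝ) + 2) * ((m : ℝ) + 3) * (1 / (2 * (m : ℝ) + 3 + 1)) +
      ((m : ℝ) + 3) ^ 2 * (1 / (2 * (m : ℝ) + 4 + 1)) =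
      ((m : ℝ) + 2) / ((2 * (m : ℝ) + 3) * (2 * (m : ℝ) + 5)) := by
    have h1 : (2 * (m : ℝ) + 2 + 1) ≠ 0 := by positivity
    have h2 : (2 * (m : ℝ) + 3 + 1) ≠ 0 := by positivity
    have h3 : (2 * (m : ℝ) + 4 + 1) ≠ 0 := by positivity
    have h4 : (2 * (m : ℝ) + 3) ≠ 0 := by positivity
    have h5 : (2 * (m : ℝ) + 5) ≠ 0 := by positivity
    field_simp
    ring
  rw [e2, div_le_div_iff₀ (by positivity) (by positivity)]
  nlinarith

theorem integral_scale_left {a c : ℝ} (hac : a < c) (φ : ℝ → ℝ) :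
    ∫ t in a..c, φ ((t - a) / (c - a)) = (c - a) * ∫ s in (0 : ℝ)..1, φ s := by
  have hd : c - a ≠ 0 := (sub_pos.2 hac).ne'
  have h1 := intervalIntegral.integral_comp_sub_right (fun t => φ (t / (c - a))) a (a := a) (b := c)
  rw [h1, intervalIntegral.integral_comp_div φ hd, sub_self, zero_div, div_self hd, smul_eq_mul]

theorem integral_scale_right {a c : ℝ} (hac : a < c) (φ : ℝ → ℝ) :
    ∫ t in a..c, φ ((c - t) / (c - a)) = (c - a) * ∫ s in (0 : ℝ)..1, φ s := by
  have hd : c - a ≠ 0 := (sub_pos.2 hac).ne'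
  have h1 := intervalIntegral.integral_comp_sub_left (fun t => φ (t / (c - a))) c (a := a) (b := c)
  rw [h1, intervalIntegral.integral_comp_div φ hd, sub_self, zero_div, div_self hd, smul_eq_mul]

/-- A bound for the integral of `|β₀ φ(1 - s) + β₁ φ(s)|²`, with `s` the relative position. -/
theorem integral_norm_combination_le {a c : ℝ} (hac : a < c) {φ : ℝ → ℝ} (hφ : Continuous φ)
    (p q : ℂ) :
    ∫ t in a..c, ‖p * (φ ((c - t) / (c - a)) : ℂ) + q * (φ ((t - a) / (c - a)) : ℂ)‖ ^ 2 ≤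
      2 * (‖p‖ ^ 2 + ‖q‖ ^ 2) * ((c - a) * ∫ s in (0 : ℝ)..1, φ s ^ 2) := by
  have hc1 : Continuous fun t : ℝ => (φ ((c - t) / (c - a))) ^ 2 := by fun_prop
  have hc2 : Continuous fun t : ℝ => (φ ((t - a) / (c - a))) ^ 2 := by fun_prop
  have h1 : ∫ t in a..c, ‖p * (φ ((c - t) / (c - a)) : ℂ) + q * (φ ((t - a) / (c - a)) : ℂ)‖ ^ 2 ≤
      ∫ t in a..c, (2 * ‖p‖ ^ 2 * φ ((c - t) / (c - a)) ^ 2 +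
        2 * ‖q‖ ^ 2 * φ ((t - a) / (c - a)) ^ 2) := by
    refine intervalIntegral.integral_mono_on hac.le
      (Continuous.intervalIntegrable (by fun_prop) _ _)
      (Continuous.intervalIntegrable (by fun_prop) _ _) fun t _ => ?_
    set A := φ ((c - t) / (c - a))
    set B := φ ((t - a) / (c - a))
    have h2 : ‖p * (A : ℂ) + q * (B : ℂ)‖ ≤ ‖p‖ * |A| + ‖q‖ * |B| := by
      refine (norm_add_le _ _).trans (le_of_eq ?_)
      rw [norm_mul, norm_mul, Complex.norm_real, Complex.norm_real, Real.norm_eq_abs,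
        Real.norm_eq_abs]
    calc _ ≤ (‖p‖ * |A| + ‖q‖ * |B|) ^ 2 := pow_le_pow_left₀ (norm_nonneg _) h2 2
      _ ≤ 2 * ((‖p‖ * |A|) ^ 2 + (‖q‖ * |B|) ^ 2) := by
          nlinarith [sq_nonneg (‖p‖ * |A| - ‖q‖ * |B|)]
      _ = _ := by rw [mul_pow, mul_pow, sq_abs, sq_abs]; ring
  refine h1.trans (le_of_eq ?_)
  rw [intervalIntegral.integral_add ((hc1.intervalIntegrable _ _).const_mul _)
    ((hc2.intervalIntegrable _ _).const_mul _), intervalIntegral.integral_const_mul,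
    intervalIntegral.integral_const_mul, integral_scale_right hac (fun s => φ s ^ 2),
    integral_scale_left hac (fun s => φ s ^ 2)]
  ring

theorem IsSob.of_hasDerivAt {a c : ℝ} (hac : a < c) {U V w : ℝ → ℂ}
    (hU : ∀ t, HasDerivAt U (V t) t) (hV : ∀ t, HasDerivAt V (w t) t) (hw : Continuous w) :
    IsSob a c U V w := by
  have hVc : Continuous V := continuous_iff_continuousAt.2 fun t => (hV t).continuousAt
  refine ⟨hac, memLp_two_of_continuousOn hw.continuousOn, fun t _ => ?_, fun t _ => ?_⟩
  · rw [intervalIntegral.integral_eq_sub_of_hasDerivAt (fun s _ => hV s)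
      (hw.intervalIntegrable _ _)]
    ring
  · rw [intervalIntegral.integral_eq_sub_of_hasDerivAt (fun s _ => hU s)
      (hVc.intervalIntegrable _ _)]
    ring

/-- The polynomial on `[a, c]` with boundary values `α₀, α₁` and derivative boundary values
`(α₁ - α₀ + β₀) / (c - a)`, `(α₁ - α₀ - β₁) / (c - a)`. -/
def interp (m : ℕ) (a c : ℝ) (α₀ α₁ β₀ β₁ : ℂ) (t : ℝ) : ℂ :=
  (α₀ * (((c - t) / (c - a) : ℝ) : ℂ) + α₁ * (((t - a) / (c - a) : ℝ) : ℂ)) +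
    (β₀ * (bump m ((c - t) / (c - a)) : ℂ) + β₁ * (bump m ((t - a) / (c - a)) : ℂ))

/-- The derivative of `interp`. -/
def interp' (m : ℕ) (a c : ℝ) (α₀ α₁ β₀ β₁ : ℂ) (t : ℝ) : ℂ :=
  (α₁ - α₀) / ((c - a : ℝ) : ℂ) + (-β₀ * (bump' m ((c - t) / (c - a)) : ℂ) +
    β₁ * (bump' m ((t - a) / (c - a)) : ℂ)) / ((c - a : ℝ) : ℂ)

/-- The second derivative of `interp`. -/
def interp'' (m : ℕ) (a c : ℝ) (β₀ β₁ : ℂ) (t : ℝ) : ℂ :=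
  (β₀ * (bump'' m ((c - t) / (c - a)) : ℂ) +
    β₁ * (bump'' m ((t - a) / (c - a)) : ℂ)) / ((c - a : ℝ) : ℂ) ^ 2

theorem hasDerivAt_relR (a c t : ℝ) :
    HasDerivAt (fun t : ℝ => (c - t) / (c - a)) (-1 / (c - a)) t := by
  simpa using ((hasDerivAt_const t c).sub (hasDerivAt_id t)).div_const (c - a)

theorem hasDerivAt_relL (a c t : ℝ) :
    HasDerivAt (fun t : ℝ => (t - a) / (c - a)) (1 / (c - a)) t := by
  simpa using ((hasDerivAt_id t).sub_const a).div_const (c - a)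

theorem isSob_interp (m : ℕ) {a c : ℝ} (hac : a < c) (α₀ α₁ β₀ β₁ : ℂ) :
    IsSob a c (interp m a c α₀ α₁ β₀ β₁) (interp' m a c α₀ α₁ β₀ β₁) (interp'' m a c β₀ β₁) := by
  refine IsSob.of_hasDerivAt hac (fun t => ?_) (fun t => ?_) ?_
  · have hR := hasDerivAt_relR a c t
    have hL := hasDerivAt_relL a c t
    have h := ((hR.ofReal_comp.const_mul α₀).add (hL.ofReal_comp.const_mul α₁)).add
      ((((hasDerivAt_bump m _).comp t hR).ofReal_comp.const_mul β₀).add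
        (((hasDerivAt_bump m _).comp t hL).ofReal_comp.const_mul β₁))
    refine h.congr_deriv ?_
    rw [interp']
    push_cast
    ring
  · have hR := hasDerivAt_relR a c t
    have hL := hasDerivAt_relL a c t
    have h := ((((hasDerivAt_bump' m _).comp t hR).ofReal_comp.const_mul (-β₀)).add
        (((hasDerivAt_bump' m _).comp t hL).ofReal_comp.const_mul β₁)).div_const
          ((c - a : ℝ) : ℂ) |>.const_add ((α₁ - α₀) / ((c - a : ℝ) : ℂ))
    refine h.congr_deriv ?_
    rw [interp'']
    simp only [Complex.ofReal_mul, Complex.ofReal_div, Complex.ofReal_neg, Complex.ofReal_one]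
    ring
  · have := continuous_bump'' m
    unfold interp''
    fun_prop

section boundaryValues

variable (m : ℕ) {a c : ℝ} (α₀ α₁ β₀ β₁ : ℂ)

theorem interp_left (hac : a < c) : interp m a c α₀ α₁ β₀ β₁ a = α₀ := by
  have hd : c - a ≠ 0 := (sub_pos.2 hac).ne'
  simp [interp, bump, div_self hd]

theorem interp_right (hac : a < c) : interp m a c α₀ α₁ β₀ β₁ c = α₁ := by
  have hd : c - a ≠ 0 := (sub_pos.2 hac).ne'
  simp [interp, bump, div_self hd]

theorem interp'_left (hac : a < c) :
    interp' m a c α₀ α₁ β₀ β₁ a = (α₁ - α₀ + β₀) / ((c - a : ℝ) : ℂ) := by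
  have hd : c - a ≠ 0 := (sub_pos.2 hac).ne'
  simp only [interp', bump', div_self hd, sub_self, zero_div, one_pow, ne_eq, Nat.succ_ne_zero,
    not_false_eq_true, zero_pow]
  push_cast
  ring

theorem interp'_right (hac : a < c) :
    interp' m a c α₀ α₁ β₀ β₁ c = (α₁ - α₀ - β₁) / ((c - a : ℝ) : ℂ) := by
  have hd : c - a ≠ 0 := (sub_pos.2 hac).ne'
  simp only [interp', bump', div_self hd, sub_self, zero_div, one_pow, ne_eq, Nat.succ_ne_zero,
    not_false_eq_true, zero_pow]
  push_cast
  ring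

theorem integral_interp_sq_le (hac : a < c) :
    ∫ t in a..c, ‖interp m a c α₀ α₁ β₀ β₁ t‖ ^ 2 ≤
      4 * (c - a) * (‖α₀‖ ^ 2 + ‖α₁‖ ^ 2) +
      4 * (c - a) * (∫ s in (0 : ℝ)..1, bump m s ^ 2) * (‖β₀‖ ^ 2 + ‖β₁‖ ^ 2) := by
  have hb := continuous_bump m
  have h1 := integral_norm_combination_le hac continuous_id α₀ α₁
  have h2 := integral_norm_combination_le hac (continuous_bump m) β₀ β₁
  set f : ℝ → ℂ := fun t =>
    α₀ * ((id ((c - t) / (c - a)) : ℝ) : ℂ) + α₁ * ((id ((t - a) / (c - a)) : ℝ) : ℂ) with hf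
  set g : ℝ → ℂ := fun t =>
    β₀ * (bump m ((c - t) / (c - a)) : ℂ) + β₁ * (bump m ((t - a) / (c - a)) : ℂ) with hg
  have hfc : Continuous f := by
    simp only [hf, id]
    fun_prop
  have hgc : Continuous g := by fun_prop
  have h3 : ∫ t in a..c, ‖interp m a c α₀ α₁ β₀ β₁ t‖ ^ 2 ≤
      ∫ t in a..c, (2 * ‖f t‖ ^ 2 + 2 * ‖g t‖ ^ 2) := by
    refine intervalIntegral.integral_mono_on hac.le
      ((((isSob_interp m hac α₀ α₁ β₀ β₁).continuousOn_U.norm.pow 2)).intervalIntegrable_of_Icc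
        hac.le) (Continuous.intervalIntegrable (by fun_prop) _ _) fun t _ => ?_
    have h4 : ‖interp m a c α₀ α₁ β₀ β₁ t‖ ≤ ‖f t‖ + ‖g t‖ := norm_add_le (f t) (g t)
    calc _ ≤ (‖f t‖ + ‖g t‖) ^ 2 := pow_le_pow_left₀ (norm_nonneg _) h4 2
      _ ≤ _ := by nlinarith [sq_nonneg (‖f t‖ - ‖g t‖)]
  rw [intervalIntegral.integral_add (Continuous.intervalIntegrable (by fun_prop) _ _)
    (Continuous.intervalIntegrable (by fun_prop) _ _), intervalIntegral.integral_const_mul,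
    intervalIntegral.integral_const_mul] at h3
  have h5 : ∫ s in (0 : ℝ)..1, (id s) ^ 2 ≤ 1 := by
    simp only [id, integral_pow]
    norm_num
  have hd : 0 < c - a := sub_pos.2 hac
  have h6 : (‖α₀‖ ^ 2 + ‖α₁‖ ^ 2) * ((c - a) * ∫ s in (0 : ℝ)..1, (id s) ^ 2) ≤
      (‖α₀‖ ^ 2 + ‖α₁‖ ^ 2) * ((c - a) * 1) := by gcongr
  linarith

theorem integral_interp''_sq_le (hac : a < c) :
    ∫ t in a..c, ‖interp'' m a c β₀ β₁ t‖ ^ 2 ≤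
      2 * (∫ s in (0 : ℝ)..1, bump'' m s ^ 2) * (‖β₀‖ ^ 2 + ‖β₁‖ ^ 2) / (c - a) ^ 3 := by
  have h1 := integral_norm_combination_le hac (continuous_bump'' m) β₀ β₁
  have hd : 0 < c - a := sub_pos.2 hac
  simp only [interp'', norm_div, div_pow, norm_pow, Complex.norm_real, Real.norm_of_nonneg hd.le]
  rw [intervalIntegral.integral_div, div_le_div_iff₀ (by positivity) (by positivity)]
  have h2 := mul_le_mul_of_nonneg_right h1 (pow_nonneg hd.le 3)
  refine h2.trans (le_of_eq (by ring))

/-- The linear part of `interp` is its linear interpolant, so only the bumps contribute to the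
excess. -/
theorem excess_interp_le (hac : a < c) :
    IsSob.excess a c (interp m a c α₀ α₁ β₀ β₁) (interp' m a c α₀ α₁ β₀ β₁) ≤
      2 * (∫ s in (0 : ℝ)..1, bump' m s ^ 2) * (‖β₀‖ ^ 2 + ‖β₁‖ ^ 2) / (c - a) := by
  have h1 := integral_norm_combination_le hac (continuous_bump' m) (-β₀) β₁
  have hd : 0 < c - a := sub_pos.2 hac
  have h0 : ∀ t, interp' m a c α₀ α₁ β₀ β₁ t - IsSob.slope a c (interp m a c α₀ α₁ β₀ β₁) =
      (-β₀ * (bump' m ((c - t) / (c - a)) : ℂ) +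
        β₁ * (bump' m ((t - a) / (c - a)) : ℂ)) / ((c - a : ℝ) : ℂ) := fun t => by
    rw [IsSob.slope, interp_left m α₀ α₁ β₀ β₁ hac, interp_right m α₀ α₁ β₀ β₁ hac, interp']
    ring
  simp only [IsSob.excess, h0, norm_div, div_pow, Complex.norm_real, Real.norm_of_nonneg hd.le]
  rw [intervalIntegral.integral_div, div_le_div_iff₀ (by positivity) (by positivity)]
  have h2 := mul_le_mul_of_nonneg_right h1 hd.le
  rw [norm_neg] at h2
  refine h2.trans (le_of_eq (by ring))

end boundaryValues

/-! ### A right inverse of the boundary map -/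

namespace PointSeq

variable (X : PointSeq)

theorem glue_add (U U' : ℕ → ℝ → ℂ) : X.glue (U + U') = X.glue U + X.glue U' := by
  funext t
  rw [Pi.add_apply, glue, glue, glue]
  split_ifs
  · rfl
  · rw [add_zero]

theorem glue_smul (c : ℂ) (U : ℕ → ℝ → ℂ) : X.glue (c • U) = c • X.glue U := by
  funext t
  rw [Pi.smul_apply, glue, glue]
  split_ifs
  · rfl
  · rw [smul_zero]

/-- The function on the `n`-th interval with the boundary data `ω`. -/
def liftU (m : ℕ) (ω : BoundarySpace × BoundarySpace) (n : ℕ) : ℝ → ℂ :=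
  interp m (X.x n) (X.x (n + 1)) (ω.1 n 0 / X.r n) (-(ω.1 n 1 / X.r n))
    (X.r n ^ 3 * ω.2 n 0) (-(X.r n ^ 3 * ω.2 n 1))

/-- The derivative of `liftU`. -/
def liftV (m : ℕ) (ω : BoundarySpace × BoundarySpace) (n : ℕ) : ℝ → ℂ :=
  interp' m (X.x n) (X.x (n + 1)) (ω.1 n 0 / X.r n) (-(ω.1 n 1 / X.r n))
    (X.r n ^ 3 * ω.2 n 0) (-(X.r n ^ 3 * ω.2 n 1))

/-- The second derivative of `liftU`. -/
def liftD2 (m : ℕ) (ω : BoundarySpace × BoundarySpace) (n : ℕ) : ℝ → ℂ :=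
  interp'' m (X.x n) (X.x (n + 1)) (X.r n ^ 3 * ω.2 n 0) (-(X.r n ^ 3 * ω.2 n 1))

theorem isSob_lift (m : ℕ) (ω : BoundarySpace × BoundarySpace) (n : ℕ) :
    IsSob (X.x n) (X.x (n + 1)) (X.liftU m ω n) (X.liftV m ω n) (X.liftD2 m ω n) :=
  isSob_interp m (X.lt_succ n) _ _ _ _

theorem norm_sq_r_pow_three_mul (n : ℕ) (v : EuclideanSpace ℂ (Fin 2)) :
    ‖(X.r n : ℂ) ^ 3 * v 0‖ ^ 2 + ‖-((X.r n : ℂ) ^ 3 * v 1)‖ ^ 2 = X.d n ^ 3 * ‖v‖ ^ 2 := by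
  rw [BoundarySpace.norm_sq_eq, norm_neg, norm_mul, norm_mul, norm_pow, Complex.norm_real,
    Real.norm_of_nonneg (X.r_pos n).le, ← X.r_sq n]
  ring

theorem norm_sq_div_r (n : ℕ) (v : EuclideanSpace ℂ (Fin 2)) :
    X.d n * (‖v 0 / X.r n‖ ^ 2 + ‖-(v 1 / X.r n)‖ ^ 2) = ‖v‖ ^ 2 := by
  have hr := (X.r_pos n).ne'
  rw [BoundarySpace.norm_sq_eq, norm_neg, norm_div, norm_div, Complex.norm_real,
    Real.norm_of_nonneg (X.r_pos n).le, ← X.r_sq n]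
  field_simp

/-- The linear part costs a fixed multiple of the `Γ₀` data; the part carrying the `Γ₁` data is
negligible for large `m`. -/
theorem integral_liftU_le {D : ℝ} (hD : ∀ n, X.d n ≤ D) (m : ℕ)
    (ω : BoundarySpace × BoundarySpace) (n : ℕ) :
    ∫ t in X.x n..X.x (n + 1), ‖X.liftU m ω n t‖ ^ 2 ≤
      4 * ‖ω.1 n‖ ^ 2 + 4 * D ^ 4 / (m + 1) * ‖ω.2 n‖ ^ 2 := by
  have h := integral_interp_sq_le m (ω.1 n 0 / X.r n) (-(ω.1 n 1 / X.r n))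
    (X.r n ^ 3 * ω.2 n 0) (-(X.r n ^ 3 * ω.2 n 1)) (X.lt_succ n)
  rw [norm_sq_r_pow_three_mul] at h
  refine h.trans ?_
  change 4 * X.d n * _ + 4 * X.d n * _ * _ ≤ _
  rw [mul_assoc 4, norm_sq_div_r]
  have h2 := integral_bump_sq_le m
  have hd := X.d_pos n
  have h3 : X.d n ^ 4 ≤ D ^ 4 := pow_le_pow_left₀ hd.le (hD n) 4
  have h4 : 4 * X.d n * (∫ s in (0 : ℝ)..1, bump m s ^ 2) * (X.d n ^ 3 * ‖ω.2 n‖ ^ 2) ≤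
      4 * D ^ 4 / (m + 1) * ‖ω.2 n‖ ^ 2 := by
    calc _ = 4 * X.d n ^ 4 * (∫ s in (0 : ℝ)..1, bump m s ^ 2) * ‖ω.2 n‖ ^ 2 := by ring
      _ ≤ 4 * X.d n ^ 4 * (1 / ((m : ℝ) + 1)) * ‖ω.2 n‖ ^ 2 := by gcongr
      _ ≤ 4 * D ^ 4 * (1 / ((m : ℝ) + 1)) * ‖ω.2 n‖ ^ 2 := by gcongr
      _ = _ := by ring
  linarith

/-- The weights cancel, `rₙ⁶ = dₙ³`, so for each fixed `m` the lift is bounded in the graph norm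
uniformly over the gaps. -/
theorem integral_liftD2_le (m : ℕ) (ω : BoundarySpace × BoundarySpace) (n : ℕ) :
    ∫ t in X.x n..X.x (n + 1), ‖X.liftD2 m ω n t‖ ^ 2 ≤
      2 * (∫ s in (0 : ℝ)..1, bump'' m s ^ 2) * ‖ω.2 n‖ ^ 2 := by
  have h := integral_interp''_sq_le m
    (X.r n ^ 3 * ω.2 n 0) (-(X.r n ^ 3 * ω.2 n 1)) (X.lt_succ n)
  rw [norm_sq_r_pow_three_mul] at h
  refine h.trans (le_of_eq ?_)
  change _ / X.d n ^ 3 = _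
  have hd := (X.d_pos n).ne'
  field_simp

theorem excess_lift_le {D : ℝ} (hD : ∀ n, X.d n ≤ D) (m : ℕ)
    (ω : BoundarySpace × BoundarySpace) (n : ℕ) :
    IsSob.excess (X.x n) (X.x (n + 1)) (X.liftU m ω n) (X.liftV m ω n) ≤
      2 * D ^ 2 / (m + 1) * ‖ω.2 n‖ ^ 2 := by
  have h := excess_interp_le m (ω.1 n 0 / X.r n) (-(ω.1 n 1 / X.r n))
    (X.r n ^ 3 * ω.2 n 0) (-(X.r n ^ 3 * ω.2 n 1)) (X.lt_succ n)
  rw [norm_sq_r_pow_three_mul] at h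
  refine h.trans ?_
  change _ / X.d n ≤ _
  have h2 := integral_bump'_sq_le m
  have hd := X.d_pos n
  have h3 : X.d n ^ 2 ≤ D ^ 2 := pow_le_pow_left₀ hd.le (hD n) 2
  have hd' := hd.ne'
  calc _ = 2 * X.d n ^ 2 * (∫ s in (0 : ℝ)..1, bump' m s ^ 2) * ‖ω.2 n‖ ^ 2 := by field_simp
    _ ≤ 2 * X.d n ^ 2 * (1 / ((m : ℝ) + 1)) * ‖ω.2 n‖ ^ 2 := by gcongr
    _ ≤ 2 * D ^ 2 * (1 / ((m : ℝ) + 1)) * ‖ω.2 n‖ ^ 2 := by gcongr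
    _ = _ := by ring

variable {X} in
theorem summable_liftU (hd : BddAbove (range X.d)) (m : ℕ) (ω : BoundarySpace × BoundarySpace) :
    Summable fun n => ∫ t in X.x n..X.x (n + 1), ‖X.liftU m ω n t‖ ^ 2 := by
  obtain ⟨D, hD⟩ := hd
  exact Summable.of_nonneg_of_le
    (fun n => intervalIntegral.integral_nonneg (X.lt_succ n).le fun _ _ => sq_nonneg _)
    (fun n => X.integral_liftU_le (fun n => hD ⟨n, rfl⟩) m ω n)
    (((BoundarySpace.hasSum_norm_sq ω.1).summable.mul_left _).add
      ((BoundarySpace.hasSum_norm_sq ω.2).summable.mul_left _))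

theorem summable_liftD2 (m : ℕ) (ω : BoundarySpace × BoundarySpace) :
    Summable fun n => ∫ t in X.x n..X.x (n + 1), ‖X.liftD2 m ω n t‖ ^ 2 :=
  Summable.of_nonneg_of_le
    (fun n => intervalIntegral.integral_nonneg (X.lt_succ n).le fun _ _ => sq_nonneg _)
    (fun n => X.integral_liftD2_le m ω n)
    ((BoundarySpace.hasSum_norm_sq ω.2).summable.mul_left _)

/-- A right inverse of the boundary map. -/
def liftW (hd : BddAbove (range X.d)) (m : ℕ) :
    BoundarySpace × BoundarySpace →ₗ[ℂ] X.W22 where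
  toFun ω := X.glueW (X.isSob_lift m ω) (summable_liftU hd m ω) (X.summable_liftD2 m ω)
  map_add' ω η := by
    refine Subtype.ext ?_
    change X.glue _ = X.glue _ + X.glue _
    rw [← glue_add]
    congr 1
    funext n t
    simp only [liftU, interp, Pi.add_apply, Prod.fst_add, Prod.snd_add, lp.coeFn_add,
      PiLp.add_apply]
    ring
  map_smul' c ω := by
    refine Subtype.ext ?_
    change X.glue _ = c • X.glue _
    rw [← glue_smul]
    congr 1
    funext n t
    simp only [liftU, interp, Pi.smul_apply, Prod.smul_fst, Prod.smul_snd, lp.coeFn_smul,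
      PiLp.smul_apply, smul_eq_mul]
    ring

variable (hd : BddAbove (range X.d)) (m : ℕ) (ω : BoundarySpace × BoundarySpace)

theorem liftW_eqOn (n : ℕ) :
    EqOn (X.liftW hd m ω).1 (X.liftU m ω n) (Ioo (X.x n) (X.x (n + 1))) :=
  X.glue_eqOn _ n

/-- The coefficients in `liftU` invert the weights: `interp` has `d U'(a) + U(a) - U(c) = β₀` and `d
U'(c) + U(a) - U(c) = -β₁`, whence the signs and the factors `rₙ³`. -/
theorem gamma_liftW : X.gamma hd (X.liftW hd m ω) = ω := by
  have hL := fun n => X.valL_eq (X.isSob_lift m ω n) (X.liftW_eqOn hd m ω n)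
  have hR := fun n => X.valR_eq (X.isSob_lift m ω n) (X.liftW_eqOn hd m ω n)
  have hL' := fun n => X.derivL_eq (X.isSob_lift m ω n) (X.liftW_eqOn hd m ω n)
  have hR' := fun n => X.derivR_eq (X.isSob_lift m ω n) (X.liftW_eqOn hd m ω n)
  simp only [liftU, liftV, interp_left _ _ _ _ _ (X.lt_succ _),
    interp_right _ _ _ _ _ (X.lt_succ _), interp'_left _ _ _ _ _ (X.lt_succ _),
    interp'_right _ _ _ _ _ (X.lt_succ _)] at hL hR hL' hR'
  have hdd : ∀ n, ((X.x (n + 1) - X.x n : ℝ) : ℂ) = (X.r n : ℂ) ^ 2 := X.d_eq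
  refine Prod.ext (lp.ext (funext fun n => ?_)) (lp.ext (funext fun n => ?_))
  · have hr := X.r_ne_zero n
    rw [gamma_fst]
    ext i
    fin_cases i
    · change X.Gamma0 n _ 0 = ω.1 n 0
      rw [Gamma0_zero, hL]
      field_simp
    · change X.Gamma0 n _ 1 = ω.1 n 1
      rw [Gamma0_one, hR]
      field_simp
  · have hr := X.r_ne_zero n
    rw [gamma_snd]
    ext i
    fin_cases i
    · change X.Gamma1 n _ 0 = ω.2 n 0
      rw [Gamma1_zero, hL, hR, hL', hdd, d_eq]
      field_simp
      ring
    · change X.Gamma1 n _ 1 = ω.2 n 1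
      rw [Gamma1_one, hL, hR, hR', hdd, d_eq]
      field_simp
      ring

theorem norm_sq_toL2_liftW_le {D : ℝ} (hD : ∀ n, X.d n ≤ D) :
    ‖X.toL2 (X.liftW hd m ω)‖ ^ 2 ≤ 4 * ‖ω.1‖ ^ 2 + 4 * D ^ 4 / (m + 1) * ‖ω.2‖ ^ 2 := by
  refine hasSum_le (fun n => ?_) (X.hasSum_toL2 (X.liftW hd m ω))
    (((BoundarySpace.hasSum_norm_sq ω.1).mul_left _).add
      ((BoundarySpace.hasSum_norm_sq ω.2).mul_left _))
  refine le_trans (le_of_eq ?_) (X.integral_liftU_le hD m ω n)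
  exact X.integral_gap_congr fun t ht => by rw [X.liftW_eqOn hd m ω n ht]

theorem norm_sq_negD2_liftW_le :
    ‖X.negD2 (X.liftW hd m ω)‖ ^ 2 ≤ 2 * (∫ s in (0 : ℝ)..1, bump'' m s ^ 2) * ‖ω.2‖ ^ 2 := by
  refine hasSum_le (fun n => ?_) (X.hasSum_negD2 (X.liftW hd m ω))
    ((BoundarySpace.hasSum_norm_sq ω.2).mul_left _)
  refine le_trans (le_of_eq ?_) (X.integral_liftD2_le m ω n)
  rw [← setIntegral_Ioo_eq (X.lt_succ n).le, ← setIntegral_Ioo_eq (X.lt_succ n).le]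
  refine setIntegral_congr_ae measurableSet_Ioo ?_
  filter_upwards [(X.isW22_glue (X.isSob_lift m ω) (summable_liftU hd m ω)
    (X.summable_liftD2 m ω)).2 n] with t ht hm
  exact congrArg (fun z : ℂ => ‖z‖ ^ 2) (ht hm)

theorem gapExcess_eq {u : X.W22} {n : ℕ} {U V w : ℝ → ℂ} (h : IsSob (X.x n) (X.x (n + 1)) U V w)
    (hU : EqOn u.1 U (Ioo (X.x n) (X.x (n + 1)))) :
    X.gapExcess n u = IsSob.excess (X.x n) (X.x (n + 1)) U V := by
  have hs : IsSob.slope (X.x n) (X.x (n + 1)) (X.repU u n) =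
      IsSob.slope (X.x n) (X.x (n + 1)) U := by
    rw [IsSob.slope, IsSob.slope, ← valL_rep, ← valR_rep, X.valL_eq h hU, X.valR_eq h hU]
  rw [gapExcess, IsSob.excess, IsSob.excess, hs]
  exact X.integral_gap_congr fun t ht => by
    rw [← X.eqOn_repV u n ht, X.deriv_eqOn h hU ht]

/-- By `hasSum_gapExcess` the form of a lift differs from the boundary form by its total excess,
which is as small as desired when `m` is large. -/
theorem re_inner_liftW_le {D : ℝ} (hD : ∀ n, X.d n ≤ D) :
    (inner ℂ (X.toL2 (X.liftW hd m ω)) (X.negD2 (X.liftW hd m ω)) : ℂ).re ≤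
      (inner ℂ ω.1 ω.2 : ℂ).re + 2 * D ^ 2 / (m + 1) * ‖ω.2‖ ^ 2 := by
  have h := X.hasSum_gapExcess hd (X.liftW hd m ω)
  rw [gamma_liftW] at h
  have h2 := hasSum_le (fun n => ?_) h ((BoundarySpace.hasSum_norm_sq ω.2).mul_left
    (2 * D ^ 2 / (m + 1)))
  · linarith
  · rw [X.gapExcess_eq (X.isSob_lift m ω n) (X.liftW_eqOn hd m ω n)]
    exact X.excess_lift_le hD m ω n

theorem exists_norm_graphMap_liftW_le :
    ∃ C, ∀ ω, ‖X.graphMap (X.liftW hd m ω)‖ ≤ C * ‖ω‖ := by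
  have hd' := hd
  obtain ⟨D, hD⟩ := hd'
  set K := ∫ s in (0 : ℝ)..1, bump'' m s ^ 2
  have hK : 0 ≤ K := intervalIntegral.integral_nonneg zero_le_one fun _ _ => sq_nonneg _
  refine ⟨Real.sqrt (4 + 4 * D ^ 4 / (m + 1) + 2 * K), fun ω => ?_⟩
  have h1 := X.norm_sq_toL2_liftW_le hd m ω (fun n => hD ⟨n, rfl⟩)
  have h2 := X.norm_sq_negD2_liftW_le hd m ω
  have n1 : ‖ω.1‖ ^ 2 ≤ ‖ω‖ ^ 2 := pow_le_pow_left₀ (norm_nonneg _) (norm_fst_le ω) 2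
  have n2 : ‖ω.2‖ ^ 2 ≤ ‖ω‖ ^ 2 := pow_le_pow_left₀ (norm_nonneg _) (norm_snd_le ω) 2
  have hA : 0 ≤ 4 * D ^ 4 / ((m : ℝ) + 1) := by positivity
  have hω : 0 ≤ ‖ω‖ ^ 2 := sq_nonneg _
  rw [← Real.sqrt_sq (norm_nonneg ω), ← Real.sqrt_mul (by positivity), Prod.norm_def]
  refine max_le (Real.le_sqrt_of_sq_le (h1.trans ?_)) (Real.le_sqrt_of_sq_le (h2.trans ?_))
  · nlinarith [mul_le_mul_of_nonneg_left n2 hA, mul_nonneg hK hω]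
  · nlinarith [mul_le_mul_of_nonneg_left n2 hK, mul_nonneg hA hω]

/-! ### The boundary triple -/

/-- The map `graphMap` onto the adjoint of the minimal operator. -/
def graphMapAdjoint : X.W22 →ₗ[ℂ] X.Hmin.adjoint :=
  X.graphMap.codRestrict X.Hmin.adjoint X.graphMap_mem_adjoint

theorem graphMapAdjoint_surjective : Function.Surjective X.graphMapAdjoint := by
  rintro ⟨y, hy⟩
  rw [adjoint_Hmin] at hy
  obtain ⟨u, rfl⟩ := hy
  exact ⟨u, rfl⟩

/-- `graphMapAdjoint` is not injective, since functions may be changed at points of `X`; a linear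
choice of representatives is all that is needed to define `Γ`. -/
theorem exists_rightInverse_graphMapAdjoint :
    ∃ s : X.Hmin.adjoint →ₗ[ℂ] X.W22, X.graphMapAdjoint ∘ₗ s = LinearMap.id :=
  LinearMap.exists_rightInverse_of_surjective _
    (LinearMap.range_eq_top.2 X.graphMapAdjoint_surjective)

/-- The representative in `W22` of an element of the adjoint of the minimal operator. -/
def rep : X.Hmin.adjoint →ₗ[ℂ] X.W22 := X.exists_rightInverse_graphMapAdjoint.choose

theorem graphMap_rep (y : X.Hmin.adjoint) : X.graphMap (X.rep y) = y :=
  congrArg Subtype.val (LinearMap.congr_fun X.exists_rightInverse_graphMapAdjoint.choose_spec y)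

/-- The boundary triple `{l₂(ℕ, ℂ²), Γ₀, Γ₁}` for the adjoint of the minimal operator. -/
def triple : BoundaryTriple BoundarySpace X.Hmin where
  Γ := LinearMap.mkContinuousOfExistsBound (X.gamma hd ∘ₗ X.rep) <| by
    obtain ⟨C, hC⟩ := X.exists_norm_gamma_le hd
    refine ⟨C, fun y => (hC (X.rep y)).trans (le_of_eq ?_)⟩
    rw [graphMap_rep]
    rfl
  -- Any `m` would serve here; the freedom in `m` matters only for semiboundedness and for
  -- `liftDiff`.
  lift := LinearMap.mkContinuousOfExistsBound (X.graphMapAdjoint ∘ₗ X.liftW hd 0)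
    (X.exists_norm_graphMap_liftW_le hd 0)
  Γ_lift ω := (X.gamma_eq_of_graphMap_eq hd (X.graphMap_rep _)).trans (X.gamma_liftW hd 0 ω)
  green x y := by
    change LinRel.sform (X.gamma hd (X.rep x)) (X.gamma hd (X.rep y)) = _
    rw [sform_gamma, graphMap_rep, graphMap_rep]
  le_adjoint := by
    rintro _ ⟨u, -, rfl⟩
    exact X.graphMap_mem_adjoint u
  vanish := by
    rintro ⟨_, hx⟩ ⟨u, hu, rfl⟩
    have h := X.mem_W22zero.1 hu
    refine (X.gamma_eq_of_graphMap_eq hd (v := u) (X.graphMap_rep _)).trans ?_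
    refine Prod.ext (lp.ext (funext fun n => ?_)) (lp.ext (funext fun n => ?_))
    · obtain ⟨h1, h2, h3, h4⟩ := h n
      rw [gamma_fst]
      ext i
      fin_cases i
      · exact (X.Gamma0_zero n u).trans (by rw [h1, mul_zero]; rfl)
      · exact (X.Gamma0_one n u).trans (by rw [h2, mul_zero]; rfl)
    · obtain ⟨h1, h2, h3, h4⟩ := h n
      rw [gamma_snd]
      ext i
      fin_cases i
      · exact (X.Gamma1_zero n u).trans (by rw [h1, h2, h3]; simp)
      · exact (X.Gamma1_one n u).trans (by rw [h1, h2, h4]; simp)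

theorem triple_Γ_graphMap (u : X.W22) :
    (X.triple hd).Γ ⟨X.graphMap u, X.graphMap_mem_adjoint u⟩ = X.gamma hd u :=
  X.gamma_eq_of_graphMap_eq hd (X.graphMap_rep _)

theorem H_eq_ext (Θ : Submodule ℂ (BoundarySpace × BoundarySpace)) :
    X.H Θ = (X.triple hd).ext Θ := by
  ext y
  constructor
  · rintro ⟨hy, u, hu, ω, hω, h⟩
    have hy' := hy
    rw [SetLike.mem_coe, adjoint_Hmin] at hy'
    obtain ⟨v, rfl⟩ := hy'
    refine ((X.triple hd).mem_ext).2 ⟨hy, ?_⟩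
    -- The definition of `H` asks for some representative `u` of the first component; its boundary
    -- values are those of `v`, since the class in `L²` determines them.
    rw [triple_Γ_graphMap, X.gamma_eq_of_toL2_eq hd (v := u) hu.symm]
    have : X.gamma hd u = ω :=
      Prod.ext (lp.ext (funext fun n => (h n).1.symm)) (lp.ext (funext fun n => (h n).2.symm))
    rwa [this]
  · intro hy
    obtain ⟨h1, h2⟩ := ((X.triple hd).mem_ext).1 hy
    refine ⟨h1, ?_⟩
    have hy' := h1
    rw [adjoint_Hmin] at hy'
    obtain ⟨v, rfl⟩ := hy'
    rw [triple_Γ_graphMap] at h2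
    exact ⟨v, rfl, _, h2, fun n => ⟨rfl, rfl⟩⟩

theorem mem_H {Θ : Submodule ℂ (BoundarySpace × BoundarySpace)} {y : X.L2 × X.L2} :
    y ∈ X.H Θ ↔ ∃ u : X.W22, X.graphMap u = y ∧ X.gamma hd u ∈ Θ := by
  rw [X.H_eq_ext hd, BoundaryTriple.mem_ext]
  constructor
  · rintro ⟨h1, h2⟩
    have hy' := h1
    rw [adjoint_Hmin] at hy'
    obtain ⟨v, rfl⟩ := hy'
    rw [triple_Γ_graphMap] at h2
    exact ⟨v, rfl, h2⟩
  · rintro ⟨u, rfl, h⟩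
    exact ⟨X.graphMap_mem_adjoint u, by rwa [triple_Γ_graphMap]⟩

end PointSeq

/-! ### Semiboundedness -/

theorem le_of_forall_le_add_div {a b M : ℝ} (h : ∀ m : ℕ, a ≤ b + M * (1 / ((m : ℝ) + 1))) :
    a ≤ b := by
  have h1 := ((tendsto_one_div_add_atTop_nhds_zero_nat (𝕜 := ℝ)).const_mul M).const_add b
  rw [mul_zero, add_zero] at h1
  exact ge_of_tendsto' h1 h

theorem LinRel.IsLowerSemibounded.exists_nonneg {E : Type*} [NormedAddCommGroup E]
    [InnerProductSpace ℂ E] {T : Submodule ℂ (E × E)} (h : LinRel.IsLowerSemibounded T) :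
    ∃ K : ℝ, 0 ≤ K ∧ ∀ f f' : E, (f, f') ∈ T → -(K * ‖f‖ ^ 2) ≤ (inner ℂ f f' : ℂ).re := by
  obtain ⟨c, hc⟩ := h
  refine ⟨|c|, abs_nonneg c, fun f f' hf => le_trans ?_ (hc f f' hf)⟩
  rw [← neg_mul]
  exact mul_le_mul_of_nonneg_right (neg_abs_le c) (sq_nonneg _)

namespace PointSeq

variable (X : PointSeq)

/-- The trace inequality with `δ = min dₙ ε`: the coefficient of the excess becomes small with `ε`,
uniformly in `n`, at the price of a large coefficient of `‖u‖²`. The bound `dₙ ≤ δ (1 + D / ε)`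
holds in both cases of the minimum. -/
theorem norm_sq_Gamma0_le_excess {D ε : ℝ} (hD : ∀ n, X.d n ≤ D) (hε : 0 < ε) (n : ℕ)
    (u : X.W22) : ‖X.Gamma0 n u‖ ^ 2 ≤ 72 * (1 + D / ε) *
      (∫ t in X.x n..X.x (n + 1), ‖u.1 t‖ ^ 2) + 12 * (D * ε) * X.gapExcess n u := by
  have hdn := X.d_pos n
  have hD0 : 0 < D := hdn.trans_le (hD n)
  set I := ∫ t in X.x n..X.x (n + 1), ‖u.1 t‖ ^ 2
  have hI : 0 ≤ I := intervalIntegral.integral_nonneg (X.lt_succ n).le fun _ _ => sq_nonneg _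
  have hE := X.gapExcess_nonneg n u
  have hδ : 0 < min (X.d n) ε := lt_min hdn hε
  have h := X.norm_sq_Gamma0_le n u hδ (min_le_left _ _)
  refine le_of_mul_le_mul_left (h.trans ?_) hδ
  have h1 : X.d n ≤ min (X.d n) ε * (1 + D / ε) := by
    rcases le_total (X.d n) ε with h2 | h2
    · rw [min_eq_left h2]
      have : 0 ≤ X.d n * (D / ε) := by positivity
      linarith
    · rw [min_eq_right h2, mul_add, mul_div_cancel₀ _ hε.ne']
      linarith [hD n]
  have h3 : X.d n * min (X.d n) ε ≤ D * ε :=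
    mul_le_mul (hD n) (min_le_right _ _) hδ.le hD0.le
  set δ := min (X.d n) ε
  calc X.d n * (72 * I + 12 * δ ^ 2 * X.gapExcess n u)
      = 72 * I * X.d n + 12 * δ * X.gapExcess n u * (X.d n * δ) := by ring
    _ ≤ 72 * I * (δ * (1 + D / ε)) + 12 * δ * X.gapExcess n u * (D * ε) := by gcongr
    _ = _ := by ring

/-- From `H_Θ` to `Θ`, boundary data are lifted with parameter `m` and `m → ∞`; the excess
disappears and `‖u‖²` is replaced by `4‖Γ₀u‖²`. From `Θ` to `H_Θ`, the negative contribution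
`-K‖Γ₀u‖²` is absorbed by the total excess. -/
theorem isLowerSemibounded_H (hd : BddAbove (range X.d))
    {Θ : Submodule ℂ (BoundarySpace × BoundarySpace)} :
    LinRel.IsLowerSemibounded (X.H Θ) ↔ LinRel.IsLowerSemibounded Θ := by
  have hd' := hd
  obtain ⟨D, hD⟩ := hd'
  replace hD : ∀ n, X.d n ≤ D := fun n => hD ⟨n, rfl⟩
  have hD0 : 0 < D := (X.d_pos 0).trans_le (hD 0)
  constructor
  · intro h
    obtain ⟨K, hK, h⟩ := h.exists_nonneg
    refine ⟨-(4 * K), fun f f' hf => ?_⟩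
    refine le_of_forall_le_add_div (M := (K * (4 * D ^ 4) + 2 * D ^ 2) * ‖f'‖ ^ 2) fun m => ?_
    have h1 := h _ _ ((X.mem_H hd).2 ⟨X.liftW hd m (f, f'), rfl, by rwa [gamma_liftW]⟩)
    have h2 := X.re_inner_liftW_le hd m (f, f') hD
    have h3 := mul_le_mul_of_nonneg_left (X.norm_sq_toL2_liftW_le hd m (f, f') hD) hK
    have h4 := h1.trans h2
    have e1 : K * (4 * ‖f‖ ^ 2 + 4 * D ^ 4 / (m + 1) * ‖f'‖ ^ 2) =
      4 * K * ‖f‖ ^ 2 + K * (4 * D ^ 4) * ‖f'‖ ^ 2 * (1 / ((m : ℝ) + 1)) := by ring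
    have e2 : 2 * D ^ 2 / ((m : ℝ) + 1) * ‖f'‖ ^ 2 =
      2 * D ^ 2 * ‖f'‖ ^ 2 * (1 / ((m : ℝ) + 1)) := by ring
    simp only [e1, e2] at h3 h4
    linarith
  · intro h
    obtain ⟨K, hK, h⟩ := h.exists_nonneg
    -- This makes `K · 12 D ε = K / (K + 1) ≤ 1`, so that the excess term can be absorbed.
    set ε := 1 / (12 * D * (K + 1)) with hε
    have hε0 : 0 < ε := by positivity
    refine ⟨-(K * (72 * (1 + D / ε))), fun f f' hf => ?_⟩
    obtain ⟨u, hu, hu'⟩ := (X.mem_H hd).1 hf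
    obtain ⟨rfl, rfl⟩ := Prod.ext_iff.1 hu
    have h1 : -(K * ‖(X.gamma hd u).1‖ ^ 2) ≤
        (inner ℂ (X.gamma hd u).1 (X.gamma hd u).2 : ℂ).re := h _ _ hu'
    have hE := X.hasSum_gapExcess hd u
    have hE0 := hE.nonneg fun n => X.gapExcess_nonneg n u
    have h2 := hasSum_le (fun n => X.norm_sq_Gamma0_le_excess hD hε0 n u)
      (BoundarySpace.hasSum_norm_sq (X.gamma hd u).1)
      (((X.hasSum_toL2 u).mul_left _).add (hE.mul_left _))
    change -(K * (72 * (1 + D / ε))) * ‖X.toL2 u‖ ^ 2 ≤ (inner ℂ (X.toL2 u) (X.negD2 u) : ℂ).re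
    set S := (inner ℂ (X.toL2 u) (X.negD2 u) : ℂ).re
    set G := (inner ℂ (X.gamma hd u).1 (X.gamma hd u).2 : ℂ).re
    have h3 := mul_le_mul_of_nonneg_left h2 hK
    have h4 : K * (12 * (D * ε)) ≤ 1 := by
      have : K * (12 * (D * ε)) = K / (K + 1) := by
        rw [hε]
        field_simp
      rw [this, div_le_one (by positivity)]
      linarith
    have h5 := mul_le_mul_of_nonneg_right h4 hE0
    rw [mul_add, ← mul_assoc, ← mul_assoc K (12 * (D * ε))] at h3
    linarith

end PointSeq

/-! ### Compactness -/

/-- An operator is compact if it is arbitrarily small on subspaces of finite codimension. -/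
theorem isCompactOperator_of_small_on_ker {E : Type*} [NormedAddCommGroup E]
    [InnerProductSpace ℂ E] [CompleteSpace E] {T : E →L[ℂ] E}
    (h : ∀ ε : ℝ, 0 < ε → ∃ (N : ℕ) (φ : E →ₗ[ℂ] (Fin N → ℂ)), ∀ f, φ f = 0 → ‖T f‖ ≤ ε * ‖f‖) :
    IsCompactOperator T := by
  have hcl := isClosed_setOfPred_isCompactOperator (σ₁₂ := RingHom.id ℂ) (M₁ := E) (M₂ := E)
  refine hcl.closure_subset (Metric.mem_closure_iff.2 fun ε hε => ?_)
  obtain ⟨N, φ, hφ⟩ := h (ε / 2) (half_pos hε)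
  set K := LinearMap.ker φ
  -- `φ` is injective on the complement of its kernel. As `φ` is not assumed continuous, the kernel
  -- need not be closed, and the estimate is extended to its closure below.
  have hfin : FiniteDimensional ℂ Kᗮ := by
    refine FiniteDimensional.of_injective (φ ∘ₗ Kᗮ.subtype) ?_
    rw [← LinearMap.ker_eq_bot, LinearMap.ker_eq_bot']
    rintro ⟨f, hf⟩ hf0
    have h0 : f ∈ K := hf0
    have := Submodule.inner_right_of_mem_orthogonal h0 hf
    exact Subtype.ext (inner_self_eq_zero.1 this)
  have hT : ∀ f ∈ K.topologicalClosure, ‖T f‖ ≤ ε / 2 * ‖f‖ := by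
    have hc : IsClosed {f : E | ‖T f‖ ≤ ε / 2 * ‖f‖} :=
      isClosed_le T.continuous.norm (continuous_const.mul continuous_norm)
    intro f hf
    exact closure_minimal (s := (K : Set E)) (fun g hg => hφ g hg) hc hf
  refine ⟨T ∘L Kᗮ.starProjection, ?_, ?_⟩
  · have h1 : IsCompactOperator (Kᗮ.starProjection : E →L[ℂ] E) :=
      LinRel.isCompactOperator_of_range_le (V := Kᗮ) fun f =>
        Submodule.starProjection_apply_mem Kᗮ f
    exact h1.clm_comp T
  · rw [dist_eq_norm]
    refine lt_of_le_of_lt ?_ (half_lt_self hε)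
    refine ContinuousLinearMap.opNorm_le_bound _ (half_pos hε).le fun f => ?_
    have h1 : f - Kᗮ.starProjection f ∈ K.topologicalClosure := by
      rw [← Submodule.orthogonal_orthogonal_eq_closure]
      exact Submodule.sub_starProjection_mem_orthogonal f
    have h2 : (T - T ∘L Kᗮ.starProjection) f = T (f - Kᗮ.starProjection f) := by
      rw [map_sub]
      rfl
    rw [h2]
    refine (hT _ h1).trans (mul_le_mul_of_nonneg_left ?_ (half_pos hε).le)
    have h3 := Submodule.norm_sq_eq_add_norm_sq_starProjection f Kᗮ
    rw [Submodule.starProjection_orthogonal_val (K := Kᗮ)] at h3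
    have h4 : ‖f - Kᗮ.starProjection f‖ ^ 2 ≤ ‖f‖ ^ 2 := by
      linarith [sq_nonneg ‖Kᗮ.starProjection f‖]
    exact le_of_sq_le_sq h4 (norm_nonneg _)

/-- The inequality of Poincaré type for a function that vanishes at the end points and at the points
that divide the interval into `M` parts. -/
theorem IsSob.integral_norm_U_sq_le {a c : ℝ} {U V w : ℝ → ℂ} (h : IsSob a c U V w) {M : ℕ}
    (hM : 0 < M) (hc : U c = 0)
    (hU : ∀ k < M, U (a + k * ((c - a) / M)) = 0) :
    ∫ t in a..c, ‖U t‖ ^ 2 ≤ ((c - a) / M) ^ 2 * ((c - a) ^ 2 * ∫ t in a..c, ‖w t‖ ^ 2) := by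
  have hd : 0 < c - a := sub_pos.2 h.lt
  have hM' : (0 : ℝ) < M := by exact_mod_cast hM
  set s : ℕ → ℝ := fun k => a + k * ((c - a) / M) with hs
  have hs0 : s 0 = a := by simp [hs]
  have hsM : s M = c := by
    simp only [hs]
    field_simp
    ring
  have hmono : Monotone s := fun i j hij => by
    simp only [hs]
    have : (i : ℝ) ≤ j := by exact_mod_cast hij
    gcongr
  have hmem : ∀ k ≤ M, s k ∈ Icc a c := fun k hk =>
    ⟨hs0 ▸ hmono (Nat.zero_le k), hsM ▸ hmono hk⟩
  have hiU : ∀ k < M, IntervalIntegrable (fun t => ‖U t‖ ^ 2) volume (s k) (s (k + 1)) :=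
    fun k hk => ((h.continuousOn_U.norm.pow 2).mono
      (uIcc_subset_Icc (hmem k hk.le) (hmem _ hk))).intervalIntegrable
  have hiV : ∀ k < M, IntervalIntegrable (fun t => ‖V t‖ ^ 2) volume (s k) (s (k + 1)) :=
    fun k hk => ((h.continuousOn_V.norm.pow 2).mono
      (uIcc_subset_Icc (hmem k hk.le) (hmem _ hk))).intervalIntegrable
  have e1 := intervalIntegral.sum_integral_adjacent_intervals hiU
  have e2 := intervalIntegral.sum_integral_adjacent_intervals hiV
  rw [hs0, hsM] at e1 e2
  have h0 : U a = 0 := by simpa using hU 0 hM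
  have h1 := h.integral_norm_V_sq_le_of_dirichlet h0 hc
  calc ∫ t in a..c, ‖U t‖ ^ 2 ≤ ((c - a) / M) ^ 2 * ∫ t in a..c, ‖V t‖ ^ 2 := by
        rw [← e1, ← e2, Finset.mul_sum]
        refine Finset.sum_le_sum fun k hk => ?_
        have hk' := Finset.mem_range.1 hk
        have h2 := h.integral_norm_U_sub_sq_le (hmem k hk'.le) (hmem _ hk') (hmono k.le_succ)
        have h3 : s (k + 1) - s k = (c - a) / M := by
          simp only [hs]
          push_cast
          ring
        rw [h3] at h2
        refine le_trans (le_of_eq ?_) h2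
        rw [hU k hk']
        simp
    _ ≤ _ := by gcongr

/-! ### Dirichlet conditions as a reference relation -/

namespace PointSeq

variable (X : PointSeq)

/-- The boundary relation `{0} × l₂(ℕ, ℂ²)` of the Dirichlet conditions. -/
def dirichlet : Submodule ℂ (BoundarySpace × BoundarySpace) :=
  LinearMap.ker (LinearMap.fst ℂ BoundarySpace BoundarySpace)

theorem mem_dirichlet {ω : BoundarySpace × BoundarySpace} : ω ∈ dirichlet ↔ ω.1 = 0 := Iff.rfl

theorem isSelfAdjoint_dirichlet : LinRel.IsSelfAdjoint dirichlet := by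
  ext ω
  rw [mem_dirichlet, LinRel.mem_adjoint_iff_sform]
  constructor
  · intro h x hx
    rw [LinRel.sform, h, mem_dirichlet.1 hx]
    simp
  · intro h
    have := h (0, ω.1) (mem_dirichlet.2 rfl)
    rw [LinRel.sform, inner_zero_left, sub_zero] at this
    exact inner_self_eq_zero.1 this

/-- Elements `{0, h}` of this purely multivalued relation satisfy `(T - z)⁻¹ h = 0` for every `z`.
Compared with it, the resolvent of `Θ` is itself a difference of resolvents. -/
theorem resolvent_dirichlet (z : ℂ) : LinRel.resolvent dirichlet z = 0 :=
  LinRel.resolvent_eq_of_forall 0 fun x => by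
    rw [mem_dirichlet, zero_apply, eq_comm]

variable (hd : BddAbove (range X.d))

theorem val_eq_zero_of_gamma_mem_dirichlet {u : X.W22} (h : X.gamma hd u ∈ dirichlet) (n : ℕ) :
    X.valL n u = 0 ∧ X.valR n u = 0 := by
  have h1 : X.Gamma0 n u = 0 := by
    rw [← X.gamma_fst hd, mem_dirichlet.1 h]
    rfl
  have h2 := congrArg (fun v : EuclideanSpace ℂ (Fin 2) => v 0) h1
  have h3 := congrArg (fun v : EuclideanSpace ℂ (Fin 2) => v 1) h1
  simp only [Gamma0_zero, Gamma0_one] at h2 h3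
  refine ⟨?_, ?_⟩
  · simpa [X.r_ne_zero n] using h2
  · simpa [X.r_ne_zero n] using h3

theorem integral_norm_sq_le_of_dirichlet {u : X.W22} {n : ℕ} (hL : X.valL n u = 0)
    (hR : X.valR n u = 0) {M : ℕ} (hM : 0 < M)
    (hu : ∀ k < M, 0 < k → u.1 (X.x n + k * (X.d n / M)) = 0) :
    ∫ t in X.x n..X.x (n + 1), ‖u.1 t‖ ^ 2 ≤ (X.d n ^ 4 / M ^ 2) *
      ∫ t in X.x n..X.x (n + 1), ‖deriv (deriv u.1) t‖ ^ 2 := by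
  rw [← integral_repU]
  refine ((X.isSob_rep u n).integral_norm_U_sq_le hM ?_ fun k hk => ?_).trans (le_of_eq ?_)
  · rw [← valR_rep, hR]
  · rcases Nat.eq_zero_or_pos k with rfl | hk0
    · rw [Nat.cast_zero, zero_mul, add_zero, ← valL_rep, hL]
    · rw [← hu k hk hk0]
      have hM' : (0 : ℝ) < M := by exact_mod_cast hM
      have hk' : (k : ℝ) < M := by exact_mod_cast hk
      have hk0' : (0 : ℝ) < k := by exact_mod_cast hk0
      have hdn := X.d_pos n
      change X.repU u n (X.x n + k * (X.d n / M)) = _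
      refine (X.eqOn_repU u n ⟨?_, ?_⟩).symm
      · have : 0 < k * (X.d n / M) := by positivity
        linarith
      · have h1 : (k : ℝ) * (X.d n / M) < M * (X.d n / M) := by gcongr
        rw [mul_div_cancel₀ _ hM'.ne'] at h1
        have h2 : X.d n = X.x (n + 1) - X.x n := rfl
        linarith
  · change (X.d n / M) ^ 2 * (X.d n ^ 2 * _) = _
    ring

/-- On all but finitely many gaps the Poincaré inequality has a small constant because `dₙ` is
small. On each of the first `N` gaps the constant is made small by requiring zeros at division
points, which is a finite number of linear conditions. -/
theorem isCompactOperator_resolvent_dirichlet (hd : BddAbove (range X.d))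
    (h : Tendsto X.d atTop (𝓝 0)) :
    IsCompactOperator (LinRel.resolvent (X.H dirichlet) Complex.I) := by
  have hsa : LinRel.IsSelfAdjoint (X.H dirichlet) := by
    rw [X.H_eq_ext hd]
    exact (X.triple hd).isSelfAdjoint_ext.2 isSelfAdjoint_dirichlet
  have hI := hsa.I_mem_resolventSet
  set R := LinRel.resolvent (X.H dirichlet) Complex.I with hR
  have hmem : ∀ f, (R f, f + Complex.I • R f) ∈ X.H dirichlet := LinRel.resolvent_mem hI
  have hadj : ∀ f, (R f, f + Complex.I • R f) ∈ X.Hmin.adjoint := fun f => (hmem f).1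
  let A : X.L2 →ₗ[ℂ] X.Hmin.adjoint := LinearMap.codRestrict X.Hmin.adjoint
    ((R : X.L2 →ₗ[ℂ] X.L2).prod (LinearMap.id + Complex.I • (R : X.L2 →ₗ[ℂ] X.L2))) fun f => by
      simpa using hadj f
  let W : X.L2 →ₗ[ℂ] X.W22 := X.rep ∘ₗ A
  have hW : ∀ f, X.graphMap (W f) = (R f, f + Complex.I • R f) := fun f => X.graphMap_rep (A f)
  have hW1 : ∀ f, X.toL2 (W f) = R f := fun f => congrArg Prod.fst (hW f)
  have hW2 : ∀ f, X.negD2 (W f) = f + Complex.I • R f := fun f => congrArg Prod.snd (hW f)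
  have hWd : ∀ f n, X.valL n (W f) = 0 ∧ X.valR n (W f) = 0 := fun f n => by
    obtain ⟨u, hu, hu'⟩ := (X.mem_H hd).1 (hmem f)
    rw [X.gamma_eq_of_graphMap_eq hd (hu.trans (hW f).symm)] at hu'
    exact X.val_eq_zero_of_gamma_mem_dirichlet hd hu' n
  have hW2n : ∀ f, ‖X.negD2 (W f)‖ ≤ (1 + ‖R‖) * ‖f‖ := fun f => by
    rw [hW2]
    refine (norm_add_le _ _).trans ?_
    rw [norm_smul, Complex.norm_I, one_mul, add_mul, one_mul]
    gcongr
    exact R.le_opNorm f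
  refine isCompactOperator_of_small_on_ker fun ε hε => ?_
  set C := 1 + ‖R‖ with hC
  have hC0 : 0 < C := by positivity
  have h4 : Tendsto (fun n => X.d n ^ 4) atTop (𝓝 0) := by simpa using h.pow 4
  obtain ⟨N, hN⟩ := eventually_atTop.1 (h4.eventually_le_const
    (show (0 : ℝ) < (ε / C) ^ 2 by positivity))
  have hd' := hd
  obtain ⟨D, hD⟩ := hd'
  -- With `M` parts the Poincaré constant is `dₙ⁴ / M²`, which is at most `(ε / C)²` for this `M`.
  obtain ⟨M, hM⟩ := exists_nat_gt (D ^ 4 / (ε / C) ^ 2)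
  have hM0 : (0 : ℝ) < M := lt_of_le_of_lt (by positivity) hM
  have hM1 : (1 : ℝ) ≤ M := by exact_mod_cast Nat.one_le_iff_ne_zero.2 (by rintro rfl; simp at hM0)
  let e := finProdFinEquiv (m := N) (n := M)
  -- The index `k = 0` evaluates the representative at `xₙ` itself; this superfluous condition is
  -- harmless and keeps the indexing a product.
  let φ : X.L2 →ₗ[ℂ] (Fin (N * M) → ℂ) := LinearMap.pi fun j =>
    LinearMap.proj (X.x (e.symm j).1 + (e.symm j).2 * (X.d (e.symm j).1 / M)) ∘ₗ
      X.W22.subtype ∘ₗ W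
  refine ⟨N * M, φ, fun f hf => ?_⟩
  have hzero : ∀ n < N, ∀ k < M, (W f).1 (X.x n + k * (X.d n / M)) = 0 := fun n hn k hk => by
    have := congrFun hf (e (⟨n, hn⟩, ⟨k, hk⟩))
    simpa [φ] using this
  have hgap : ∀ n, ∫ t in X.x n..X.x (n + 1), ‖(W f).1 t‖ ^ 2 ≤ (ε / C) ^ 2 *
      ∫ t in X.x n..X.x (n + 1), ‖deriv (deriv (W f).1) t‖ ^ 2 := fun n => by
    have hI : 0 ≤ ∫ t in X.x n..X.x (n + 1), ‖deriv (deriv (W f).1) t‖ ^ 2 :=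
      intervalIntegral.integral_nonneg (X.lt_succ n).le fun _ _ => sq_nonneg _
    rcases lt_or_ge n N with hn | hn
    · refine (X.integral_norm_sq_le_of_dirichlet (hWd f n).1 (hWd f n).2
        (M := M) (by exact_mod_cast hM0) fun k hk _ => hzero n hn k hk).trans
        (mul_le_mul_of_nonneg_right ?_ hI)
      have h5 : X.d n ^ 4 ≤ D ^ 4 := pow_le_pow_left₀ (X.d_pos n).le (hD ⟨n, rfl⟩) 4
      rw [div_lt_iff₀ (by positivity)] at hM
      rw [div_le_iff₀ (by positivity)]
      have h6 : (M : ℝ) ≤ M ^ 2 := by nlinarith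
      calc X.d n ^ 4 ≤ D ^ 4 := h5
        _ ≤ M * (ε / C) ^ 2 := hM.le
        _ ≤ M ^ 2 * (ε / C) ^ 2 := by gcongr
        _ = _ := mul_comm _ _
    -- One part suffices: there are no interior division points and no conditions on these gaps.
    · refine (X.integral_norm_sq_le_of_dirichlet (hWd f n).1 (hWd f n).2
        (M := 1) one_pos fun k hk hk0 => by omega).trans
        (mul_le_mul_of_nonneg_right ?_ hI)
      simpa using hN n hn
  have h5 := hasSum_le hgap (X.hasSum_toL2 (W f)) ((X.hasSum_negD2 (W f)).mul_left _)
  rw [hW1, ← mul_pow] at h5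
  have h6 := le_of_sq_le_sq h5 (by positivity)
  calc ‖R f‖ ≤ ε / C * ‖X.negD2 (W f)‖ := h6
    _ ≤ ε / C * (C * ‖f‖) := by gcongr; exact hW2n f
    _ = ε * ‖f‖ := by field_simp

/-! ### The lengths of the intervals -/

theorem integral_bump_sub_pos : 0 < ∫ s in (0 : ℝ)..1, (bump 0 s - bump 1 s) ^ 2 := by
  refine intervalIntegral.intervalIntegral_pos_of_pos_on
    (Continuous.intervalIntegrable
      (((continuous_bump 0).sub (continuous_bump 1)).pow 2) _ _) (fun s hs => ?_) one_pos
  have h1 : bump 0 s - bump 1 s = s ^ 2 * (1 - s) ^ 2 := by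
    rw [bump, bump]
    ring
  have h2 : 0 < s := hs.1
  have h3 : 0 < 1 - s := sub_pos.2 hs.2
  rw [h1]
  positivity

/-- A function with the boundary data zero. -/
def liftDiff : BoundarySpace →ₗ[ℂ] X.W22 :=
  (X.liftW hd 0 - X.liftW hd 1) ∘ₗ LinearMap.inr ℂ BoundarySpace BoundarySpace

theorem gamma_liftDiff (η : BoundarySpace) : X.gamma hd (X.liftDiff hd η) = 0 := by
  change X.gamma hd (X.liftW hd 0 (0, η) - X.liftW hd 1 (0, η)) = 0
  rw [map_sub, gamma_liftW, gamma_liftW, sub_self]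

theorem exists_norm_graphMap_liftDiff_le :
    ∃ C, ∀ η, ‖X.graphMap (X.liftDiff hd η)‖ ≤ C * ‖η‖ := by
  obtain ⟨C, hC⟩ := X.exists_norm_graphMap_liftW_le hd 0
  obtain ⟨C', hC'⟩ := X.exists_norm_graphMap_liftW_le hd 1
  refine ⟨C + C', fun η => ?_⟩
  have h1 : ‖((0, η) : BoundarySpace × BoundarySpace)‖ = ‖η‖ := by
    rw [Prod.norm_def, norm_zero]
    exact max_eq_right (norm_nonneg _)
  change ‖X.graphMap (X.liftW hd 0 (0, η) - X.liftW hd 1 (0, η))‖ ≤ _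
  rw [map_sub, add_mul]
  refine (norm_sub_le _ _).trans (add_le_add ?_ ?_)
  · exact h1 ▸ hC (0, η)
  · exact h1 ▸ hC' (0, η)

/-- On the `n`-th gap the function is `rₙ³ s² (1 - s)²`, with `s` the relative distance from the
right end; `rₙ⁶ = dₙ³`, and the change of variable gives one more factor `dₙ`. -/
theorem le_norm_sq_toL2_liftDiff {η : BoundarySpace} {n : ℕ} (h0 : η n 0 = 1) (h1 : η n 1 = 0) :
    X.d n ^ 4 * (∫ s in (0 : ℝ)..1, (bump 0 s - bump 1 s) ^ 2) ≤
      ‖X.toL2 (X.liftDiff hd η)‖ ^ 2 := by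
  refine le_trans (le_of_eq ?_) (le_hasSum (X.hasSum_toL2 (X.liftDiff hd η)) n fun k _ =>
    intervalIntegral.integral_nonneg (X.lt_succ k).le fun _ _ => sq_nonneg _)
  have h2 := integral_scale_right (X.lt_succ n) fun s => X.d n ^ 3 * (bump 0 s - bump 1 s) ^ 2
  rw [intervalIntegral.integral_const_mul (X.d n ^ 3) fun s : ℝ => (bump 0 s - bump 1 s) ^ 2] at h2
  calc _ = (X.x (n + 1) - X.x n) * (X.d n ^ 3 *
        ∫ s in (0 : ℝ)..1, (bump 0 s - bump 1 s) ^ 2) := by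
        change _ = X.d n * _
        ring
    _ = _ := h2.symm
    _ = _ := X.integral_gap_congr fun t ht => by
        have h3 : (X.liftDiff hd η).1 t = X.liftU 0 (0, η) n t - X.liftU 1 (0, η) n t := by
          rw [← X.liftW_eqOn hd 0 (0, η) n ht, ← X.liftW_eqOn hd 1 (0, η) n ht]
          rfl
        have h4 : (X.liftDiff hd η).1 t = (X.r n : ℂ) ^ 3 *
            ((bump 0 ((X.x (n + 1) - t) / (X.x (n + 1) - X.x n)) -
              bump 1 ((X.x (n + 1) - t) / (X.x (n + 1) - X.x n)) : ℝ) : ℂ) := by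
          rw [h3, liftU, liftU, interp, interp]
          simp only [h0, h1]
          push_cast
          ring
        rw [h4, norm_mul, norm_pow, Complex.norm_real, Complex.norm_real, mul_pow, Real.norm_eq_abs,
          Real.norm_eq_abs, sq_abs, ← pow_mul, pow_mul', sq_abs, r_sq]

/-- If infinitely many gaps have length at least `ε`, the functions `liftDiff` of unit data on these
gaps are bounded in the graph norm and uniformly separated in `L²`. Having zero boundary data, they
lie in the domain of every `H_Θ`, so they are images of a bounded sequence under the resolvent,
without a convergent subsequence. -/
theorem tendsto_d_of_isCompactOperator (hd : BddAbove (range X.d))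
    {Θ : Submodule ℂ (BoundarySpace × BoundarySpace)}
    (hI : Complex.I ∈ LinRel.resolventSet (X.H Θ))
    (hR : IsCompactOperator (LinRel.resolvent (X.H Θ) Complex.I)) :
    Tendsto X.d atTop (𝓝 0) := by
  by_contra hcon
  have hfreq : ∃ ε > 0, ∃ᶠ n in atTop, ε ≤ X.d n := by
    by_contra! h
    refine hcon (Metric.tendsto_atTop'.2 fun ε hε => ?_)
    have h1 := h ε hε
    obtain ⟨N, hN⟩ := eventually_atTop.1 h1
    refine ⟨N, fun n hn => ?_⟩
    rw [Real.dist_eq, sub_zero, abs_of_pos (X.d_pos n)]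
    exact hN n hn.le
  obtain ⟨ε, hε, hfreq⟩ := hfreq
  obtain ⟨φ, hφ, hφε⟩ := extraction_of_frequently_atTop hfreq
  obtain ⟨C, hC⟩ := X.exists_norm_graphMap_liftDiff_le hd
  set κ := ∫ s in (0 : ℝ)..1, (bump 0 s - bump 1 s) ^ 2
  have hκ : 0 < κ := integral_bump_sub_pos
  let e : ℕ → BoundarySpace := fun k => lp.single 2 (φ k) (EuclideanSpace.single 0 1)
  have he : ∀ k, ‖e k‖ = 1 := fun k => by
    simp [e, lp.norm_single]
  have hee : ∀ j k, j ≠ k → (e j - e k) (φ j) = EuclideanSpace.single 0 1 := fun j k hjk => by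
    have h1 : φ j ≠ φ k := fun h => hjk (hφ.injective h)
    simp [e, lp.single_apply, h1]
  -- The image of the bump under `H_Θ - i`, which the resolvent sends back to the bump.
  let y : ℕ → X.L2 := fun k =>
    X.negD2 (X.liftDiff hd (e k)) - Complex.I • X.toL2 (X.liftDiff hd (e k))
  have hy : ∀ k, y k ∈ Metric.closedBall 0 (C + C) := fun k => by
    have h1 := hC (e k)
    rw [he, mul_one] at h1
    rw [mem_closedBall_zero_iff]
    refine (norm_sub_le _ _).trans (add_le_add ?_ ?_)
    · exact (norm_snd_le (X.graphMap (X.liftDiff hd (e k)))).trans h1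
    · rw [norm_smul, Complex.norm_I, one_mul]
      exact (norm_fst_le (X.graphMap (X.liftDiff hd (e k)))).trans h1
  have hRy : ∀ k, LinRel.resolvent (X.H Θ) Complex.I (y k) = X.toL2 (X.liftDiff hd (e k)) :=
    fun k => (LinRel.mem_iff_resolvent hI).1 ((X.mem_H hd).2 ⟨X.liftDiff hd (e k), rfl, by
      rw [gamma_liftDiff]
      exact Θ.zero_mem⟩)
  obtain ⟨K, hK, hsub⟩ := hR.image_closedBall_subset_compact (C + C)
  obtain ⟨g, -, ψ, hψ, hlim⟩ := hK.tendsto_subseq (x := fun k => X.toL2 (X.liftDiff hd (e k)))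
    fun k => hsub ⟨y k, hy k, hRy k⟩
  have hδ : 0 < Real.sqrt (ε ^ 4 * κ) := Real.sqrt_pos.2 (by positivity)
  obtain ⟨N, hN⟩ := Metric.cauchySeq_iff'.1 hlim.cauchySeq _ hδ
  have h1 := hN (N + 1) N.le_succ
  rw [dist_eq_norm] at h1
  simp only [Function.comp] at h1
  have hne : ψ (N + 1) ≠ ψ N := (hψ N.lt_succ_self).ne'
  rw [← map_sub, ← map_sub] at h1
  -- The data of the difference of two bumps, read on the gap of the first, are those of a single
  -- bump, so the lower bound applies.
  have h2 := X.le_norm_sq_toL2_liftDiff hd (η := e (ψ (N + 1)) - e (ψ N)) (n := φ (ψ (N + 1)))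
    (by rw [hee _ _ hne]; simp) (by rw [hee _ _ hne]; simp)
  have h3 : ε ^ 4 * κ ≤ X.d (φ (ψ (N + 1))) ^ 4 * κ := by
    have := hφε (ψ (N + 1))
    gcongr
  exact absurd (Real.sqrt_le_iff.2 ⟨norm_nonneg _, h3.trans h2⟩) (not_le.2 h1)

/-- Both sides are compactness statements at `i`. The comparison theorem with `p = ∞` and the
Dirichlet relation turns compactness of the resolvent of `Θ` into compactness of the difference
between the resolvent of `H_Θ` and the Dirichlet one, and the latter is compact as soon as `dₙ → 0`.
-/
theorem hasDiscreteSpectrum_H (hd : BddAbove (range X.d))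
    {Θ : Submodule ℂ (BoundarySpace × BoundarySpace)}
    (hH : LinRel.IsSelfAdjoint (X.H Θ)) :
    LinRel.HasDiscreteSpectrum (X.H Θ) ↔
      Tendsto X.d atTop (𝓝 0) ∧ LinRel.HasDiscreteSpectrum Θ := by
  have hΘ : LinRel.IsSelfAdjoint Θ := by
    rw [X.H_eq_ext hd] at hH
    exact (X.triple hd).isSelfAdjoint_ext.1 hH
  have hH' : LinRel.IsSelfAdjoint (X.H dirichlet) := by
    rw [X.H_eq_ext hd]
    exact (X.triple hd).isSelfAdjoint_ext.2 isSelfAdjoint_dirichlet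
  rw [hH.hasDiscreteSpectrum_iff, hΘ.hasDiscreteSpectrum_iff]
  have hI := hH.I_mem_resolventSet
  have hI' := hH'.I_mem_resolventSet
  have key : IsCompactOperator (LinRel.resolvent (X.H Θ) Complex.I -
        LinRel.resolvent (X.H dirichlet) Complex.I) ↔
      IsCompactOperator (LinRel.resolvent Θ Complex.I) := by
    rw [X.H_eq_ext hd] at hI hI'
    rw [X.H_eq_ext hd Θ, X.H_eq_ext hd dirichlet]
    have h := (X.triple hd).memSchatten_ext (p := ⊤) hI hI' hΘ.I_mem_resolventSet
      isSelfAdjoint_dirichlet.I_mem_resolventSet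
    rw [MemSchatten, MemSchatten, if_pos rfl, if_pos rfl, resolvent_dirichlet, sub_zero] at h
    exact h
  constructor
  · intro hc
    have ht := X.tendsto_d_of_isCompactOperator hd hI hc
    exact ⟨ht, key.1 (hc.sub (X.isCompactOperator_resolvent_dirichlet hd ht))⟩
  · rintro ⟨ht, hc⟩
    have h1 := (key.2 hc).add (X.isCompactOperator_resolvent_dirichlet hd ht)
    simpa using h1

end PointSeq

/-! ### The four assertions combined -/

theorem theorem4p5 (X : PointSeq) (hd : BddAbove (Set.range X.d))
    (Θ Θ' : Submodule ℂ (BoundarySpace × BoundarySpace))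
    (hΘ : IsClosed (Θ : Set (BoundarySpace × BoundarySpace)))
    (hΘ' : IsClosed (Θ' : Set (BoundarySpace × BoundarySpace))) :
    ((LinRel.IsSymmetric (X.H Θ) ↔ LinRel.IsSymmetric Θ) ∧
      (LinRel.IsSelfAdjoint (X.H Θ) ↔ LinRel.IsSelfAdjoint Θ) ∧
      (LinRel.IsSymmetric (X.H Θ) →
        LinRel.deficiencyPlus (X.H Θ) = LinRel.deficiencyPlus Θ ∧
        LinRel.deficiencyMinus (X.H Θ) = LinRel.deficiencyMinus Θ)) ∧
    (LinRel.IsSymmetric (X.H Θ) →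
      (LinRel.IsLowerSemibounded (X.H Θ) ↔ LinRel.IsLowerSemibounded Θ)) ∧
    (∀ p : ENNReal, 0 < p →
      ∀ z ∈ LinRel.resolventSet (X.H Θ) ∩ LinRel.resolventSet (X.H Θ'),
      ∀ ζ ∈ LinRel.resolventSet Θ ∩ LinRel.resolventSet Θ',
        (MemSchatten p (LinRel.resolvent (X.H Θ) z - LinRel.resolvent (X.H Θ') z) ↔
          MemSchatten p (LinRel.resolvent Θ ζ - LinRel.resolvent Θ' ζ))) ∧
    (LinRel.IsSelfAdjoint (X.H Θ) →
      (LinRel.HasDiscreteSpectrum (X.H Θ) ↔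
        Filter.Tendsto X.d Filter.atTop (nhds 0) ∧ LinRel.HasDiscreteSpectrum Θ)) := by
  have hsym : LinRel.IsSymmetric (X.H Θ) ↔ LinRel.IsSymmetric Θ := by
    rw [X.H_eq_ext hd]
    exact (X.triple hd).isSymmetric_ext
  refine ⟨⟨hsym, ?_, fun hs => ?_⟩, fun _ => X.isLowerSemibounded_H hd, fun p _ z hz ζ hζ => ?_,
    X.hasDiscreteSpectrum_H hd⟩
  · rw [X.H_eq_ext hd]
    exact (X.triple hd).isSelfAdjoint_ext
  · rw [X.H_eq_ext hd]
    exact ⟨(X.triple hd).defect_ext hΘ (hsym.1 hs) (Or.inl rfl),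
      (X.triple hd).defect_ext hΘ (hsym.1 hs) (Or.inr rfl)⟩
  · rw [X.H_eq_ext hd Θ, X.H_eq_ext hd Θ'] at hz ⊢
    exact (X.triple hd).memSchatten_ext hz.1 hz.2 hζ.1 hζ.2

end
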